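/- Let $S\in M_2(\mathbb Q)$ be symmetric, $d=4\det S$, $L=\mathbb Q(\sqrt{-d})$, and let $p$ be an odd prime that is inert in the quadratic field $L$. Assume that $S\in M_2(\mathbb Z_p)$ and $d\in\mathbb Z_p^\times$ (that is, $-d$ generates the discriminant of $L_p/\mathbb Q_p$). Let $J=\begin{pmatrix}0&1_2\\-1_2&0\end{pmatrix}$ and $G=\mathrm{GSp}(4)=\{g\in GL_4: g^TJg=\mu(g)J,\ \mu(g)\in GL_1\}$, let $K_p=G(\mathbb Q_p)\cap GL_4(\mathbb Z_p)$, and let $I_p$ be the subgroup of those elements of $K_p$ that modulo $p$ have the shape $\begin{pmatrix}*&0&*&*\\ *&*&*&*\\0&0&*&*\\0&0&0&*\end{pmatrix}$. Let $T=\{g\in GL_2: g^TSg=\det(g)S\}$, embedded in $G$ by $g\mapsto\begin{pmatrix}g&0\\0&\det(g)(g^{-1})^T\end{pmatrix}$, let $U=\left\{\begin{pmatrix}1_2&X\\0&1_2\end{pmatrix}: X=X^T\right\}$, and let $R=TU$. For $l\in\mathbb Z$ and $m\ge 0$ put $h(l,m)=\mathrm{diag}(p^{2m+l},p^{m+l},1,p^m)$.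 Put $$U_{(n,q,r)}=\begin{pmatrix}1&0&n&q\\0&1&q&r\\0&0&1&0\\0&0&0&1\end{pmatrix},\qquad Z_y=\begin{pmatrix}1&y&0&0\\0&1&0&0\\0&0&1&0\\0&0&-y&1\end{pmatrix},\qquad Z_\infty=\begin{pmatrix}0&1&0&0\\1&0&0&0\\0&0&0&1\\0&0&1&0\end{pmatrix},$$ $A_x^y=U_xJZ_y$ and $B_x^y=JU_xJZ_y$, and let $$t_1=B_{(1,0,0)}^0,\ t_2=B_{(1,0,0)}^\infty,\ t_3=B_{(0,0,1)}^0,\ t_4=B_{(0,0,1)}^\infty,\ t_5=B_{(0,0,0)}^0,\ t_6=B_{(0,0,0)}^\infty,\ t_7=A_{(0,0,0)}^0,\ t_8=A_{(0,0,0)}^\infty.$$ There is a right $G(\mathbb Q_p)$-invariant Borel measure on $R(\mathbb Q_p)\backslash G(\mathbb Q_p)$ that gives the image of $K_p$ volume $1$. Let $\mathrm{vol}$ be any such measure, and for $t\in K_p$ let $I_t^{l,m}=\mathrm{vol}\big(R(\mathbb Q_p)\backslash R(\mathbb Q_p)h(l,m)tI_p\big)$. (a) For every $l\in\mathbb Z$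 and $m>0$, with $M_{l,m}=\dfrac{p^{3l+4m}}{(p+1)(p^2+1)}$, $$I_{t_1}^{l,m}=pM_{l,m},\quad I_{t_2}^{l,m}=p^2M_{l,m},\quad I_{t_3}^{l,m}=pM_{l,m},\quad I_{t_4}^{l,m}=M_{l,m},$$ $$I_{t_5}^{l,m}=M_{l,m},\quad I_{t_6}^{l,m}=p^{-1}M_{l,m},\quad I_{t_7}^{l,m}=p^2M_{l,m},\quad I_{t_8}^{l,m}=p^3M_{l,m}.$$ (b) For every $l\in\mathbb Z$, $$I_{t_1}^{l,0}=\frac{p^{3l+1}}{(p+1)(p^2+1)},\quad I_{t_2}^{l,0}=\frac{p^{3l+2}}{(p+1)(p^2+1)},\quad I_{t_5}^{l,0}=\frac{p^{3l}}{(p+1)(p^2+1)},\quad I_{t_7}^{l,0}=\frac{p^{3l+3}}{(p+1)(p^2+1)}.$$ -/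

import Mathlib

open MeasureTheory
open scoped Matrix NumberField ENNReal

/-! ### The group `G = GSp(4)` -/

section Algebra

variable {F : Type*} [Field F]

/-- The alternating matrix `J = [[0, 1₂], [-1₂, 0]]`. -/
def J4 (F : Type*) [Field F] : Matrix (Fin 4) (Fin 4) F :=
  !![ 0,  0, 1, 0;
      0,  0, 0, 1;
     -1,  0, 0, 0;
      0, -1, 0, 0]

theorem J4_mul_J4 : J4 F * J4 F = -1 := by
  ext i j
  fin_cases i <;> fin_cases j <;> simp [J4, Matrix.mul_apply, Fin.sum_univ_four]

/-- `GSp(4, F)`: the invertible `g` with `gᵀ J g = ν J` for some `ν ∈ Fˣ`. -/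
def GSp4 (F : Type*) [Field F] : Subgroup (GL (Fin 4) F) where
  carrier := {g | ∃ ν : Fˣ,
    (g : Matrix (Fin 4) (Fin 4) F)ᵀ * J4 F * (g : Matrix (Fin 4) (Fin 4) F) = (ν : F) • J4 F}
  mul_mem' := by
    rintro g h ⟨ν, hν⟩ ⟨κ, hκ⟩
    refine ⟨ν * κ, ?_⟩
    have : ((g * h : GL (Fin 4) F) : Matrix (Fin 4) (Fin 4) F)ᵀ * J4 F *
        ((g * h : GL (Fin 4) F) : Matrix (Fin 4) (Fin 4) F)
        = (h : Matrix (Fin 4) (Fin 4) F)ᵀ *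
          ((g : Matrix (Fin 4) (Fin 4) F)ᵀ * J4 F * (g : Matrix (Fin 4) (Fin 4) F)) *
          (h : Matrix (Fin 4) (Fin 4) F) := by
      simp [Matrix.transpose_mul, Matrix.mul_assoc]
    rw [this, hν, Matrix.mul_smul, Matrix.smul_mul, hκ, smul_smul, Units.val_mul]
  one_mem' := ⟨1, by simp⟩
  inv_mem' := by
    rintro g ⟨ν, hν⟩
    refine ⟨ν⁻¹, ?_⟩
    have hg : (g : Matrix (Fin 4) (Fin 4) F) * ((g⁻¹ : GL (Fin 4) F) : Matrix (Fin 4) (Fin 4) F)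
        = 1 := by
      rw [← Units.val_mul, mul_inv_cancel, Units.val_one]
    have hgt : ((g⁻¹ : GL (Fin 4) F) : Matrix (Fin 4) (Fin 4) F)ᵀ *
        (g : Matrix (Fin 4) (Fin 4) F)ᵀ = 1 := by
      rw [← Matrix.transpose_mul, hg, Matrix.transpose_one]
    have h1 : J4 F = (ν : F) • (((g⁻¹ : GL (Fin 4) F) : Matrix (Fin 4) (Fin 4) F)ᵀ * J4 F *
        ((g⁻¹ : GL (Fin 4) F) : Matrix (Fin 4) (Fin 4) F)) := by
      calc J4 F
          = (((g⁻¹ : GL (Fin 4) F) : Matrix (Fin 4) (Fin 4) F)ᵀ *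
              (g : Matrix (Fin 4) (Fin 4) F)ᵀ) * J4 F *
            ((g : Matrix (Fin 4) (Fin 4) F) *
              ((g⁻¹ : GL (Fin 4) F) : Matrix (Fin 4) (Fin 4) F)) := by
            rw [hg, hgt, Matrix.one_mul, Matrix.mul_one]
        _ = ((g⁻¹ : GL (Fin 4) F) : Matrix (Fin 4) (Fin 4) F)ᵀ *
              ((g : Matrix (Fin 4) (Fin 4) F)ᵀ * J4 F * (g : Matrix (Fin 4) (Fin 4) F)) *
              ((g⁻¹ : GL (Fin 4) F) : Matrix (Fin 4) (Fin 4) F) := by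
            simp only [Matrix.mul_assoc]
        _ = _ := by rw [hν, Matrix.mul_smul, Matrix.smul_mul]
    conv_rhs => rw [h1]
    rw [smul_smul, Units.inv_mul, one_smul]

/-- The element of `GSp(4, F)` with matrix `g`, where `gᵀ J g = ν J` and `ν ≠ 0`. -/
def GSp4.ofMatrix (g : Matrix (Fin 4) (Fin 4) F) (ν : F) (hν : ν ≠ 0)
    (h : gᵀ * J4 F * g = ν • J4 F) : GSp4 F :=
  have hinv : (ν⁻¹ • (-(J4 F) * (gᵀ * J4 F))) * g = 1 := by
    rw [Matrix.smul_mul, Matrix.mul_assoc, h, Matrix.mul_smul, smul_smul, inv_mul_cancel₀ hν,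
      one_smul, Matrix.neg_mul, J4_mul_J4, neg_neg]
  ⟨⟨g, ν⁻¹ • (-(J4 F) * (gᵀ * J4 F)), mul_eq_one_comm.mp hinv, hinv⟩,
    ⟨Units.mk0 ν hν, h⟩⟩

@[simp]
theorem GSp4.coe_ofMatrix (g : Matrix (Fin 4) (Fin 4) F) (ν : F) (hν : ν ≠ 0)
    (h : gᵀ * J4 F * g = ν • J4 F) :
    ((GSp4.ofMatrix g ν hν h : GL (Fin 4) F) : Matrix (Fin 4) (Fin 4) F) = g := rfl

theorem GSp4.ext_matrix {g h : GSp4 F}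
    (e : ((g : GL (Fin 4) F) : Matrix (Fin 4) (Fin 4) F) = ((h : GL (Fin 4) F) : Matrix _ _ F)) :
    g = h := Subtype.ext (Units.ext e)

/-- `J` as an element of `GSp(4, F)`. -/
def elJ : GSp4 F := GSp4.ofMatrix (J4 F) 1 one_ne_zero (by
  ext i j
  fin_cases i <;> fin_cases j <;> simp [J4, Matrix.mul_apply, Fin.sum_univ_four])

/-- The unipotent element `U_x`, `x = (n, q, r)`. -/
def elU (n q r : F) : GSp4 F := GSp4.ofMatrix
  !![1, 0, n, q;
     0, 1, q, r;
     0, 0, 1, 0;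
     0, 0, 0, 1] 1 one_ne_zero (by
  ext i j
  fin_cases i <;> fin_cases j <;> simp [J4, Matrix.mul_apply, Fin.sum_univ_four])

/-- The element `Z_y`, for `y ∈ F` (`some y`) or `y = ∞` (`none`). -/
def elZ : Option F → GSp4 F
  | some y => GSp4.ofMatrix
      !![1, y,  0, 0;
         0, 1,  0, 0;
         0, 0,  1, 0;
         0, 0, -y, 1] 1 one_ne_zero (by
      ext i j
      fin_cases i <;> fin_cases j <;> simp [J4, Matrix.mul_apply, Fin.sum_univ_four])
  | none => GSp4.ofMatrix
      !![0, 1, 0, 0;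
         1, 0, 0, 0;
         0, 0, 0, 1;
         0, 0, 1, 0] 1 one_ne_zero (by
      ext i j
      fin_cases i <;> fin_cases j <;> simp [J4, Matrix.mul_apply, Fin.sum_univ_four])

/-- `A_x^y = U_x J Z_y` for `x = (n, q, r)`. -/
def elA (n q r : F) (y : Option F) : GSp4 F := elU n q r * elJ * elZ y

/-- `B_x^y = J U_x J Z_y` for `x = (n, q, r)`. -/
def elB (n q r : F) (y : Option F) : GSp4 F := elJ * elU n q r * elJ * elZ y

/-- `t_1 = B_{(1,0,0)}^0`. -/
def t₁ : GSp4 F := elB 1 0 0 (some 0)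
/-- `t_2 = B_{(1,0,0)}^∞`. -/
def t₂ : GSp4 F := elB 1 0 0 none
/-- `t_3 = B_{(0,0,1)}^0`. -/
def t₃ : GSp4 F := elB 0 0 1 (some 0)
/-- `t_4 = B_{(0,0,1)}^∞`. -/
def t₄ : GSp4 F := elB 0 0 1 none
/-- `t_5 = B_{(0,0,0)}^0`. -/
def t₅ : GSp4 F := elB 0 0 0 (some 0)
/-- `t_6 = B_{(0,0,0)}^∞`. -/
def t₆ : GSp4 F := elB 0 0 0 none
/-- `t_7 = A_{(0,0,0)}^0`. -/
def t₇ : GSp4 F := elA 0 0 0 (some 0)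
/-- `t_8 = A_{(0,0,0)}^∞`. -/
def t₈ : GSp4 F := elA 0 0 0 none

/-! ### The Bessel subgroup `R = TU` -/

/-- `T(F) = {g ∈ GL₂(F) | gᵀ S g = det(g) S}`. -/
def torus (S : Matrix (Fin 2) (Fin 2) F) : Subgroup (GL (Fin 2) F) where
  carrier := {g | (g : Matrix (Fin 2) (Fin 2) F)ᵀ * S * (g : Matrix (Fin 2) (Fin 2) F)
    = (g : Matrix (Fin 2) (Fin 2) F).det • S}
  mul_mem' := by
    intro g h hg hh
    simp only [Set.mem_ofPred_eq] at hg hh ⊢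
    have : ((g * h : GL (Fin 2) F) : Matrix (Fin 2) (Fin 2) F)ᵀ * S *
        ((g * h : GL (Fin 2) F) : Matrix (Fin 2) (Fin 2) F)
        = (h : Matrix (Fin 2) (Fin 2) F)ᵀ *
          ((g : Matrix (Fin 2) (Fin 2) F)ᵀ * S * (g : Matrix (Fin 2) (Fin 2) F)) *
          (h : Matrix (Fin 2) (Fin 2) F) := by
      simp [Matrix.transpose_mul, Matrix.mul_assoc]
    rw [this, hg, Matrix.mul_smul, Matrix.smul_mul, hh, smul_smul, Units.val_mul, Matrix.det_mul]
  one_mem' := by simp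
  inv_mem' := by
    intro g hg
    simp only [Set.mem_ofPred_eq] at hg ⊢
    have h1 : (g : Matrix (Fin 2) (Fin 2) F) * ((g⁻¹ : GL (Fin 2) F) : Matrix (Fin 2) (Fin 2) F)
        = 1 := by
      rw [← Units.val_mul, mul_inv_cancel, Units.val_one]
    have h2 : ((g⁻¹ : GL (Fin 2) F) : Matrix (Fin 2) (Fin 2) F)ᵀ *
        (g : Matrix (Fin 2) (Fin 2) F)ᵀ = 1 := by
      rw [← Matrix.transpose_mul, h1, Matrix.transpose_one]
    have h3 : ((g⁻¹ : GL (Fin 2) F) : Matrix (Fin 2) (Fin 2) F).det *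
        (g : Matrix (Fin 2) (Fin 2) F).det = 1 := by
      rw [mul_comm, ← Matrix.det_mul, h1, Matrix.det_one]
    have h4 : S = (g : Matrix (Fin 2) (Fin 2) F).det •
        (((g⁻¹ : GL (Fin 2) F) : Matrix (Fin 2) (Fin 2) F)ᵀ * S *
        ((g⁻¹ : GL (Fin 2) F) : Matrix (Fin 2) (Fin 2) F)) := by
      calc S
          = (((g⁻¹ : GL (Fin 2) F) : Matrix (Fin 2) (Fin 2) F)ᵀ *
              (g : Matrix (Fin 2) (Fin 2) F)ᵀ) * S *
            ((g : Matrix (Fin 2) (Fin 2) F) *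
              ((g⁻¹ : GL (Fin 2) F) : Matrix (Fin 2) (Fin 2) F)) := by
            rw [h1, h2, Matrix.one_mul, Matrix.mul_one]
        _ = ((g⁻¹ : GL (Fin 2) F) : Matrix (Fin 2) (Fin 2) F)ᵀ *
              ((g : Matrix (Fin 2) (Fin 2) F)ᵀ * S * (g : Matrix (Fin 2) (Fin 2) F)) *
              ((g⁻¹ : GL (Fin 2) F) : Matrix (Fin 2) (Fin 2) F) := by
            simp only [Matrix.mul_assoc]
        _ = _ := by rw [hg, Matrix.mul_smul, Matrix.smul_mul]
    conv_rhs => rw [h4]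
    rw [smul_smul, h3, one_smul]

/-- The block matrix `diag(A, det(A) (A⁻¹)ᵀ)`: for `A = [[a, b], [c, d]]` the lower right block is
`[[d, -c], [-b, a]]`. -/
def leviMat (A : Matrix (Fin 2) (Fin 2) F) : Matrix (Fin 4) (Fin 4) F :=
  !![A 0 0, A 0 1, 0, 0;
     A 1 0, A 1 1, 0, 0;
     0, 0, A 1 1, -A 1 0;
     0, 0, -A 0 1, A 0 0]

theorem leviMat_one : leviMat (1 : Matrix (Fin 2) (Fin 2) F) = 1 := by
  ext i j
  fin_cases i <;> fin_cases j <;> simp [leviMat]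

theorem leviMat_mul (A B : Matrix (Fin 2) (Fin 2) F) :
    leviMat (A * B) = leviMat A * leviMat B := by
  have h00 : (A * B) 0 0 = A 0 0 * B 0 0 + A 0 1 * B 1 0 := by simp [Matrix.mul_apply]
  have h01 : (A * B) 0 1 = A 0 0 * B 0 1 + A 0 1 * B 1 1 := by simp [Matrix.mul_apply]
  have h10 : (A * B) 1 0 = A 1 0 * B 0 0 + A 1 1 * B 1 0 := by simp [Matrix.mul_apply]
  have h11 : (A * B) 1 1 = A 1 0 * B 0 1 + A 1 1 * B 1 1 := by simp [Matrix.mul_apply]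
  unfold leviMat
  rw [h00, h01, h10, h11]
  generalize A 0 0 = a, A 0 1 = b, A 1 0 = c, A 1 1 = d,
    B 0 0 = a', B 0 1 = b', B 1 0 = c', B 1 1 = d'
  ext i j
  fin_cases i <;> fin_cases j <;> simp [Matrix.mul_apply, Fin.sum_univ_four] <;> ring

theorem leviMat_similitude (A : Matrix (Fin 2) (Fin 2) F) :
    (leviMat A)ᵀ * J4 F * leviMat A = A.det • J4 F := by
  rw [Matrix.det_fin_two]
  unfold leviMat
  generalize A 0 0 = a, A 0 1 = b, A 1 0 = c, A 1 1 = d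
  ext i j
  fin_cases i <;> fin_cases j <;> simp [J4, Matrix.mul_apply, Fin.sum_univ_four] <;> ring

/-- The embedding `GL₂ → GSp(4)`, `g ↦ diag(g, det(g) (g⁻¹)ᵀ)`. -/
def leviEmb : GL (Fin 2) F →* GSp4 F where
  toFun g := GSp4.ofMatrix (leviMat (g : Matrix (Fin 2) (Fin 2) F))
    (g : Matrix (Fin 2) (Fin 2) F).det (Matrix.GeneralLinearGroup.det_ne_zero g)
    (leviMat_similitude _)
  map_one' := GSp4.ext_matrix (by rw [GSp4.coe_ofMatrix]; exact leviMat_one)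
  map_mul' g h := GSp4.ext_matrix (by
    exact leviMat_mul _ _)

theorem elU_zero : elU (0 : F) 0 0 = 1 := by
  apply GSp4.ext_matrix
  rw [elU, GSp4.coe_ofMatrix]
  ext i j
  fin_cases i <;> fin_cases j <;> simp

theorem elU_mul_elU (n q r n' q' r' : F) :
    elU n q r * elU n' q' r' = elU (n + n') (q + q') (r + r') := by
  apply GSp4.ext_matrix
  rw [Subgroup.coe_mul, Units.val_mul]
  simp only [elU, GSp4.coe_ofMatrix]
  ext i j
  fin_cases i <;> fin_cases j <;> simp [Matrix.mul_apply, Fin.sum_univ_four, add_comm]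

theorem elU_mul_leviEmb (g : GL (Fin 2) F) (n q r : F) :
    ∃ n' q' r' : F, elU n q r * leviEmb g = leviEmb g * elU n' q' r' := by
  have hd : g.1 0 0 * g.1 1 1 - g.1 0 1 * g.1 1 0 ≠ 0 := by
    rw [← Matrix.det_fin_two]; exact Matrix.GeneralLinearGroup.det_ne_zero g
  set a := g.1 0 0 with ha
  set b := g.1 0 1 with hb
  set c := g.1 1 0 with hc
  set d := g.1 1 1 with he
  obtain ⟨e, h⟩ : ∃ e, (a * d - b * c) * e = 1 := ⟨_, mul_inv_cancel₀ hd⟩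
  refine ⟨(d * (n * d - q * b) - b * (q * d - r * b)) * e,
    (d * (-(n * c) + q * a) - b * (-(q * c) + r * a)) * e,
    (-(c * (-(n * c) + q * a)) + a * (-(q * c) + r * a)) * e, ?_⟩
  apply GSp4.ext_matrix
  rw [Subgroup.coe_mul, Subgroup.coe_mul, Units.val_mul, Units.val_mul]
  simp only [elU, leviEmb, MonoidHom.coe_mk, OneHom.coe_mk, GSp4.coe_ofMatrix, leviMat]
  rw [← ha, ← hb, ← hc, ← he]
  clear_value a b c d
  ext i j
  fin_cases i <;> fin_cases j <;> simp [Matrix.mul_apply, Fin.sum_univ_four] <;>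
    first
    | linear_combination (-(n * d - q * b)) * h
    | linear_combination (-(-(n * c) + q * a)) * h
    | linear_combination (-(q * d - r * b)) * h
    | linear_combination (-(-(q * c) + r * a)) * h

/-- The Bessel subgroup `R = TU` of `GSp(4)`: the products `t u` with `t ∈ T` (embedded in
`GSp(4)`) and `u = U_{(n,q,r)}` in the unipotent radical of the Siegel parabolic. -/
def besselR (S : Matrix (Fin 2) (Fin 2) F) : Subgroup (GSp4 F) where
  carrier := {x | ∃ t ∈ torus S, ∃ n q r : F, x = leviEmb t * elU n q r}
  mul_mem' := by
    rintro _ _ ⟨t, ht, n, q, r, rfl⟩ ⟨s, hs, n', q', r', rfl⟩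
    obtain ⟨n₁, q₁, r₁, h⟩ := elU_mul_leviEmb s n q r
    refine ⟨t * s, mul_mem ht hs, n₁ + n', q₁ + q', r₁ + r', ?_⟩
    rw [map_mul, ← elU_mul_elU, mul_assoc, ← mul_assoc (elU n q r), h]
    simp only [mul_assoc]
  one_mem' := ⟨1, one_mem _, 0, 0, 0, by rw [map_one, elU_zero, one_mul]⟩
  inv_mem' := by
    rintro _ ⟨t, ht, n, q, r, rfl⟩
    obtain ⟨n₁, q₁, r₁, h⟩ := elU_mul_leviEmb t⁻¹ (-n) (-q) (-r)
    refine ⟨t⁻¹, inv_mem ht, n₁, q₁, r₁, ?_⟩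
    rw [← h, mul_inv_rev, map_inv]
    congr 1
    rw [inv_eq_iff_mul_eq_one, elU_mul_elU]
    simp [elU_zero]

end Algebra

/-! ### The `p`-adic groups -/

section Padic

variable (p : ℕ) [Fact p.Prime]

/-- `K_p = GSp(4, ℚ_p) ∩ GL₄(ℤ_p)`. -/
noncomputable def maxCompact : Subgroup (GSp4 ℚ_[p]) :=
  (Matrix.GeneralLinearGroup.map (n := Fin 4) (algebraMap ℤ_[p] ℚ_[p])).range.subgroupOf
    (GSp4 ℚ_[p])

/-- The Iwahori subgroup `I_p`, as a set: the `g ∈ K_p` whose reduction modulo `p` has the shape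
`[[*, 0, *, *], [*, *, *, *], [0, 0, *, *], [0, 0, 0, *]]`.
For `x ∈ ℤ_p`, `‖x‖ < 1` means `x ≡ 0 (mod p)`. -/
def iwahori : Set (GSp4 ℚ_[p]) :=
  {g | g ∈ maxCompact p ∧ ‖g.1.1 0 1‖ < 1 ∧
    ‖g.1.1 2 0‖ < 1 ∧ ‖g.1.1 2 1‖ < 1 ∧
    ‖g.1.1 3 0‖ < 1 ∧ ‖g.1.1 3 1‖ < 1 ∧ ‖g.1.1 3 2‖ < 1}

/-- `h(l, m) = diag(p^(2m+l), p^(m+l), 1, p^m)`. -/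
noncomputable def elH (l : ℤ) (m : ℕ) : GSp4 ℚ_[p] :=
  have hp : (p : ℚ_[p]) ≠ 0 := Nat.cast_ne_zero.mpr (Fact.out : p.Prime).ne_zero
  GSp4.ofMatrix
    !![(p : ℚ_[p]) ^ (2 * (m : ℤ) + l), 0, 0, 0;
       0, (p : ℚ_[p]) ^ ((m : ℤ) + l), 0, 0;
       0, 0, 1, 0;
       0, 0, 0, (p : ℚ_[p]) ^ (m : ℤ)]
    ((p : ℚ_[p]) ^ (2 * (m : ℤ) + l)) (zpow_ne_zero _ hp) (by
      have e : (p : ℚ_[p]) ^ (2 * (m : ℤ) + l)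
          = (p : ℚ_[p]) ^ ((m : ℤ) + l) * (p : ℚ_[p]) ^ (m : ℤ) := by
        rw [← zpow_add₀ hp]; congr 1; ring
      rw [e]
      ext i j
      fin_cases i <;> fin_cases j <;>
        simp [J4, Matrix.mul_apply, Fin.sum_univ_four, mul_comm])

/-- `S` viewed as a matrix over `ℚ_p`. -/
noncomputable def matPadic (S : Matrix (Fin 2) (Fin 2) ℚ) : Matrix (Fin 2) (Fin 2) ℚ_[p] :=
  S.map (fun x => (x : ℚ_[p]))

/-! ### The quotient `R(ℚ_p) \ G(ℚ_p)` and volumes on it -/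

/-- The space `R(ℚ_p) \ G(ℚ_p)` of right cosets `R(ℚ_p) g`. -/
def BesselQuot (S : Matrix (Fin 2) (Fin 2) ℚ) : Type :=
  Quotient (QuotientGroup.rightRel (besselR (matPadic p S)))

variable (S : Matrix (Fin 2) (Fin 2) ℚ)

/-- The quotient topology. -/
instance : TopologicalSpace (BesselQuot p S) :=
  inferInstanceAs (TopologicalSpace (Quotient (QuotientGroup.rightRel (besselR (matPadic p S)))))

/-- The Borel σ-algebra. -/
instance : MeasurableSpace (BesselQuot p S) := borel _

instance : BorelSpace (BesselQuot p S) := ⟨rfl⟩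

variable {p}

/-- The projection `g ↦ R(ℚ_p) g`. -/
noncomputable def BesselQuot.mk (g : GSp4 ℚ_[p]) : BesselQuot p S :=
  Quotient.mk (QuotientGroup.rightRel (besselR (matPadic p S))) g

variable {S}

/-- Right translation `R(ℚ_p) x ↦ R(ℚ_p) x g`. -/
noncomputable def BesselQuot.translate (g : GSp4 ℚ_[p]) : BesselQuot p S → BesselQuot p S :=
  Quotient.map (fun x => x * g) (by
    intro x y h
    replace h := QuotientGroup.rightRel_apply.mp h
    refine QuotientGroup.rightRel_apply.mpr ?_
    simpa [mul_assoc] using h)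

/-- `μ` is the `G(ℚ_p)`-invariant Borel measure on `R(ℚ_p) \ G(ℚ_p)` under which the image of
`K_p` has volume `1`. -/
structure IsNormalizedInvariant (μ : Measure (BesselQuot p S)) : Prop where
  invariant : ∀ (g : GSp4 ℚ_[p]) (A : Set (BesselQuot p S)), MeasurableSet A →
    μ (BesselQuot.translate g ⁻¹' A) = μ A
  normalized : μ (BesselQuot.mk S '' (maxCompact p : Set (GSp4 ℚ_[p]))) = 1

/-- `I_t^{l,m} = vol(R(ℚ_p) \ R(ℚ_p) h(l,m) t I_p)`, the volume being taken with respect to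
`μ`. -/
noncomputable def cosetVolume (μ : Measure (BesselQuot p S)) (l : ℤ) (m : ℕ) (t : GSp4 ℚ_[p]) :
    ℝ≥0∞ :=
  μ ((fun k => BesselQuot.mk S (elH p l m * t * k)) '' iwahori p)

/-- `M_{l,m} = p^(3l+4m) / ((p+1)(p²+1))`. -/
noncomputable def volM (p : ℕ) (l : ℤ) (m : ℕ) : ℝ :=
  (p : ℝ) ^ (3 * l + 4 * (m : ℤ)) / (((p : ℝ) + 1) * ((p : ℝ) ^ 2 + 1))

end Padic

/-! ### The quadratic field `L = ℚ(√-d)` -/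

/-- `ℚ(√D) ⊆ ℂ`. -/
noncomputable def sqrtField (D : ℚ) : IntermediateField ℚ ℂ :=
  IntermediateField.adjoin ℚ {z : ℂ | z ^ 2 = (D : ℂ)}

/-- The prime `p` is inert in `ℚ(√D)`: this field is quadratic over `ℚ`, and `p` generates a prime
ideal of its ring of integers. -/
def IsInertIn (p : ℕ) (D : ℚ) : Prop :=
  Module.finrank ℚ (sqrtField D) = 2 ∧
    (Ideal.span {(p : 𝓞 (sqrtField D))}).IsPrime

/-! The volume of a double coset is computed as a ratio of volumes of compact open subgroups. Let η
be Haar measure on R, viewed as a measure on G, and ν right Haar measure on G. For H' of finite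
index in H, the translates of R\RH' by H cover R\RH with constant multiplicity [R∩H : R∩H'], so
vol(R\RH) η(H) / ν(H) does not change from H to H', and hence agrees for commensurable open
subgroups (`measure_image_mul_measure_mul_measure`). Apply this to K and to gIg⁻¹ with g = h(l,m)t.
Since RgI = R(gIg⁻¹)g and the modular character is trivial at g, this gives I_t = η(K) / ([K:I]
η(gIg⁻¹)) for every normalized invariant measure (`cosetVolume_mul`). The index [K:I] is
(p+1)²(p²+1), by counting points of projective spaces over the field with p elements.

It remains to measure gIg⁻¹ inside R. Inertness makes the norm form of the torus satisfy |N(x,y)| =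
max(|x|,|y|)² (`isInertForm_of_isInertIn`), so T is generated by the powers of the scalar p and the
compact group T(ℤ_p), which is the unit sphere of ℚ_p². Haar measure on R is therefore explicit:
additive Haar measure on the sphere and on the coordinates (n,q,r) of U, summed over the scalars
p^k. Only k = 0 meets a compact subgroup, and η(K) = 1 - p⁻².

Conjugation by h(l,m) rescales y by p^m and n, q, r by p^(2m+l), p^(m+l), p^l, which produces the
common factor p^(3l+4m) (`cosetVolume_eq_of_scaled_iff`). After rescaling, t only contributes
congruences modulo p on the four coordinates b (the rescaled y), n, q, r. Each independent
congruence costs a factor p, and the identity 1 - p⁻² = p⁻¹(1 - p⁻¹)(p+1) takes one factor back: the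
exponent of p beyond 3l+4m is the number of congruences minus one.

Existence of the invariant measure follows Weil: choose a weight on G whose integral along each
coset Rg is 1, multiply ν by it and push forward to R\G (`exists_invariant_measure_quotient`). The
result is invariant because η is two-sided invariant and ν is right invariant and left invariant
under R. -/

/-! ### Invariant measures on R\G from a weight function. -/

section WeilMeasure

variable {G : Type*} [Group G]

/-- A representative of the double coset `R g K`. -/
noncomputable def doubleCosetRep (R K : Subgroup G) (g : G) : G :=
  (DoubleCoset.mk R K g).out

theorem doubleCosetRep_spec (R K : Subgroup G) (g : G) :
    ∃ r ∈ R, ∃ k ∈ K, doubleCosetRep R K g = r * g * k := by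
  obtain ⟨r, k, hr, hk, h⟩ := DoubleCoset.mk_out_eq_mul R K g
  exact ⟨r, hr, k, hk, h⟩

theorem doubleCosetRep_mul (R K : Subgroup G) {r k : G} (g : G) (hr : r ∈ R) (hk : k ∈ K) :
    doubleCosetRep R K (r * g * k) = doubleCosetRep R K g := by
  unfold doubleCosetRep
  rw [(DoubleCoset.eq R K g (r * g * k)).mpr ⟨r, hr, k, hk, rfl⟩]

variable [MeasurableSpace G]

open Classical in
/-- A function on `G` whose integral over every coset `R g` is `1`. -/
noncomputable def weilWeight (R K : Subgroup G) (η : Measure G) (g : G) : ℝ≥0∞ :=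
  if (doubleCosetRep R K g)⁻¹ * g ∈ K then
    (η {x | (doubleCosetRep R K g)⁻¹ * x * doubleCosetRep R K g ∈ K})⁻¹ else 0

theorem weilWeight_mul_right (R K : Subgroup G) (η : Measure G) (g : G) {k : G} (hk : k ∈ K) :
    weilWeight R K η (g * k) = weilWeight R K η g := by
  have h := doubleCosetRep_mul R K g R.one_mem hk
  rw [one_mul] at h
  unfold weilWeight
  rw [h]
  classical
  exact if_congr (by rw [← mul_assoc, K.mul_mem_cancel_right hk]) rfl rfl

/-- Such a function is locally constant, so every preimage is open. -/
theorem measurable_of_mul_right [TopologicalSpace G] [IsTopologicalGroup G] [BorelSpace G]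
    {β : Type*} [MeasurableSpace β] {K : Subgroup G} (hK : IsOpen (K : Set G)) {f : G → β}
    (hf : ∀ g, ∀ k ∈ K, f (g * k) = f g) : Measurable f := by
  intro A _
  refine IsOpen.measurableSet (isOpen_iff_mem_nhds.mpr fun g hg => ?_)
  have h1 : (fun x => g⁻¹ * x) ⁻¹' (K : Set G) ∈ nhds g :=
    (hK.preimage (continuous_const_mul g⁻¹)).mem_nhds (by simp [K.one_mem])
  filter_upwards [h1] with x hx
  have := hf g (g⁻¹ * x) hx
  rw [mul_inv_cancel_left] at this
  simpa [this] using hg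

variable {R K : Subgroup G} {η : Measure G}

/-- The representative s is constant along Rg. Writing g as an element of R times s times an element
of K turns the condition rg ∈ sK into one on a right translate of r lying in sKs⁻¹, so the weight is
a normalized indicator in r. -/
theorem weilWeight_left_coset (hηR : ∀ᵐ r ∂η, r ∈ R) (g : G) :
    ∃ r₀ ∈ R, ∀ᵐ r ∂η, weilWeight R K η (r * g) =
      Set.indicator {x | (doubleCosetRep R K g)⁻¹ * (x * r₀) * doubleCosetRep R K g ∈ K}
        (fun _ => (η {x | (doubleCosetRep R K g)⁻¹ * x * doubleCosetRep R K g ∈ K})⁻¹) r := by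
  obtain ⟨r₀, hr₀, k₀, hk₀, h⟩ := doubleCosetRep_spec R K g
  refine ⟨r₀⁻¹, R.inv_mem hr₀, ?_⟩
  classical
  filter_upwards [hηR] with r hr
  have h2 := doubleCosetRep_mul R K g hr K.one_mem
  rw [mul_one] at h2
  have h3 : (doubleCosetRep R K g)⁻¹ * (r * g) ∈ K ↔
      (doubleCosetRep R K g)⁻¹ * (r * r₀⁻¹) * doubleCosetRep R K g ∈ K := by
    rw [← K.mul_mem_cancel_right hk₀]
    conv_rhs => rw [mul_assoc]; arg 2; arg 2; rw [h]
    simp only [mul_assoc, inv_mul_cancel_left]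
  unfold weilWeight
  rw [h2, Set.indicator_apply]
  exact if_congr h3 rfl rfl

theorem lintegral_weilWeight [TopologicalSpace G] [IsTopologicalGroup G] [BorelSpace G]
    [SecondCountableTopology G] (hK : IsOpen (K : Set G))
    (hηR : ∀ᵐ r ∂η, r ∈ R) (hr : ∀ r ∈ R, η.map (· * r) = η)
    (h0 : ∀ s : G, η {x | s⁻¹ * x * s ∈ K} ≠ 0) (h1 : ∀ s : G, η {x | s⁻¹ * x * s ∈ K} ≠ ∞)
    (g : G) : ∫⁻ r, weilWeight R K η (r * g) ∂η = 1 := by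
  obtain ⟨r₀, hr₀, h⟩ := weilWeight_left_coset (K := K) hηR g
  set s := doubleCosetRep R K g
  have hm : MeasurableSet {x | s⁻¹ * x * s ∈ K} :=
    (hK.preimage (by fun_prop : Continuous fun x => s⁻¹ * x * s)).measurableSet
  rw [lintegral_congr_ae h, lintegral_indicator_const (s := {x | s⁻¹ * (x * r₀) * s ∈ K})
    (measurable_mul_const r₀ hm)]
  have h2 : η {x | s⁻¹ * (x * r₀) * s ∈ K} = η {x | s⁻¹ * x * s ∈ K} := by
    conv_rhs => rw [← hr r₀ hr₀, Measure.map_apply (measurable_mul_const r₀) hm]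
    rfl
  rw [h2]
  exact ENNReal.inv_mul_cancel (h0 s) (h1 s)

/-- Inverting the membership in K replaces r⁻¹ by r and puts the correcting translation on the left,
so here it is left invariance of η that is needed. -/
theorem lintegral_weilWeight_inv [TopologicalSpace G] [IsTopologicalGroup G] [BorelSpace G]
    [SecondCountableTopology G] (hK : IsOpen (K : Set G))
    (hηR : ∀ᵐ r ∂η, r ∈ R) (hl : ∀ r ∈ R, η.map (r * ·) = η)
    (h0 : ∀ s : G, η {x | s⁻¹ * x * s ∈ K} ≠ 0) (h1 : ∀ s : G, η {x | s⁻¹ * x * s ∈ K} ≠ ∞)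
    (g : G) : ∫⁻ r, weilWeight R K η (r⁻¹ * g) ∂η = 1 := by
  obtain ⟨r₀, hr₀, k₀, hk₀, h⟩ := doubleCosetRep_spec R K g
  set s := doubleCosetRep R K g with hs
  have hm : MeasurableSet {x | s⁻¹ * x * s ∈ K} :=
    (hK.preimage (by fun_prop : Continuous fun x => s⁻¹ * x * s)).measurableSet
  have key : ∀ᵐ r ∂η, weilWeight R K η (r⁻¹ * g) = Set.indicator {x | s⁻¹ * (r₀ * x) * s ∈ K}
        (fun _ => (η {x | s⁻¹ * x * s ∈ K})⁻¹) r := by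
    filter_upwards [hηR] with r hr
    have h2 := doubleCosetRep_mul R K g (R.inv_mem hr) K.one_mem
    rw [mul_one, ← hs] at h2
    have h3 : s⁻¹ * (r⁻¹ * g) ∈ K ↔ s⁻¹ * (r₀ * r) * s ∈ K := by
      rw [← K.mul_mem_cancel_right hk₀, ← K.inv_mem_iff]
      have : (s⁻¹ * (r⁻¹ * g) * k₀)⁻¹ = s⁻¹ * (r₀ * r) * s := by
        have hg : g * k₀ = r₀⁻¹ * s := by rw [h]; group
        rw [mul_assoc, mul_assoc r⁻¹, hg]; group
      rw [this]
    classical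
    unfold weilWeight
    rw [h2, Set.indicator_apply]
    exact if_congr h3 rfl rfl
  rw [lintegral_congr_ae key, lintegral_indicator_const (s := {x | s⁻¹ * (r₀ * x) * s ∈ K})
    (measurable_const_mul r₀ hm)]
  have h2 : η {x | s⁻¹ * (r₀ * x) * s ∈ K} = η {x | s⁻¹ * x * s ∈ K} := by
    conv_rhs => rw [← hl r₀ hr₀, Measure.map_apply (measurable_const_mul r₀) hm]
    rfl
  rw [h2]
  exact ENNReal.inv_mul_cancel (h0 s) (h1 s)

/-- Unfolding and refolding: move g₀ onto the weight f, insert 1 = ∫ f(r⁻¹g) dη(r), exchange the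
integrals, substitute rg for g (which fixes u and ν), and carry out the r-integral of the other copy
of f, which is again 1. -/
theorem lintegral_weilWeight_translate [TopologicalSpace G] [IsTopologicalGroup G] [BorelSpace G]
    [SecondCountableTopology G] (hK : IsOpen (K : Set G)) [SFinite η]
    (hηR : ∀ᵐ r ∂η, r ∈ R) (hl : ∀ r ∈ R, η.map (r * ·) = η) (hr : ∀ r ∈ R, η.map (· * r) = η)
    (h0 : ∀ s : G, η {x | s⁻¹ * x * s ∈ K} ≠ 0) (h1 : ∀ s : G, η {x | s⁻¹ * x * s ∈ K} ≠ ∞)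
    {ν : Measure G} [SFinite ν] (hνr : ∀ g, ν.map (· * g) = ν)
    (hνl : ∀ r ∈ R, ν.map (r * ·) = ν) {u : G → ℝ≥0∞} (hu : Measurable u)
    (huR : ∀ r ∈ R, ∀ g, u (r * g) = u g) (g₀ : G) :
    ∫⁻ g, weilWeight R K η g * u (g * g₀) ∂ν = ∫⁻ g, weilWeight R K η g * u g ∂ν := by
  have hf : Measurable (weilWeight R K η) :=
    measurable_of_mul_right hK fun g k hk => weilWeight_mul_right R K η g hk
  set f := weilWeight R K η
  have e1 : ∫⁻ g, f g * u (g * g₀) ∂ν = ∫⁻ g, f (g * g₀⁻¹) * u g ∂ν := by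
    conv_rhs => rw [← hνr g₀]
    rw [lintegral_map (by fun_prop) (by fun_prop)]
    simp
  have e2 : ∀ g, ∫⁻ r, f (r⁻¹ * g) ∂η = 1 := lintegral_weilWeight_inv hK hηR hl h0 h1
  have e3 : ∀ g, ∫⁻ r, f (r * g) ∂η = 1 := lintegral_weilWeight hK hηR hr h0 h1
  calc ∫⁻ g, f g * u (g * g₀) ∂ν
      = ∫⁻ g, ∫⁻ r, f (g * g₀⁻¹) * u g * f (r⁻¹ * g) ∂η ∂ν := by
        rw [e1]
        refine lintegral_congr fun g => ?_
        rw [lintegral_const_mul _ (by fun_prop), e2, mul_one]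
    _ = ∫⁻ r, ∫⁻ g, f (g * g₀⁻¹) * u g * f (r⁻¹ * g) ∂ν ∂η := by
        rw [lintegral_lintegral_swap]
        refine Measurable.aemeasurable ?_
        simp only [Function.uncurry_def]
        fun_prop
    _ = ∫⁻ r, ∫⁻ g, f g * u g * f (r * (g * g₀⁻¹)) ∂ν ∂η := by
        refine lintegral_congr_ae ?_
        filter_upwards [hηR] with r hr
        conv_lhs => rw [← hνl r hr]
        rw [lintegral_map (by fun_prop) (by fun_prop)]
        refine lintegral_congr fun g => ?_
        rw [huR r hr, inv_mul_cancel_left, mul_assoc r]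
        ring
    _ = ∫⁻ g, ∫⁻ r, f g * u g * f (r * (g * g₀⁻¹)) ∂η ∂ν := by
        rw [lintegral_lintegral_swap]
        refine Measurable.aemeasurable ?_
        simp only [Function.uncurry_def]
        fun_prop
    _ = ∫⁻ g, f g * u g ∂ν := by
        refine lintegral_congr fun g => ?_
        rw [lintegral_const_mul _ (by fun_prop), e3, mul_one]

/-- Existence of an invariant measure on `R \ G`, here the image of `π`, on which `G` acts by `τ`.
-/
theorem exists_invariant_measure_quotient [TopologicalSpace G] [IsTopologicalGroup G] [BorelSpace G]
    [SecondCountableTopology G] (hK : IsOpen (K : Set G)) [SFinite η]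
    (hηR : ∀ᵐ r ∂η, r ∈ R) (hl : ∀ r ∈ R, η.map (r * ·) = η) (hr : ∀ r ∈ R, η.map (· * r) = η)
    (h0 : ∀ s : G, η {x | s⁻¹ * x * s ∈ K} ≠ 0) (h1 : ∀ s : G, η {x | s⁻¹ * x * s ∈ K} ≠ ∞)
    {ν : Measure G} [SFinite ν] (hνr : ∀ g, ν.map (· * g) = ν)
    (hνl : ∀ r ∈ R, ν.map (r * ·) = ν) (hν0 : ν K ≠ 0) (hν1 : ν K ≠ ∞)
    {X : Type*} [MeasurableSpace X] {π : G → X} (hπ : Measurable π)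
    (hπR : ∀ a b, π a = π b ↔ ∃ r ∈ R, a = r * b) {τ : G → X → X}
    (hτ : ∀ g x, τ g (π x) = π (x * g)) (hτm : ∀ g, Measurable (τ g))
    (hKm : MeasurableSet (π '' K)) :
    ∃ μ : Measure X, (∀ g A, MeasurableSet A → μ (τ g ⁻¹' A) = μ A) ∧ μ (π '' K) = 1 := by
  have hf : Measurable (weilWeight R K η) :=
    measurable_of_mul_right hK fun g k hk => weilWeight_mul_right R K η g hk
  have happ : ∀ A, MeasurableSet A → (ν.withDensity (weilWeight R K η)).map π A =
      ∫⁻ g, weilWeight R K η g * (π ⁻¹' A).indicator 1 g ∂ν := by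
    intro A hA
    rw [Measure.map_apply hπ hA, withDensity_apply _ (hπ hA), ← lintegral_indicator (hπ hA)]
    refine lintegral_congr fun g => ?_
    by_cases h : g ∈ π ⁻¹' A <;> simp [h]
  have hinv : ∀ g A, MeasurableSet A → (ν.withDensity (weilWeight R K η)).map π (τ g ⁻¹' A) =
      (ν.withDensity (weilWeight R K η)).map π A := by
    intro g₀ A hA
    classical
    rw [happ _ (hτm g₀ hA), happ _ hA, ← lintegral_weilWeight_translate hK hηR hl hr h0 h1 hνr hνl
      (measurable_one.indicator (hπ hA)) _ g₀]
    · refine lintegral_congr fun g => ?_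
      congr 1
      simp [Set.indicator_apply, hτ]
    · intro r hr g
      have : π (r * g) = π g := (hπR _ _).mpr ⟨r, hr, rfl⟩
      simp [Set.indicator_apply, this]
  -- The chosen representative of RK need not be 1; it is s = r₀k₀. The weight on RK is c⁻¹ times
  -- the indicator of sK = r₀K, which has the same ν-volume as K.
  obtain ⟨r₀, hr₀, k₀, hk₀, hs⟩ := doubleCosetRep_spec R K 1
  rw [mul_one] at hs
  set s := doubleCosetRep R K 1 with hsd
  set c := η {x | s⁻¹ * x * s ∈ K} with hc
  have hvol : (ν.withDensity (weilWeight R K η)).map π (π '' K) = c⁻¹ * ν K := by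
    rw [happ _ hKm]
    have hm : MeasurableSet {g | s⁻¹ * g ∈ K} :=
      (hK.preimage (continuous_const_mul s⁻¹)).measurableSet
    have e : ∀ g, weilWeight R K η g * (π ⁻¹' (π '' K)).indicator 1 g =
        {g | s⁻¹ * g ∈ K}.indicator (fun _ => c⁻¹) g := by
      intro g
      by_cases hg : g ∈ π ⁻¹' (π '' K)
      · obtain ⟨k, hk, hkg⟩ := hg
        obtain ⟨r, hr, e⟩ := (hπR _ _).mp hkg
        have : doubleCosetRep R K g = s := by
          have := doubleCosetRep_mul R K 1 (R.inv_mem hr) hk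
          rw [mul_one, e, inv_mul_cancel_left] at this
          exact this
        have hg : g ∈ π ⁻¹' (π '' K) := ⟨k, hk, hkg⟩
        classical
        rw [Set.indicator_of_mem hg, Pi.one_apply, mul_one, Set.indicator_apply]
        unfold weilWeight
        rw [this]
        exact if_congr Iff.rfl rfl rfl
      · have : ¬ s⁻¹ * g ∈ K := by
          intro h
          refine hg ⟨k₀ * (s⁻¹ * g), K.mul_mem hk₀ h, (hπR _ _).mpr ⟨r₀⁻¹, R.inv_mem hr₀, ?_⟩⟩
          rw [hs]; group
        simp [hg, this]
    rw [lintegral_congr e, lintegral_indicator_const hm]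
    congr 1
    have e2 : {g | s⁻¹ * g ∈ K} = (r₀⁻¹ * ·) ⁻¹' (K : Set G) := by
      ext g
      simp only [Set.mem_ofPred_eq, Set.mem_preimage, SetLike.mem_coe, hs, mul_inv_rev]
      rw [mul_assoc, K.mul_mem_cancel_left (K.inv_mem hk₀)]
    rw [e2, ← Measure.map_apply (measurable_const_mul _) hK.measurableSet,
      hνl _ (R.inv_mem hr₀)]
  have hv0 : c⁻¹ * ν K ≠ 0 := mul_ne_zero (ENNReal.inv_ne_zero.mpr (h1 s)) hν0
  have hv1 : c⁻¹ * ν K ≠ ∞ := ENNReal.mul_ne_top (ENNReal.inv_ne_top.mpr (h0 s)) hν1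
  refine ⟨(c⁻¹ * ν K)⁻¹ • (ν.withDensity (weilWeight R K η)).map π, ?_, ?_⟩
  · intro g A hA
    simp only [Measure.smul_apply, hinv g A hA]
  · rw [Measure.smul_apply, hvol, smul_eq_mul, ENNReal.inv_mul_cancel hv0 hv1]

end WeilMeasure

/-! ### Volumes of commensurable subgroups and of their images in R\G. -/

section RelativeIndex

variable {G : Type*} [Group G]

/-- The right cosets in `H` of a subgroup `H'`. -/
abbrev RightCosets (H' H : Subgroup G) : Type _ :=
  Quotient (QuotientGroup.rightRel (H'.subgroupOf H))

theorem RightCosets.mk_eq_iff {H' H : Subgroup G} (a b : H) :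
    (Quotient.mk _ a : RightCosets H' H) = Quotient.mk _ b ↔ (b : G) * (a : G)⁻¹ ∈ H' := by
  rw [Quotient.eq, QuotientGroup.rightRel_apply, Subgroup.mem_subgroupOf]
  simp

theorem RightCosets.card (H' H : Subgroup G) : Nat.card (RightCosets H' H) = H'.relIndex H :=
  Nat.card_congr (QuotientGroup.quotientRightRelEquivQuotientLeftRel _)

theorem RightCosets.finite {H' H : Subgroup G} (h : H'.relIndex H ≠ 0) :
    Finite (RightCosets H' H) := by
  rw [← RightCosets.card] at h
  exact Nat.finite_of_card_ne_zero h

theorem relIndex_eq_card_of_surjective {H' H : Subgroup G} {Y : Type*} (f : H → Y)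
    (hf : Function.Surjective f) (h : ∀ a b, f a = f b ↔ (b : G) * (a : G)⁻¹ ∈ H') :
    H'.relIndex H = Nat.card Y := by
  rw [← RightCosets.card]
  refine Nat.card_congr (Equiv.ofBijective
    (Quotient.lift f fun a b hab => (h a b).mpr
      ((RightCosets.mk_eq_iff a b).mp (Quotient.sound hab)))
    ⟨?_, ?_⟩)
  · rintro ⟨a⟩ ⟨b⟩ hab
    exact (RightCosets.mk_eq_iff a b).mpr ((h a b).mp hab)
  · intro y
    obtain ⟨a, rfl⟩ := hf y
    exact ⟨Quotient.mk _ a, rfl⟩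

/-- Up to a null set H is the disjoint union of the translates H'q, with q running over
representatives in R∩H of its right cosets modulo R∩H'; only translations by R are used. With R the
whole group it becomes the index formula for Haar measure. -/
theorem measure_eq_relIndex_mul [MeasurableSpace G] {R H' H : Subgroup G} (hle : H' ≤ H)
    [MeasurableMul G]
    (hm : MeasurableSet (H' : Set G)) (hfin : (R ⊓ H').relIndex (R ⊓ H) ≠ 0)
    {η : Measure G} (hηR : ∀ᵐ r ∂η, r ∈ R) (hr : ∀ r ∈ R, η.map (· * r) = η) :
    η H = (R ⊓ H').relIndex (R ⊓ H) * η H' := by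
  have := RightCosets.finite hfin
  let C : RightCosets (R ⊓ H') (R ⊓ H) → Set G := fun q => (· * (q.out : G)⁻¹) ⁻¹' (H' : Set G)
  have hC : ∀ q, MeasurableSet (C q) := fun q => measurable_mul_const _ hm
  have hCv : ∀ q, η (C q) = η H' := fun q => by
    rw [← Measure.map_apply (measurable_mul_const _) hm, hr _ (R.inv_mem q.out.2.1)]
  have hd : Pairwise (Function.onFun Disjoint C) := by
    intro q q' hne
    refine Set.disjoint_left.mpr fun x hx hx' => hne ?_
    rw [← Quotient.out_eq q, ← Quotient.out_eq q', RightCosets.mk_eq_iff]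
    refine ⟨R.mul_mem q'.out.2.1 (R.inv_mem q.out.2.1), ?_⟩
    have := H'.mul_mem (H'.inv_mem hx') hx
    simpa [mul_assoc] using this
  have hU : (H : Set G) =ᵐ[η] ⋃ q, C q := by
    filter_upwards [hηR] with x hxR
    refine propext ⟨fun hx => ?_, fun hx => ?_⟩
    · refine Set.mem_iUnion.mpr ⟨Quotient.mk _ ⟨x, hxR, hx⟩, ?_⟩
      exact ((RightCosets.mk_eq_iff _ _).mp (Quotient.out_eq
        (Quotient.mk _ ⟨x, hxR, hx⟩ : RightCosets (R ⊓ H') (R ⊓ H)))).2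
    · obtain ⟨q, hq⟩ := Set.mem_iUnion.mp hx
      have := H.mul_mem (hle hq) q.out.2.2
      rw [inv_mul_cancel_right] at this
      exact this
  rw [measure_congr hU, measure_iUnion hd hC]
  simp only [hCv]
  have := Fintype.ofFinite (RightCosets (R ⊓ H') (R ⊓ H))
  rw [tsum_fintype, Finset.sum_const, nsmul_eq_mul, Finset.card_univ, ← Nat.card_eq_fintype_card,
    RightCosets.card]

/-- Double counting: the images of the cosets H'q in H all have the measure of the image of H', and
each point of the image of H lies in exactly [R∩H : R∩H'] of them. -/
theorem measure_image_mul_relIndex {R H' H : Subgroup G} (hle : H' ≤ H)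
    (hfin : H'.relIndex H ≠ 0)
    {X : Type*} [MeasurableSpace X] {π : G → X} (hs : Function.Surjective π)
    (hπR : ∀ a b, π a = π b ↔ ∃ r ∈ R, a = r * b) {τ : G → X → X}
    (hτ : ∀ g x, τ g (π x) = π (x * g))
    (hm : MeasurableSet (π '' H)) (hm' : ∀ g : G, MeasurableSet (π '' {x | x * g⁻¹ ∈ H'}))
    {μ : Measure X} (hμ : ∀ g A, MeasurableSet A → μ (τ g ⁻¹' A) = μ A) :
    μ (π '' H') * H'.relIndex H = μ (π '' H) * (R ⊓ H').relIndex (R ⊓ H) := by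
  classical
  have := RightCosets.finite hfin
  have := Fintype.ofFinite (RightCosets H' H)
  let E : RightCosets H' H → Set X := fun q => π '' {x | x * (q.out : G)⁻¹ ∈ H'}
  have hE : ∀ q, MeasurableSet (E q) := fun q => hm' _
  have hEv : ∀ q, μ (E q) = μ (π '' H') := by
    intro q
    rw [← hμ (q.out : G) _ (hE q)]
    congr 1
    ext y
    obtain ⟨x, rfl⟩ := hs y
    simp only [Set.mem_preimage, hτ, E, Set.mem_image, Set.mem_ofPred_eq, hπR]
    constructor
    · rintro ⟨z, hz, r, hr, rfl⟩
      exact ⟨r * x, by simpa [mul_assoc] using hz, r, hr, rfl⟩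
    · rintro ⟨z, hz, r, hr, rfl⟩
      exact ⟨r * x * q.out, by simpa using hz, r, hr, by group⟩
  have hcount : ∀ y, ∑ q, (E q).indicator (1 : X → ℝ≥0∞) y =
      (π '' H).indicator (fun _ => ((R ⊓ H').relIndex (R ⊓ H) : ℝ≥0∞)) y := by
    intro y
    by_cases hy : y ∈ π '' H
    · obtain ⟨h, hh, rfl⟩ := hy
      rw [Set.indicator_of_mem (Set.mem_image_of_mem π hh)]
      have e1 : ∑ q, (E q).indicator (1 : X → ℝ≥0∞) (π h) =
          ((Finset.univ.filter fun q => π h ∈ E q).card : ℝ≥0∞) := by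
        rw [Finset.card_filter, Nat.cast_sum]
        refine Finset.sum_congr rfl fun q _ => ?_
        by_cases hq : π h ∈ E q <;> simp [hq]
      rw [e1, ← RightCosets.card, ← Fintype.card_subtype, ← Nat.card_eq_fintype_card]
      congr 1
      symm
      -- The cosets whose image contains π(h) are the H'rh with r in R∩H, and rh, r₁h give the same
      -- coset exactly when r₁r⁻¹ lies in R∩H'.
      let φ : (R ⊓ H : Subgroup G) → {q // π h ∈ E q} := fun r =>
        ⟨Quotient.mk _ ⟨(r : G) * h, H.mul_mem r.2.2 hh⟩, (r : G) * h,
          (RightCosets.mk_eq_iff _ _).mp (Quotient.out_eq (Quotient.mk _ ⟨(r : G) * h, _⟩ :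
            RightCosets H' H)), (hπR _ _).mpr ⟨r, r.2.1, rfl⟩⟩
      have hφ : ∀ a b, φ a = φ b ↔ (b : G) * (a : G)⁻¹ ∈ R ⊓ H' := by
        intro a b
        rw [Subtype.ext_iff, RightCosets.mk_eq_iff, Subgroup.mem_inf]
        simp [mul_assoc, R.mul_mem b.2.1 (R.inv_mem a.2.1)]
      rw [RightCosets.card]
      refine relIndex_eq_card_of_surjective φ ?_ hφ
      rintro ⟨q, x, hx, hxh⟩
      obtain ⟨r, hr, rfl⟩ := (hπR _ _).mp hxh
      have hrh : r * h ∈ H := by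
        have := H.mul_mem (hle hx) q.out.2
        simpa using this
      have hrH : r ∈ H := by
        have := H.mul_mem hrh (H.inv_mem hh)
        simpa using this
      exact ⟨⟨r, hr, hrH⟩, Subtype.ext (((RightCosets.mk_eq_iff _ _).mpr hx).symm.trans
        (Quotient.out_eq q))⟩
    · rw [Set.indicator_of_notMem hy]
      refine Finset.sum_eq_zero fun q _ => Set.indicator_of_notMem (fun hq => hy ?_) _
      obtain ⟨x, hx, rfl⟩ := hq
      refine ⟨x, ?_, rfl⟩
      have := H.mul_mem (hle hx) q.out.2
      simpa using this
  calc μ (π '' H') * H'.relIndex H = ∑ q, μ (E q) := by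
        simp only [hEv]
        rw [Finset.sum_const, nsmul_eq_mul, Finset.card_univ, ← Nat.card_eq_fintype_card,
          RightCosets.card, mul_comm]
    _ = ∫⁻ y, ∑ q, (E q).indicator (1 : X → ℝ≥0∞) y ∂μ := by
        rw [lintegral_finsetSum _ fun q _ => measurable_one.indicator (hE q)]
        simp only [lintegral_indicator_one (hE _)]
    _ = μ (π '' H) * (R ⊓ H').relIndex (R ⊓ H) := by
        simp only [hcount]
        rw [lintegral_indicator_const hm, mul_comm]

/-- For open subgroups `H` of `G`, the quantity `vol(R \ R H) η(H) / ν(H)` depends only on the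
commensurability class of `H`. -/
theorem measure_image_mul_measure_mul_measure {R H₁ H₂ : Subgroup G} [TopologicalSpace G]
    [MeasurableSpace G]
    [IsTopologicalGroup G] [BorelSpace G] [MeasurableMul G]
    (ho₁ : IsOpen (H₁ : Set G)) (ho₂ : IsOpen (H₂ : Set G))
    (hfin₁ : (H₁ ⊓ H₂).relIndex H₁ ≠ 0) (hfin₂ : (H₁ ⊓ H₂).relIndex H₂ ≠ 0)
    {η ν : Measure G} (hηR : ∀ᵐ r ∂η, r ∈ R) (hr : ∀ r ∈ R, η.map (· * r) = η)
    (hνr : ∀ g, ν.map (· * g) = ν)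
    (hν0 : ν (H₁ ⊓ H₂ : Subgroup G) ≠ 0) (hν1 : ν (H₁ ⊓ H₂ : Subgroup G) ≠ ∞)
    {X : Type*} [MeasurableSpace X] {π : G → X} (hs : Function.Surjective π)
    (hπR : ∀ a b, π a = π b ↔ ∃ r ∈ R, a = r * b) {τ : G → X → X}
    (hτ : ∀ g x, τ g (π x) = π (x * g)) (hm : ∀ U, IsOpen U → MeasurableSet (π '' U))
    {μ : Measure X} (hμ : ∀ g A, MeasurableSet A → μ (τ g ⁻¹' A) = μ A) :
    μ (π '' H₁) * η H₁ * ν H₂ = μ (π '' H₂) * η H₂ * ν H₁ := by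
  set H' := H₁ ⊓ H₂ with hH'
  have ho' : IsOpen (H' : Set G) := ho₁.inter ho₂
  have key : ∀ H : Subgroup G, IsOpen (H : Set G) → H' ≤ H → H'.relIndex H ≠ 0 →
      μ (π '' H) * η H * ν H' = μ (π '' H') * η H' * ν H := by
    intro H ho hle hfin
    -- The index of R∩H' in R∩H is finite because that of H' in H is.
    have hfinR : (R ⊓ H').relIndex (R ⊓ H) ≠ 0 := by
      have h1 : R ⊓ H' = H' ⊓ (R ⊓ H) := by
        rw [inf_left_comm H' R H, inf_eq_left.mpr hle]
      rw [h1, Subgroup.inf_relIndex_right]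
      exact fun h => hfin (Subgroup.relIndex_eq_zero_of_le_right inf_le_right h)
    have e1 := measure_image_mul_relIndex (R := R) hle hfin hs hπR hτ (hm _ ho)
      (fun g => hm _ (ho'.preimage (continuous_mul_const g⁻¹))) hμ
    have e2 := measure_eq_relIndex_mul hle ho'.measurableSet hfinR hηR hr
    have e3 := measure_eq_relIndex_mul (R := ⊤) (H' := H') (H := H) hle ho'.measurableSet
      (by simpa using hfin) (by simp) (fun g _ => hνr g)
    simp only [top_inf_eq] at e3
    rw [e2, e3]
    calc μ (π '' H) * ((R ⊓ H').relIndex (R ⊓ H) * η H') * ν H'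
        = μ (π '' H) * (R ⊓ H').relIndex (R ⊓ H) * η H' * ν H' := by ring
      _ = _ := by rw [← e1]; ring
  have k1 := key H₁ ho₁ inf_le_left hfin₁
  have k2 := key H₂ ho₂ inf_le_right hfin₂
  have h3 : (μ (π '' H₁) * η H₁ * ν H₂) * ν H' = (μ (π '' H₂) * η H₂ * ν H₁) * ν H' := by
    calc (μ (π '' H₁) * η H₁ * ν H₂) * ν H' = (μ (π '' H₁) * η H₁ * ν H') * ν H₂ := by ring
      _ = (μ (π '' H₂) * η H₂ * ν H') * ν H₁ := by rw [k1, k2]; ring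
      _ = _ := by ring
  exact (ENNReal.mul_left_inj hν0 hν1).mp h3

end RelativeIndex

/-! ### The similitude factor and the inverse matrix. -/

section Similitude

variable {F : Type*} [Field F]

/-- The matrix of an element of `GSp(4)`. -/
abbrev mat4 (g : GSp4 F) : Matrix (Fin 4) (Fin 4) F := g.1.1

theorem mat4_mul (g h : GSp4 F) : mat4 (g * h) = mat4 g * mat4 h := rfl

theorem mat4_one : mat4 (1 : GSp4 F) = 1 := rfl

/-- The similitude factor `ν` of `g ∈ GSp(4)`. -/
def simil (g : GSp4 F) : F := ((mat4 g)ᵀ * J4 F * mat4 g) 0 2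

theorem simil_of {g : GSp4 F} {ν : F} (h : (mat4 g)ᵀ * J4 F * mat4 g = ν • J4 F) :
    simil g = ν := by
  rw [simil, h]
  simp [J4]

theorem simil_spec (g : GSp4 F) : (mat4 g)ᵀ * J4 F * mat4 g = simil g • J4 F := by
  obtain ⟨ν, hν⟩ := g.2
  rw [simil_of hν, hν]

theorem simil_ne_zero (g : GSp4 F) : simil g ≠ 0 := by
  obtain ⟨ν, hν⟩ := g.2
  rw [simil_of hν]
  exact ν.ne_zero

theorem simil_mul (g h : GSp4 F) : simil (g * h) = simil g * simil h := by
  refine simil_of ?_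
  rw [mat4_mul, Matrix.transpose_mul]
  calc (mat4 h)ᵀ * (mat4 g)ᵀ * J4 F * (mat4 g * mat4 h)
      = (mat4 h)ᵀ * ((mat4 g)ᵀ * J4 F * mat4 g) * mat4 h := by simp only [Matrix.mul_assoc]
    _ = _ := by rw [simil_spec, Matrix.mul_smul, Matrix.smul_mul, simil_spec, smul_smul]

theorem simil_one : simil (1 : GSp4 F) = 1 :=
  simil_of (by rw [mat4_one]; simp)

theorem simil_inv (g : GSp4 F) : simil g⁻¹ = (simil g)⁻¹ := by
  refine eq_inv_of_mul_eq_one_left ?_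
  rw [← simil_mul, inv_mul_cancel, simil_one]

theorem simil_ofMatrix (g : Matrix (Fin 4) (Fin 4) F) (ν : F) (hν : ν ≠ 0)
    (h : gᵀ * J4 F * g = ν • J4 F) : simil (GSp4.ofMatrix g ν hν h) = ν :=
  simil_of h

/-- From gᵀJg = νJ and J² = -1 one gets g⁻¹ = -ν⁻¹JgᵀJ. Every entry of the inverse is thus ± an
entry of g divided by ν, so integrality, congruences and continuity of inverses can be read off from
g. -/
theorem mat4_inv (g : GSp4 F) : mat4 g⁻¹ = (simil g)⁻¹ •
    !![ mat4 g 2 2,  mat4 g 3 2, -mat4 g 0 2, -mat4 g 1 2;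
        mat4 g 2 3,  mat4 g 3 3, -mat4 g 0 3, -mat4 g 1 3;
       -mat4 g 2 0, -mat4 g 3 0,  mat4 g 0 0,  mat4 g 1 0;
       -mat4 g 2 1, -mat4 g 3 1,  mat4 g 0 1,  mat4 g 1 1] := by
  have h1 : ((simil g)⁻¹ • (-(J4 F) * ((mat4 g)ᵀ * J4 F))) * mat4 g = 1 := by
    rw [Matrix.smul_mul, Matrix.mul_assoc, (simil_spec g), Matrix.mul_smul, smul_smul,
      inv_mul_cancel₀ (simil_ne_zero g), one_smul, Matrix.neg_mul, J4_mul_J4, neg_neg]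
  have h2 : mat4 g * mat4 g⁻¹ = 1 := by rw [← mat4_mul, mul_inv_cancel, mat4_one]
  have h3 : mat4 g⁻¹ = (simil g)⁻¹ • (-(J4 F) * ((mat4 g)ᵀ * J4 F)) := by
    rw [← Matrix.one_mul (mat4 g⁻¹), ← h1, Matrix.mul_assoc, h2, Matrix.mul_one]
  rw [h3]
  congr 1
  ext i j
  fin_cases i <;> fin_cases j <;> simp [J4, Matrix.mul_apply, Fin.sum_univ_four]

end Similitude

/-! ### Topology of GSp(4, ℚ_p), the maximal compact subgroup and the Iwahori subgroup. -/

section PadicTopology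

variable (p : ℕ) [Fact p.Prime]

theorem Padic.norm_sum_four_le {a b c d : ℚ_[p]} {r : ℝ} (ha : ‖a‖ ≤ r) (hb : ‖b‖ ≤ r)
    (hc : ‖c‖ ≤ r) (hd : ‖d‖ ≤ r) : ‖a + b + c + d‖ ≤ r := by
  refine (IsUltrametricDist.norm_add_le_max _ _).trans (max_le ?_ hd)
  refine (IsUltrametricDist.norm_add_le_max _ _).trans (max_le ?_ hc)
  exact (IsUltrametricDist.norm_add_le_max _ _).trans (max_le ha hb)

theorem Padic.norm_sum_four_lt {a b c d : ℚ_[p]} {r : ℝ} (ha : ‖a‖ < r) (hb : ‖b‖ < r)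
    (hc : ‖c‖ < r) (hd : ‖d‖ < r) : ‖a + b + c + d‖ < r := by
  refine (IsUltrametricDist.norm_add_le_max _ _).trans_lt (max_lt ?_ hd)
  refine (IsUltrametricDist.norm_add_le_max _ _).trans_lt (max_lt ?_ hc)
  exact (IsUltrametricDist.norm_add_le_max _ _).trans_lt (max_lt ha hb)

theorem norm_mul_le_one' {a b : ℚ_[p]} (ha : ‖a‖ ≤ 1) (hb : ‖b‖ ≤ 1) : ‖a * b‖ ≤ 1 := by
  rw [norm_mul]; exact mul_le_one₀ ha (norm_nonneg _) hb

theorem norm_mul_lt_one_left {a b : ℚ_[p]} (ha : ‖a‖ < 1) (hb : ‖b‖ ≤ 1) : ‖a * b‖ < 1 := by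
  rw [norm_mul]; exact mul_lt_one_of_nonneg_of_lt_one_left (norm_nonneg _) ha hb

theorem norm_mul_lt_one_right {a b : ℚ_[p]} (ha : ‖a‖ ≤ 1) (hb : ‖b‖ < 1) : ‖a * b‖ < 1 := by
  rw [norm_mul]; exact mul_lt_one_of_nonneg_of_lt_one_right ha (norm_nonneg _) hb

variable {p}

theorem norm_apply_le_one_of_mem_maxCompact {g : GSp4 ℚ_[p]} (hg : g ∈ maxCompact p)
    (i j : Fin 4) : ‖mat4 g i j‖ ≤ 1 := by
  obtain ⟨z, hz⟩ := hg
  have : mat4 g i j = ((z.1 i j : ℤ_[p]) : ℚ_[p]) := by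
    have : g.1 = Matrix.GeneralLinearGroup.map (algebraMap ℤ_[p] ℚ_[p]) z := hz.symm
    rw [mat4, this]
    rfl
  rw [this]
  exact PadicInt.norm_le_one _

theorem norm_simil_le_one {g : GSp4 ℚ_[p]} (hg : ∀ i j, ‖mat4 g i j‖ ≤ 1) : ‖simil g‖ ≤ 1 := by
  have : simil g = mat4 g 0 0 * mat4 g 2 2 + mat4 g 1 0 * mat4 g 3 2 + (-mat4 g 2 0) * mat4 g 0 2 +
      (-mat4 g 3 0) * mat4 g 1 2 := by
    simp [simil, J4, Matrix.mul_apply, Fin.sum_univ_four]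
    ring
  rw [this]
  refine Padic.norm_sum_four_le p ?_ ?_ ?_ ?_ <;> refine norm_mul_le_one' p ?_ ?_ <;>
    first | exact hg _ _ | (rw [norm_neg]; exact hg _ _)

theorem norm_simil_of_mem_maxCompact {g : GSp4 ℚ_[p]} (hg : g ∈ maxCompact p) :
    ‖simil g‖ = 1 := by
  refine le_antisymm (norm_simil_le_one (norm_apply_le_one_of_mem_maxCompact hg)) ?_
  have h := norm_simil_le_one (norm_apply_le_one_of_mem_maxCompact ((maxCompact p).inv_mem hg))
  rw [simil_inv, norm_inv] at h
  exact (inv_le_one₀ (norm_pos_iff.mpr (simil_ne_zero g))).mp h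

theorem norm_inv_apply_le_one {g : GSp4 ℚ_[p]} (hg : ∀ i j, ‖mat4 g i j‖ ≤ 1)
    (h : ‖simil g‖ = 1) (i j : Fin 4) : ‖mat4 g⁻¹ i j‖ ≤ 1 := by
  rw [mat4_inv, Matrix.smul_apply, smul_eq_mul, norm_mul, norm_inv, h, inv_one, one_mul]
  fin_cases i <;> fin_cases j <;> simp [hg]

/-- A unit similitude factor suffices in place of a unit determinant, since the inverse is ν⁻¹ times
a signed rearrangement of the entries. -/
theorem mem_maxCompact_iff {g : GSp4 ℚ_[p]} :
    g ∈ maxCompact p ↔ (∀ i j, ‖mat4 g i j‖ ≤ 1) ∧ ‖simil g‖ = 1 := by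
  refine ⟨fun h => ⟨norm_apply_le_one_of_mem_maxCompact h, norm_simil_of_mem_maxCompact h⟩, ?_⟩
  rintro ⟨h, hs⟩
  have h' := norm_inv_apply_le_one h hs
  let Z : Matrix (Fin 4) (Fin 4) ℤ_[p] := fun i j => ⟨mat4 g i j, h i j⟩
  let W : Matrix (Fin 4) (Fin 4) ℤ_[p] := fun i j => ⟨mat4 g⁻¹ i j, h' i j⟩
  have hinj : Function.Injective (fun M : Matrix (Fin 4) (Fin 4) ℤ_[p] =>
      M.map (algebraMap ℤ_[p] ℚ_[p])) :=
    Matrix.map_injective (IsFractionRing.injective ℤ_[p] ℚ_[p])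
  have hZ : Z.map (algebraMap ℤ_[p] ℚ_[p]) = mat4 g := rfl
  have hW : W.map (algebraMap ℤ_[p] ℚ_[p]) = mat4 g⁻¹ := rfl
  refine ⟨⟨Z, W, hinj ?_, hinj ?_⟩, ?_⟩
  · change (Z * W).map (algebraMap ℤ_[p] ℚ_[p]) = (1 : Matrix _ _ _).map (algebraMap ℤ_[p] ℚ_[p])
    rw [Matrix.map_mul, hZ, hW, ← mat4_mul, mul_inv_cancel, mat4_one,
      Matrix.map_one _ (map_zero _) (map_one _)]
  · change (W * Z).map (algebraMap ℤ_[p] ℚ_[p]) = (1 : Matrix _ _ _).map (algebraMap ℤ_[p] ℚ_[p])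
    rw [Matrix.map_mul, hZ, hW, ← mat4_mul, inv_mul_cancel, mat4_one,
      Matrix.map_one _ (map_zero _) (map_one _)]
  · exact Units.ext hZ

theorem continuous_mat : Continuous (fun g : GSp4 ℚ_[p] => mat4 g) :=
  Units.continuous_val.comp continuous_subtype_val

theorem continuous_mat_apply (i j : Fin 4) : Continuous (fun g : GSp4 ℚ_[p] => mat4 g i j) :=
  continuous_mat.matrix_elem i j

theorem continuous_simil : Continuous (simil : GSp4 ℚ_[p] → ℚ_[p]) :=
  (((continuous_mat.matrix_transpose).matrix_mul continuous_const).matrix_mul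
    continuous_mat).matrix_elem 0 2

theorem isOpen_maxCompact : IsOpen (maxCompact p : Set (GSp4 ℚ_[p])) := by
  have : (maxCompact p : Set (GSp4 ℚ_[p])) =
      (⋂ i, ⋂ j, (fun g : GSp4 ℚ_[p] => mat4 g i j) ⁻¹' Metric.closedBall 0 1) ∩
      simil ⁻¹' Metric.sphere 0 1 := by
    ext g
    simp [mem_maxCompact_iff]
  rw [this]
  refine IsOpen.inter ?_ ?_
  · exact isOpen_iInter_of_finite fun i => isOpen_iInter_of_finite fun j =>
      (IsUltrametricDist.isOpen_closedBall _ one_ne_zero).preimage (continuous_mat_apply i j)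
  · exact (IsUltrametricDist.isOpen_sphere _ one_ne_zero).preimage continuous_simil

theorem isClosed_GSp4 : IsClosed (GSp4 ℚ_[p] : Set (GL (Fin 4) ℚ_[p])) := by
  have : (GSp4 ℚ_[p] : Set (GL (Fin 4) ℚ_[p])) =
      {g | g.1ᵀ * J4 ℚ_[p] * g.1 = ((g.1ᵀ * J4 ℚ_[p] * g.1) 0 2) • J4 ℚ_[p]} := by
    ext g
    constructor
    · intro hg
      exact simil_spec ⟨g, hg⟩
    · intro hg
      -- If the scalar vanished, gᵀJg would be 0, contradicting invertibility. So a closed matrix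
      -- identity characterizes the group, without a separate condition ν ≠ 0.
      have h0 : (g.1ᵀ * J4 ℚ_[p] * g.1) 0 2 ≠ 0 := by
        intro h0
        have hg' : g.1ᵀ * J4 ℚ_[p] * g.1 = ((g.1ᵀ * J4 ℚ_[p] * g.1) 0 2) • J4 ℚ_[p] := hg
        rw [h0, zero_smul] at hg'
        have h1 := congrArg Matrix.det hg'
        rw [Matrix.det_mul, Matrix.det_mul, Matrix.det_transpose, Matrix.det_zero] at h1
        have h2 := Matrix.GeneralLinearGroup.det_ne_zero g
        have h3 : (J4 ℚ_[p]).det ≠ 0 := by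
          intro h3
          have h4 := congrArg Matrix.det (J4_mul_J4 (F := ℚ_[p]))
          rw [Matrix.det_mul, h3, zero_mul, Matrix.det_neg, Matrix.det_one] at h4
          norm_num at h4
        exact mul_ne_zero (mul_ne_zero h2 h3) h2 h1
      exact ⟨Units.mk0 _ h0, hg⟩
  rw [this]
  have hv : Continuous (fun g : GL (Fin 4) ℚ_[p] => g.1) := Units.continuous_val
  have hc : Continuous (fun g : GL (Fin 4) ℚ_[p] => g.1ᵀ * J4 ℚ_[p] * g.1) :=
    (hv.matrix_transpose.matrix_mul continuous_const).matrix_mul hv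
  exact isClosed_eq hc ((hc.matrix_elem 0 2).smul continuous_const)

theorem isCompact_maxCompact : IsCompact (maxCompact p : Set (GSp4 ℚ_[p])) := by
  have : CompactSpace (Matrix (Fin 4) (Fin 4) ℤ_[p]) :=
    inferInstanceAs (CompactSpace (Fin 4 → Fin 4 → ℤ_[p]))
  have h1 : IsCompact (Set.range (Matrix.GeneralLinearGroup.map (n := Fin 4)
      (algebraMap ℤ_[p] ℚ_[p]))) := by
    refine isCompact_range (Units.continuous_map ?_)
    exact continuous_id.matrix_map (continuous_subtype_val)
  exact isClosed_GSp4.isClosedEmbedding_subtypeVal.isCompact_preimage h1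

instance : LocallyCompactSpace (GSp4 ℚ_[p]) :=
  isCompact_maxCompact.locallyCompactSpace_of_mem_nhds_of_group
    (isOpen_maxCompact.mem_nhds (maxCompact p).one_mem)

instance : SecondCountableTopology (GSp4 ℚ_[p]) := by
  have : SecondCountableTopology (Matrix (Fin 4) (Fin 4) ℚ_[p]) :=
    inferInstanceAs (SecondCountableTopology (Fin 4 → Fin 4 → ℚ_[p]))
  have : SecondCountableTopology (Matrix (Fin 4) (Fin 4) ℚ_[p])ᵐᵒᵖ :=
    MulOpposite.opHomeomorph.symm.secondCountableTopology
  have : SecondCountableTopology (GL (Fin 4) ℚ_[p]) :=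
    Units.isEmbedding_embedProduct.secondCountableTopology
  exact Topology.IsEmbedding.subtypeVal.secondCountableTopology

noncomputable instance : MeasurableSpace (GSp4 ℚ_[p]) := borel _

instance : BorelSpace (GSp4 ℚ_[p]) := ⟨rfl⟩

variable (p) in
/-- The Iwahori subgroup `I_p` as a subgroup of `GSp(4, ℚ_p)`. -/
noncomputable def iwahoriSubgroup : Subgroup (GSp4 ℚ_[p]) where
  carrier := iwahori p
  one_mem' := by
    refine ⟨(maxCompact p).one_mem, ?_⟩
    simp
  mul_mem' := by
    rintro a b ⟨ha, a01, a20, a21, a30, a31, a32⟩ ⟨hb, b01, b20, b21, b30, b31, b32⟩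
    have ia := norm_apply_le_one_of_mem_maxCompact ha
    have ib := norm_apply_le_one_of_mem_maxCompact hb
    refine ⟨(maxCompact p).mul_mem ha hb, ?_⟩
    change ‖(mat4 a * mat4 b) 0 1‖ < 1 ∧ ‖(mat4 a * mat4 b) 2 0‖ < 1 ∧ ‖(mat4 a * mat4 b) 2 1‖ < 1 ∧
      ‖(mat4 a * mat4 b) 3 0‖ < 1 ∧ ‖(mat4 a * mat4 b) 3 1‖ < 1 ∧ ‖(mat4 a * mat4 b) 3 2‖ < 1
    simp only [Matrix.mul_apply, Fin.sum_univ_four]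
    refine ⟨?_, ?_, ?_, ?_, ?_, ?_⟩ <;> refine Padic.norm_sum_four_lt p ?_ ?_ ?_ ?_ <;>
      first
      | exact norm_mul_lt_one_left p (by assumption) (ib _ _)
      | exact norm_mul_lt_one_right p (ia _ _) (by assumption)
  inv_mem' := by
    rintro a ⟨ha, a01, a20, a21, a30, a31, a32⟩
    refine ⟨(maxCompact p).inv_mem ha, ?_⟩
    change ‖mat4 a⁻¹ 0 1‖ < 1 ∧ ‖mat4 a⁻¹ 2 0‖ < 1 ∧ ‖mat4 a⁻¹ 2 1‖ < 1 ∧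
      ‖mat4 a⁻¹ 3 0‖ < 1 ∧ ‖mat4 a⁻¹ 3 1‖ < 1 ∧ ‖mat4 a⁻¹ 3 2‖ < 1
    have hs := norm_simil_of_mem_maxCompact ha
    rw [mat4_inv]
    simp only [Matrix.smul_apply, smul_eq_mul, norm_mul, norm_inv, hs, inv_one, one_mul]
    simp
    exact ⟨a32, a20, a30, a21, a31, a01⟩

theorem iwahoriSubgroup_le : iwahoriSubgroup p ≤ maxCompact p := fun _ h => h.1

theorem isOpen_iwahori : IsOpen (iwahori p) := by
  have h : ∀ i j, IsOpen {g : GSp4 ℚ_[p] | ‖g.1.1 i j‖ < 1} := fun i j =>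
    isOpen_lt (continuous_norm.comp (continuous_mat_apply i j)) continuous_const
  exact isOpen_maxCompact.inter ((h _ _).inter ((h _ _).inter ((h _ _).inter ((h _ _).inter
    ((h _ _).inter (h _ _))))))

end PadicTopology

/-! ### The index of the Iwahori subgroup, through the Klingen subgroup. -/

section IwahoriIndex

variable {p : ℕ} [Fact p.Prime]

theorem toZMod_eq_iff (x y : ℤ_[p]) :
    PadicInt.toZMod x = PadicInt.toZMod y ↔ ‖(x : ℚ_[p]) - y‖ < 1 := by
  rw [← sub_eq_zero, ← map_sub, ← RingHom.mem_ker, PadicInt.ker_toZMod,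
    IsLocalRing.mem_maximalIdeal, PadicInt.mem_nonunits, ← PadicInt.coe_sub]
  rfl

/-- The reduction modulo `p` of the entries of an element of `K_p`. -/
noncomputable def redEntry (g : maxCompact p) (i j : Fin 4) : ZMod p :=
  PadicInt.toZMod ⟨mat4 (g : GSp4 ℚ_[p]) i j, norm_apply_le_one_of_mem_maxCompact g.2 i j⟩

theorem redEntry_eq_iff (g : maxCompact p) (i j : Fin 4) (x : ℤ_[p]) :
    redEntry g i j = PadicInt.toZMod x ↔ ‖mat4 (g : GSp4 ℚ_[p]) i j - x‖ < 1 :=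
  toZMod_eq_iff _ _

theorem redEntry_eq_zero_iff (g : maxCompact p) (i j : Fin 4) :
    redEntry g i j = 0 ↔ ‖mat4 (g : GSp4 ℚ_[p]) i j‖ < 1 := by
  have := redEntry_eq_iff g i j 0
  simpa using this

theorem toZMod_mul_redEntry_eq_iff (g h : maxCompact p) (i j k l : Fin 4) (c : ℤ_[p]) :
    PadicInt.toZMod c * redEntry g i j = redEntry h k l ↔
      ‖mat4 (h : GSp4 ℚ_[p]) k l - c * mat4 (g : GSp4 ℚ_[p]) i j‖ < 1 := by
  have e : PadicInt.toZMod c * redEntry g i j = PadicInt.toZMod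
      (c * ⟨mat4 (g : GSp4 ℚ_[p]) i j, norm_apply_le_one_of_mem_maxCompact g.2 i j⟩) :=
    (map_mul PadicInt.toZMod _ _).symm
  rw [e, eq_comm, redEntry_eq_iff]
  rfl

theorem exists_toZMod_eq (c : ZMod p) : ∃ x : ℤ_[p], PadicInt.toZMod x = c :=
  ⟨(c.val : ℤ_[p]), by rw [map_natCast]; exact ZMod.natCast_zmod_val c⟩

theorem norm_apply_three_three {g : GSp4 ℚ_[p]} (hg : g ∈ maxCompact p) (h0 : ‖mat4 g 3 0‖ < 1)
    (h1 : ‖mat4 g 3 1‖ < 1) (h2 : ‖mat4 g 3 2‖ < 1) : ‖mat4 g 3 3‖ = 1 := by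
  refine le_antisymm (norm_apply_le_one_of_mem_maxCompact hg _ _) (not_lt.mp fun h3 => ?_)
  have hi := norm_apply_le_one_of_mem_maxCompact ((maxCompact p).inv_mem hg)
  have e : (mat4 g * mat4 g⁻¹) 3 3 = 1 := by rw [← mat4_mul, mul_inv_cancel, mat4_one]; simp
  have : ‖(mat4 g * mat4 g⁻¹) 3 3‖ < 1 := by
    rw [Matrix.mul_apply, Fin.sum_univ_four]
    exact Padic.norm_sum_four_lt p (norm_mul_lt_one_left p h0 (hi _ _))
      (norm_mul_lt_one_left p h1 (hi _ _)) (norm_mul_lt_one_left p h2 (hi _ _))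
      (norm_mul_lt_one_left p h3 (hi _ _))
  rw [e, norm_one] at this
  exact lt_irrefl _ this

variable (p) in
/-- The elements of `K_p` whose last row is a multiple of `(0, 0, 0, 1)` modulo `p`. -/
noncomputable def klingen : Subgroup (GSp4 ℚ_[p]) where
  carrier := {g | g ∈ maxCompact p ∧ ‖mat4 g 3 0‖ < 1 ∧ ‖mat4 g 3 1‖ < 1 ∧ ‖mat4 g 3 2‖ < 1}
  one_mem' := by
    refine ⟨(maxCompact p).one_mem, ?_⟩
    rw [mat4_one]
    simp
  mul_mem' := by
    rintro a b ⟨ha, a30, a31, a32⟩ ⟨hb, b30, b31, b32⟩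
    have ia := norm_apply_le_one_of_mem_maxCompact ha
    have ib := norm_apply_le_one_of_mem_maxCompact hb
    refine ⟨(maxCompact p).mul_mem ha hb, ?_⟩
    simp only [mat4_mul, Matrix.mul_apply, Fin.sum_univ_four]
    refine ⟨?_, ?_, ?_⟩ <;> refine Padic.norm_sum_four_lt p ?_ ?_ ?_ ?_ <;>
      first
      | exact norm_mul_lt_one_left p (by assumption) (ib _ _)
      | exact norm_mul_lt_one_right p (ia _ _) (by assumption)
  inv_mem' := by
    rintro a ⟨ha, a30, a31, a32⟩
    have ha' := (maxCompact p).inv_mem ha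
    have hi := norm_apply_le_one_of_mem_maxCompact ha'
    have h33 := norm_apply_three_three ha a30 a31 a32
    have key : ∀ k : Fin 4, k ≠ 3 → ‖mat4 a⁻¹ 3 k‖ < 1 := by
      intro k hk
      have e : (mat4 a * mat4 a⁻¹) 3 k = 0 := by
        rw [← mat4_mul, mul_inv_cancel, mat4_one, Matrix.one_apply_ne hk.symm]
      rw [Matrix.mul_apply, Fin.sum_univ_four] at e
      have e2 : mat4 a 3 3 * mat4 a⁻¹ 3 k =
          -(mat4 a 3 0 * mat4 a⁻¹ 0 k + mat4 a 3 1 * mat4 a⁻¹ 1 k + mat4 a 3 2 * mat4 a⁻¹ 2 k + 0)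
          := by linear_combination e
      have e3 : ‖mat4 a 3 3 * mat4 a⁻¹ 3 k‖ < 1 := by
        rw [e2, norm_neg]
        exact Padic.norm_sum_four_lt p (norm_mul_lt_one_left p a30 (hi _ _))
          (norm_mul_lt_one_left p a31 (hi _ _)) (norm_mul_lt_one_left p a32 (hi _ _))
          (by simp)
      rwa [norm_mul, h33, one_mul] at e3
    exact ⟨ha', key 0 (by decide), key 1 (by decide), key 2 (by decide)⟩

theorem klingen_le : klingen p ≤ maxCompact p := fun _ h => h.1

theorem iwahoriSubgroup_le_klingen : iwahoriSubgroup p ≤ klingen p :=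
  fun _ h => ⟨h.1, h.2.2.2.2.1, h.2.2.2.2.2.1, h.2.2.2.2.2.2⟩

/-- The inverse is also in the Klingen subgroup, and by the inverse formula its last row is, up to a
unit, made of entries of the second column of g. Hence inside this subgroup the Iwahori condition
reduces to the entry `2 0`. -/
theorem mem_klingen_norm {g : GSp4 ℚ_[p]} (hg : g ∈ klingen p) :
    ‖mat4 g 2 1‖ < 1 ∧ ‖mat4 g 0 1‖ < 1 := by
  obtain ⟨-, h30, -, h32⟩ := (klingen p).inv_mem hg
  have hs := norm_simil_of_mem_maxCompact hg.1
  rw [mat4_inv] at h30 h32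
  simp only [Matrix.smul_apply, smul_eq_mul, norm_mul, norm_inv, hs, inv_one, one_mul] at h30 h32
  exact ⟨by simpa using h30, by simpa using h32⟩

theorem mem_iwahoriSubgroup_iff {g : GSp4 ℚ_[p]} :
    g ∈ iwahoriSubgroup p ↔ g ∈ klingen p ∧ ‖mat4 g 2 0‖ < 1 := by
  refine ⟨fun h => ⟨iwahoriSubgroup_le_klingen h, h.2.2.1⟩, fun ⟨h, h'⟩ => ?_⟩
  obtain ⟨h21, h01⟩ := mem_klingen_norm h
  exact ⟨h.1, h01, h', h21, h.2⟩

theorem redEntry_three_ne_zero (g : maxCompact p) : redEntry g 3 ≠ 0 := by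
  intro h
  have h' : ∀ j, ‖mat4 (g : GSp4 ℚ_[p]) 3 j‖ < 1 := fun j =>
    (redEntry_eq_zero_iff g 3 j).mp (congrFun h j)
  exact (norm_apply_three_three g.2 (h' 0) (h' 1) (h' 2)).not_lt (h' 3)

/-- An element of `K_p` with last row `(x, y, z, 1)`. -/
noncomputable def rowElt (x y z : ℤ_[p]) : maxCompact p :=
  ⟨GSp4.ofMatrix !![1, -(z : ℚ_[p]), 0, 0; 0, 1, 0, 0; 0, x, 1, 0; x, y, z, 1] 1 one_ne_zero (by
      ext i j
      fin_cases i <;> fin_cases j <;> simp [J4, Matrix.mul_apply, Fin.sum_univ_four]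
      ring), by
    refine mem_maxCompact_iff.mpr ⟨fun i j => ?_, ?_⟩
    · fin_cases i <;> fin_cases j <;> simp [PadicInt.norm_le_one]
    · rw [simil_ofMatrix, norm_one]⟩

theorem elJ_mem_maxCompact : (elJ : GSp4 ℚ_[p]) ∈ maxCompact p := by
  refine mem_maxCompact_iff.mpr ⟨fun i j => ?_, ?_⟩
  · fin_cases i <;> fin_cases j <;> simp [elJ, J4]
  · rw [elJ, simil_ofMatrix, norm_one]

theorem elZ_none_mem_maxCompact : (elZ none : GSp4 ℚ_[p]) ∈ maxCompact p := by
  refine mem_maxCompact_iff.mpr ⟨fun i j => ?_, ?_⟩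
  · fin_cases i <;> fin_cases j <;> simp [elZ]
  · rw [elZ, simil_ofMatrix, norm_one]

/-- Surjectivity onto projective 3-space. After scaling a nonzero coordinate to 1, the vector is the
last row of some `rowElt`, up to multiplication on the right by J and Z_∞, which permute the
coordinates up to sign and bring the 1 to the last place. -/
theorem exists_redEntry_three {v : Fin 4 → ZMod p} (hv : v ≠ 0) :
    ∃ g : maxCompact p, ∃ c : ZMod p, c • v = redEntry g 3 := by
  obtain ⟨i, hi⟩ := Function.ne_iff.mp hv
  have hi' : v i ≠ 0 := hi
  choose L hL using fun j => exists_toZMod_eq ((v i)⁻¹ * v j)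
  suffices h : ∃ g : maxCompact p, ∀ j, ‖mat4 (g : GSp4 ℚ_[p]) 3 j - L j‖ < 1 by
    obtain ⟨g, hg⟩ := h
    refine ⟨g, (v i)⁻¹, ?_⟩
    ext j
    rw [(redEntry_eq_iff g 3 j (L j)).mpr (hg j), hL, Pi.smul_apply, smul_eq_mul]
  have h1 : ‖(1 : ℚ_[p]) - L i‖ < 1 := by
    have := (toZMod_eq_iff 1 (L i)).mp (by rw [hL, inv_mul_cancel₀ hi', map_one])
    simpa using this
  fin_cases i
  · refine ⟨rowElt (-L 3) (-L 2) (L 1) * ⟨elJ, elJ_mem_maxCompact⟩ *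
      ⟨elZ none, elZ_none_mem_maxCompact⟩ * ⟨elJ, elJ_mem_maxCompact⟩ *
      ⟨elJ, elJ_mem_maxCompact⟩, fun j => ?_⟩
    simp only [Subgroup.coe_mul, mat4_mul]
    fin_cases j <;> simp [rowElt, elJ, elZ, J4, Matrix.mul_apply, Fin.sum_univ_four]
    exact h1
  · refine ⟨rowElt (-L 2) (-L 3) (L 0) * ⟨elJ, elJ_mem_maxCompact⟩ * ⟨elJ, elJ_mem_maxCompact⟩ *
      ⟨elJ, elJ_mem_maxCompact⟩, fun j => ?_⟩
    simp only [Subgroup.coe_mul, mat4_mul]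
    fin_cases j <;> simp [rowElt, elJ, J4, Matrix.mul_apply, Fin.sum_univ_four]
    exact h1
  · refine ⟨rowElt (L 1) (L 0) (L 3) * ⟨elZ none, elZ_none_mem_maxCompact⟩, fun j => ?_⟩
    simp only [Subgroup.coe_mul, mat4_mul]
    fin_cases j <;> simp [rowElt, elZ, Matrix.mul_apply, Fin.sum_univ_four]
    exact h1
  · refine ⟨rowElt (L 0) (L 1) (L 2), fun j => ?_⟩
    fin_cases j <;> simp [rowElt]
    exact h1

/-- The line spanned by the last row modulo p determines the right coset, and all points of
projective 3-space over the field with p elements occur: 1 + p + p² + p³ of them. -/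
theorem relIndex_klingen : (klingen p).relIndex (maxCompact p) = (p + 1) * (p ^ 2 + 1) := by
  let f : maxCompact p → Projectivization (ZMod p) (Fin 4 → ZMod p) := fun g =>
    Projectivization.mk _ (redEntry g 3) (redEntry_three_ne_zero g)
  rw [relIndex_eq_card_of_surjective f, Projectivization.card_of_finrank (n := 4) _ _ (by simp),
    Nat.card_zmod]
  · simp [Finset.sum_range_succ]; ring
  · intro y
    induction y using Projectivization.ind with
    | h v hv =>
      obtain ⟨g, c, h⟩ := exists_redEntry_three hv
      exact ⟨g, (Projectivization.mk_eq_mk_iff' _ _ _ _ _).mpr ⟨c, h⟩⟩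
  · intro a b
    have hia := norm_apply_le_one_of_mem_maxCompact ((maxCompact p).inv_mem a.2)
    have ha := norm_apply_le_one_of_mem_maxCompact a.2
    set m : GSp4 ℚ_[p] := (b : GSp4 ℚ_[p]) * (a : GSp4 ℚ_[p])⁻¹ with hm
    have hmK : m ∈ maxCompact p := (maxCompact p).mul_mem b.2 ((maxCompact p).inv_mem a.2)
    have hbm : (b : GSp4 ℚ_[p]) = m * a := by rw [hm, inv_mul_cancel_right]
    constructor
    · intro h
      obtain ⟨c, hc⟩ := (Projectivization.mk_eq_mk_iff' _ _ _ _ _).mp h.symm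
      obtain ⟨C, rfl⟩ := exists_toZMod_eq c
      have hd : ∀ j, ‖mat4 (b : GSp4 ℚ_[p]) 3 j - C * mat4 (a : GSp4 ℚ_[p]) 3 j‖ < 1 := by
        intro j
        exact (toZMod_mul_redEntry_eq_iff _ _ _ _ _ _ _).mp (congrFun hc j)
      have key : ∀ k : Fin 4, k ≠ 3 → ‖mat4 m 3 k‖ < 1 := by
        intro k hk
        have e : (mat4 (a : GSp4 ℚ_[p]) * mat4 (a : GSp4 ℚ_[p])⁻¹) 3 k = 0 := by
          rw [← mat4_mul, mul_inv_cancel, mat4_one, Matrix.one_apply_ne hk.symm]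
        have e2 : mat4 m 3 k = ∑ j, (mat4 (b : GSp4 ℚ_[p]) 3 j - C * mat4 (a : GSp4 ℚ_[p]) 3 j) *
            mat4 (a : GSp4 ℚ_[p])⁻¹ j k := by
          rw [hm, mat4_mul, Matrix.mul_apply]
          rw [Matrix.mul_apply] at e
          simp only [sub_mul, mul_assoc, Finset.sum_sub_distrib, ← Finset.mul_sum, e]
          simp
        rw [e2, Fin.sum_univ_four]
        exact Padic.norm_sum_four_lt p (norm_mul_lt_one_left p (hd 0) (hia _ _))
          (norm_mul_lt_one_left p (hd 1) (hia _ _)) (norm_mul_lt_one_left p (hd 2) (hia _ _))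
          (norm_mul_lt_one_left p (hd 3) (hia _ _))
      exact ⟨hmK, key 0 (by decide), key 1 (by decide), key 2 (by decide)⟩
    · rintro ⟨-, h0, h1, h2⟩
      refine ((Projectivization.mk_eq_mk_iff' _ _ _ _ _).mpr
        ⟨PadicInt.toZMod ⟨mat4 m 3 3, norm_apply_le_one_of_mem_maxCompact hmK 3 3⟩, ?_⟩).symm
      ext j
      refine (toZMod_mul_redEntry_eq_iff a b 3 j 3 j _).mpr ?_
      rw [hbm, mat4_mul, Matrix.mul_apply, Fin.sum_univ_four,
        show ∀ x y z w : ℚ_[p], x + y + z + w - w = x + y + z + 0 by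
        intros; ring]
      exact Padic.norm_sum_four_lt p (norm_mul_lt_one_left p h0 (ha _ _))
          (norm_mul_lt_one_left p h1 (ha _ _)) (norm_mul_lt_one_left p h2 (ha _ _)) (by simp)

/-- The vector formed by the entries `(3, 1)` and `(3, 3)` modulo `p`. -/
noncomputable def redPair (g : maxCompact p) : Fin 2 → ZMod p := ![redEntry g 2 0, redEntry g 2 2]

theorem redPair_ne_zero {g : maxCompact p} (hg : (g : GSp4 ℚ_[p]) ∈ klingen p) :
    redPair g ≠ 0 := by
  intro h
  have h0 := (redEntry_eq_zero_iff g 2 0).mp (by simpa [redPair] using congrFun h 0)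
  have h2 := (redEntry_eq_zero_iff g 2 2).mp (by simpa [redPair] using congrFun h 1)
  have h1 := (mem_klingen_norm hg).1
  have h3 := ((klingen p).inv_mem hg).2.2.2
  have ig := norm_apply_le_one_of_mem_maxCompact g.2
  have hi := norm_apply_le_one_of_mem_maxCompact ((maxCompact p).inv_mem g.2)
  have e : (mat4 (g : GSp4 ℚ_[p]) * mat4 (g : GSp4 ℚ_[p])⁻¹) 2 2 = 1 := by
    rw [← mat4_mul, mul_inv_cancel, mat4_one]; simp
  have : ‖(mat4 (g : GSp4 ℚ_[p]) * mat4 (g : GSp4 ℚ_[p])⁻¹) 2 2‖ < 1 := by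
    rw [Matrix.mul_apply, Fin.sum_univ_four]
    exact Padic.norm_sum_four_lt p (norm_mul_lt_one_left p h0 (hi _ _))
      (norm_mul_lt_one_left p h1 (hi _ _)) (norm_mul_lt_one_left p h2 (hi _ _))
      (norm_mul_lt_one_right p (ig _ _) h3)
  rw [e, norm_one] at this
  exact lt_irrefl _ this

/-- An element of the Klingen subgroup with third row `(x, 0, 1, 0)`. -/
noncomputable def pairElt (x : ℤ_[p]) : maxCompact p :=
  ⟨GSp4.ofMatrix !![1, 0, 0, 0; 0, 1, 0, 0; (x : ℚ_[p]), 0, 1, 0; 0, 0, 0, 1] 1 one_ne_zero (by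
      ext i j
      fin_cases i <;> fin_cases j <;> simp [J4, Matrix.mul_apply, Fin.sum_univ_four]), by
    refine mem_maxCompact_iff.mpr ⟨fun i j => ?_, ?_⟩
    · fin_cases i <;> fin_cases j <;> simp [PadicInt.norm_le_one]
    · rw [simil_ofMatrix, norm_one]⟩

variable (p) in
/-- An element of the Klingen subgroup with third row `(1, 0, 0, 0)`. -/
noncomputable def pairEltInfty : maxCompact p :=
  ⟨GSp4.ofMatrix !![0, 0, -1, 0; 0, 1, 0, 0; 1, 0, 0, 0; 0, 0, 0, 1] 1 one_ne_zero (by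
      ext i j
      fin_cases i <;> fin_cases j <;> simp [J4, Matrix.mul_apply, Fin.sum_univ_four]), by
    refine mem_maxCompact_iff.mpr ⟨fun i j => ?_, ?_⟩
    · fin_cases i <;> fin_cases j <;> simp
    · rw [simil_ofMatrix, norm_one]⟩

theorem Projectivization.mk_eq_mk_iff_det {F : Type*} [Field F] (v w : Fin 2 → F) (hv : v ≠ 0)
    (hw : w ≠ 0) :
    Projectivization.mk F v hv = Projectivization.mk F w hw ↔ v 0 * w 1 - v 1 * w 0 = 0 := by
  rw [Projectivization.mk_eq_mk_iff']
  constructor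
  · rintro ⟨c, rfl⟩
    simp only [Pi.smul_apply, smul_eq_mul]
    ring
  · intro h
    by_cases h0 : w 0 = 0
    · have h1 : w 1 ≠ 0 := fun h1 => hw (by ext i; fin_cases i <;> assumption)
      refine ⟨v 1 / w 1, ?_⟩
      have : v 0 = 0 := by
        rw [h0, mul_zero, sub_zero] at h
        exact (mul_eq_zero.mp h).resolve_right h1
      ext i
      fin_cases i
      · simp [h0, this]
      · simp [h1]
    · refine ⟨v 0 / w 0, ?_⟩
      ext i
      fin_cases i
      · simp [h0]
      · simp only [Fin.mk_one, Pi.smul_apply, smul_eq_mul]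
        rw [div_mul_eq_mul_div, div_eq_iff h0]
        linear_combination h

/-- Right cosets of the Iwahori subgroup correspond to points of a projective line, through the
entries `2 0` and `2 2` modulo p. -/
theorem relIndex_iwahoriSubgroup_klingen : (iwahoriSubgroup p).relIndex (klingen p) = p + 1 := by
  let f : klingen p → Projectivization (ZMod p) (Fin 2 → ZMod p) := fun g =>
    Projectivization.mk _ (redPair ⟨g, g.2.1⟩) (redPair_ne_zero g.2)
  rw [relIndex_eq_card_of_surjective f, Projectivization.card_of_finrank_two _ _ (by simp),
    Nat.card_zmod]
  · intro y
    induction y using Projectivization.ind with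
    | h v hv =>
      by_cases h1 : v 1 = 0
      · have hk : (pairEltInfty p : GSp4 ℚ_[p]) ∈ klingen p := by
          refine ⟨(pairEltInfty p).2, ?_⟩
          simp [pairEltInfty]
        refine ⟨⟨pairEltInfty p, hk⟩, (Projectivization.mk_eq_mk_iff_det _ _ _ _).mpr ?_⟩
        have : redEntry (pairEltInfty p) 2 2 = 0 :=
          (redEntry_eq_zero_iff _ _ _).mpr (by simp [pairEltInfty])
        simp [redPair, h1, this]
      · obtain ⟨x, hx⟩ := exists_toZMod_eq (v 0 / v 1)
        have hk : (pairElt x : GSp4 ℚ_[p]) ∈ klingen p := by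
          refine ⟨(pairElt x).2, ?_⟩
          simp [pairElt]
        refine ⟨⟨pairElt x, hk⟩, (Projectivization.mk_eq_mk_iff_det _ _ _ _).mpr ?_⟩
        have e0 : redEntry (pairElt x) 2 0 = v 0 / v 1 := by
          rw [← hx]
          exact (redEntry_eq_iff _ _ _ _).mpr (by simp [pairElt])
        have e2 : redEntry (pairElt x) 2 2 = 1 := by
          rw [← map_one PadicInt.toZMod]
          exact (redEntry_eq_iff _ _ _ _).mpr (by simp [pairElt])
        simp [redPair, e0, e2, h1]
  · intro a b
    have ha := norm_apply_le_one_of_mem_maxCompact a.2.1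
    have hb := norm_apply_le_one_of_mem_maxCompact b.2.1
    have hs := norm_simil_of_mem_maxCompact a.2.1
    have hd : f a = f b ↔ ‖mat4 (a : GSp4 ℚ_[p]) 2 0 * mat4 (b : GSp4 ℚ_[p]) 2 2 -
        mat4 (a : GSp4 ℚ_[p]) 2 2 * mat4 (b : GSp4 ℚ_[p]) 2 0‖ < 1 := by
      refine (Projectivization.mk_eq_mk_iff_det _ _ _ _).trans ?_
      rw [sub_eq_zero]
      have h1 : redPair ⟨a, a.2.1⟩ 0 * redPair ⟨b, b.2.1⟩ 1 = PadicInt.toZMod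
          (⟨mat4 (a : GSp4 ℚ_[p]) 2 0, ha _ _⟩ * ⟨mat4 (b : GSp4 ℚ_[p]) 2 2, hb _ _⟩) :=
        (map_mul PadicInt.toZMod _ _).symm
      have h2 : redPair ⟨a, a.2.1⟩ 1 * redPair ⟨b, b.2.1⟩ 0 = PadicInt.toZMod
          (⟨mat4 (a : GSp4 ℚ_[p]) 2 2, ha _ _⟩ * ⟨mat4 (b : GSp4 ℚ_[p]) 2 0, hb _ _⟩) :=
        (map_mul PadicInt.toZMod _ _).symm
      rw [h1, h2, toZMod_eq_iff]
      rfl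
    rw [hd, mem_iwahoriSubgroup_iff, and_iff_right ((klingen p).mul_mem b.2
      ((klingen p).inv_mem a.2))]
    -- Up to a unit this entry is minus the 2×2 determinant comparing the two projective points,
    -- plus terms containing an entry `2 1`, which is divisible by p in the Klingen subgroup.
    have e : mat4 ((b : GSp4 ℚ_[p]) * (a : GSp4 ℚ_[p])⁻¹) 2 0 = (simil (a : GSp4 ℚ_[p]))⁻¹ *
        (-(mat4 (a : GSp4 ℚ_[p]) 2 0 * mat4 (b : GSp4 ℚ_[p]) 2 2 -
          mat4 (a : GSp4 ℚ_[p]) 2 2 * mat4 (b : GSp4 ℚ_[p]) 2 0) +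
          (mat4 (b : GSp4 ℚ_[p]) 2 1 * mat4 (a : GSp4 ℚ_[p]) 2 3 +
            -mat4 (b : GSp4 ℚ_[p]) 2 3 * mat4 (a : GSp4 ℚ_[p]) 2 1)) := by
      rw [mat4_mul, mat4_inv, Matrix.mul_apply, Fin.sum_univ_four]
      simp
      ring
    have hsmall : ‖mat4 (b : GSp4 ℚ_[p]) 2 1 * mat4 (a : GSp4 ℚ_[p]) 2 3 +
            -mat4 (b : GSp4 ℚ_[p]) 2 3 * mat4 (a : GSp4 ℚ_[p]) 2 1‖ < 1 := by
      refine (IsUltrametricDist.norm_add_le_max _ _).trans_lt (max_lt ?_ ?_)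
      · exact norm_mul_lt_one_left p (mem_klingen_norm b.2).1 (ha _ _)
      · exact norm_mul_lt_one_right p (by rw [norm_neg]; exact hb _ _) (mem_klingen_norm a.2).1
    rw [e, norm_mul, norm_inv, hs, inv_one, one_mul]
    generalize mat4 (b : GSp4 ℚ_[p]) 2 1 * mat4 (a : GSp4 ℚ_[p]) 2 3 +
            -mat4 (b : GSp4 ℚ_[p]) 2 3 * mat4 (a : GSp4 ℚ_[p]) 2 1 = u at hsmall ⊢
    generalize mat4 (a : GSp4 ℚ_[p]) 2 0 * mat4 (b : GSp4 ℚ_[p]) 2 2 -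
        mat4 (a : GSp4 ℚ_[p]) 2 2 * mat4 (b : GSp4 ℚ_[p]) 2 0 = w
    constructor
    · intro hw
      exact (IsUltrametricDist.norm_add_le_max _ _).trans_lt (max_lt (by rwa [norm_neg]) hsmall)
    · intro hw
      have : w = -(-w + u) + u := by ring
      rw [this]
      exact (IsUltrametricDist.norm_add_le_max _ _).trans_lt (max_lt (by rwa [norm_neg]) hsmall)

theorem relIndex_iwahoriSubgroup :
    (iwahoriSubgroup p).relIndex (maxCompact p) = (p + 1) ^ 2 * (p ^ 2 + 1) := by
  rw [← Subgroup.relIndex_mul_relIndex _ _ _ iwahoriSubgroup_le_klingen klingen_le,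
    relIndex_iwahoriSubgroup_klingen, relIndex_klingen]
  ring

end IwahoriIndex

/-! ### Inert primes: a² - D is a unit for every integral a. -/

section Inert

variable {p : ℕ} [Fact p.Prime]

theorem notMem_range_of_finrank_sqrtField {D : ℚ} (h : Module.finrank ℚ (sqrtField D) = 2) {z : ℂ}
    (hz : z ^ 2 = D) : z ∉ (algebraMap ℚ ℂ).range := by
  rintro ⟨q, hq⟩
  have hbot : sqrtField D = ⊥ := by
    rw [sqrtField, IntermediateField.adjoin_eq_bot_iff]
    intro w hw
    have h1 : w ^ 2 = z ^ 2 := by rw [hz]; exact hw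
    rcases sq_eq_sq_iff_eq_or_eq_neg.mp h1 with rfl | rfl
    · exact IntermediateField.mem_bot.mpr ⟨q, hq⟩
    · exact IntermediateField.mem_bot.mpr ⟨-q, by rw [map_neg, hq]⟩
  rw [hbot, IntermediateField.finrank_bot] at h
  norm_num at h

/-- The minimal polynomial of β = (z - c)/q over ℚ is X² + (2c/q)X + (c² - N)/q². It has integer
coefficients because β is integral, and its linear coefficient gives the divisibility. -/
theorem dvd_two_mul_of_isIntegral {q : ℤ} (hq : q ≠ 0) {c N : ℤ} {z : ℂ} (hz : z ^ 2 = N)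
    (hz' : z ∉ (algebraMap ℚ ℂ).range) {β : ℂ} (hβ : IsIntegral ℤ β) (h : z - c = q * β) :
    q ∣ 2 * c := by
  have hqC : (q : ℂ) ≠ 0 := Int.cast_ne_zero.mpr hq
  have hqQ : (q : ℚ) ≠ 0 := Int.cast_ne_zero.mpr hq
  have hβQ : IsIntegral ℚ β := hβ.tower_top
  have hβ' : β ∉ (algebraMap ℚ ℂ).range := by
    rintro ⟨r, hr⟩
    refine hz' ⟨q * r + c, ?_⟩
    rw [map_add, map_mul, hr, map_intCast, map_intCast, ← h]
    ring
  let Q : Polynomial ℚ := Polynomial.X ^ 2 + (Polynomial.C (2 * c / q : ℚ) * Polynomial.X +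
    Polynomial.C ((c ^ 2 - N) / q ^ 2 : ℚ))
  have hQdeg : (Polynomial.C (2 * c / q : ℚ) * Polynomial.X +
      Polynomial.C ((c ^ 2 - N) / q ^ 2 : ℚ)).degree < 2 :=
    Polynomial.degree_linear_lt
  have hQm : Q.Monic := Polynomial.monic_X_pow_add hQdeg
  have hQn : Q.natDegree = 2 := by
    refine Polynomial.natDegree_eq_of_degree_eq_some ?_
    rw [Polynomial.degree_add_eq_left_of_degree_lt (by rwa [Polynomial.degree_X_pow])]
    exact Polynomial.degree_X_pow 2
  have hroot : Polynomial.aeval β Q = 0 := by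
    have e : (q : ℂ) * β = z - c := h.symm
    simp only [Q, map_add, map_mul, map_pow, Polynomial.aeval_X, Polynomial.aeval_C]
    simp only [map_div₀, map_mul, map_sub, map_pow, map_intCast, map_ofNat]
    field_simp
    have e2 : (q : ℂ) ^ 2 * β ^ 2 = (z - c) ^ 2 := by rw [← e]; ring
    linear_combination e2 + 2 * (c : ℂ) * e + hz
  have hmin : Q = minpoly ℚ β := by
    refine (Polynomial.eq_of_monic_of_dvd_of_natDegree_le (p := minpoly ℚ β) (q := Q)
      (minpoly.monic hβQ) hQm (minpoly.dvd _ _ hroot) ?_)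
    rw [hQn]
    exact (minpoly.two_le_natDegree_iff hβQ).mpr hβ'
  have hcoeff := congrArg (fun P : Polynomial ℚ => P.coeff 1) hmin
  rw [minpoly.isIntegrallyClosed_eq_field_fractions' ℚ hβ] at hcoeff
  simp only [Q, Polynomial.coeff_map, Polynomial.coeff_add, Polynomial.coeff_X_pow,
    Polynomial.coeff_C_mul, Polynomial.coeff_X_one, Polynomial.coeff_C] at hcoeff
  norm_num at hcoeff
  refine ⟨(minpoly ℤ β).coeff 1, ?_⟩
  rw [div_eq_iff hqQ] at hcoeff
  have : ((2 * c : ℤ) : ℚ) = ((q * (minpoly ℤ β).coeff 1 : ℤ) : ℚ) := by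
    push_cast
    rw [hcoeff]; ring
  exact_mod_cast this

/-- With N the numerator times the denominator of D and θ = den(D)√D, one has θ² = N. If p divided
b² - N, the prime ideal (p) would contain (θ - b)(θ + b), hence θ - c for c = b or -b. Then p
divides 2c, so c as p is odd, and so N. -/
theorem not_dvd_sq_sub_of_isInertIn (hp : p ≠ 2) {D : ℚ} (h : IsInertIn p D)
    (hn : ¬ (p : ℤ) ∣ D.num * D.den) (b : ℤ) : ¬ (p : ℤ) ∣ b ^ 2 - D.num * D.den := by
  intro hdvd
  have hpp : Prime (p : ℤ) := Nat.prime_iff_prime_int.mp Fact.out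
  obtain ⟨z, hz⟩ := IsAlgClosed.exists_pow_nat_eq (D : ℂ) (n := 2) (by norm_num)
  have hzL : z ∈ sqrtField D := IntermediateField.subset_adjoin _ _ hz
  have hden : (D.den : ℂ) ≠ 0 := Nat.cast_ne_zero.mpr D.den_ne_zero
  set N : ℤ := D.num * D.den with hN
  have hθ2 : ((D.den : ℂ) * z) ^ 2 = N := by
    rw [mul_pow, hz, hN]
    conv_lhs => rw [Rat.cast_def]
    push_cast
    field_simp
  have hθQ : (D.den : ℂ) * z ∉ (algebraMap ℚ ℂ).range := by
    rintro ⟨r, hr⟩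
    refine notMem_range_of_finrank_sqrtField h.1 hz ⟨r / D.den, ?_⟩
    rw [map_div₀, hr, map_natCast]
    field_simp
  let w : sqrtField D := ⟨(D.den : ℂ) * z, mul_mem (natCast_mem _ _) hzL⟩
  have hw2 : w ^ 2 = (N : sqrtField D) := Subtype.ext hθ2
  have hwI : IsIntegral ℤ w := by
    refine IsIntegral.of_pow (n := 2) (by norm_num) ?_
    rw [hw2]
    exact isIntegral_algebraMap (R := ℤ) (A := sqrtField D) (x := N)
  let θ : 𝓞 (sqrtField D) := ⟨w, hwI⟩
  have hθ : θ ^ 2 = (N : 𝓞 (sqrtField D)) := by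
    apply NumberField.RingOfIntegers.ext
    exact hw2
  have key : ∀ c : ℤ, (p : ℤ) ∣ c ^ 2 - N → θ - c ∈ Ideal.span {(p : 𝓞 (sqrtField D))} → False := by
    intro c hc hmem
    obtain ⟨β, hβ⟩ := Ideal.mem_span_singleton.mp hmem
    have h1 : (D.den : ℂ) * z - c = ((p : ℤ) : ℂ) * ((β : sqrtField D) : ℂ) := by
      have e1 : (θ - c : 𝓞 (sqrtField D)).1 = w - c := by
        change algebraMap (𝓞 (sqrtField D)) (sqrtField D) (θ - c) = _
        rw [map_sub, map_intCast]
        rfl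
      have e2 : (p * β : 𝓞 (sqrtField D)).1 = p * (β : sqrtField D) := by
        change algebraMap (𝓞 (sqrtField D)) (sqrtField D) (p * β) = _
        rw [map_mul, map_natCast]
      have e3 : w - c = p * (β : sqrtField D) := e1.symm.trans ((congrArg (·.1) hβ).trans e2)
      have := congrArg (Subtype.val : sqrtField D → ℂ) e3
      simpa [w] using this
    have hβI : IsIntegral ℤ ((β : sqrtField D) : ℂ) :=
      (NumberField.RingOfIntegers.isIntegral_coe β).map (sqrtField D).val.toIntAlgHom
    have h2 := dvd_two_mul_of_isIntegral hpp.ne_zero hθ2 hθQ hβI h1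
    have h3 : ¬ (p : ℤ) ∣ 2 := by
      intro h3
      have h4 : p ∣ 2 := by exact_mod_cast h3
      exact hp ((Nat.prime_dvd_prime_iff_eq Fact.out Nat.prime_two).mp h4)
    have h4 := (hpp.dvd_or_dvd h2).resolve_left h3
    refine hn ?_
    have h5 : (p : ℤ) ∣ c ^ 2 := dvd_pow h4 two_ne_zero
    have := dvd_sub h5 hc
    simpa using this
  have hprod : (θ - (b : ℤ)) * (θ - ((-b : ℤ) : 𝓞 (sqrtField D))) ∈
      Ideal.span {(p : 𝓞 (sqrtField D))} := by
    obtain ⟨k, hk⟩ := hdvd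
    refine Ideal.mem_span_singleton.mpr ⟨((-k : ℤ) : 𝓞 (sqrtField D)), ?_⟩
    have hk' : (b : 𝓞 (sqrtField D)) ^ 2 - N = p * k := by exact_mod_cast congrArg Int.cast hk
    push_cast
    linear_combination hθ - hk'
  rcases h.2.mem_or_mem hprod with h1 | h1
  · exact key b hdvd h1
  · exact key (-b) (by simpa using hdvd) h1

/-- The numerator and denominator of D are prime to p, so a times the denominator may be replaced by
an integer b congruent to it modulo p, which reduces to the integral statement. -/
theorem norm_sq_sub_eq_one (hp : p ≠ 2) {D : ℚ} (h : IsInertIn p D) (hD : ‖(D : ℚ_[p])‖ = 1)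
    {a : ℚ_[p]} (ha : ‖a‖ ≤ 1) : ‖a ^ 2 - D‖ = 1 := by
  refine le_antisymm ?_ (not_lt.mp fun hlt => ?_)
  · rw [sub_eq_add_neg]
    refine (IsUltrametricDist.norm_add_le_max _ _).trans (max_le ?_ (by rw [norm_neg, hD]))
    rw [norm_pow]
    exact pow_le_one₀ (norm_nonneg _) ha
  · have hpp : p.Prime := Fact.out
    have hden : ‖(D.den : ℚ_[p])‖ = 1 := by
      rw [Padic.norm_natCast_eq_one_iff]
      by_contra hc
      have h1 : p ∣ D.den := by
        by_contra h1
        exact hc ((Nat.Prime.coprime_iff_not_dvd hpp).mpr h1)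
      have h2 : ¬ (p : ℤ) ∣ D.num := by
        intro h2
        have h3 : p ∣ D.num.natAbs := Int.natCast_dvd.mp h2
        exact Nat.not_coprime_of_dvd_of_dvd hpp.one_lt h3 h1 D.reduced
      have h3 : ‖(D.num : ℚ_[p])‖ = 1 := by
        refine le_antisymm (Padic.norm_int_le_one _) (not_lt.mp fun h3 => h2 ?_)
        exact (Padic.norm_intCast_lt_one_iff).mp h3
      rw [Rat.cast_def, norm_div, h3, div_eq_iff (norm_ne_zero_iff.mpr
        (Nat.cast_ne_zero.mpr D.den_ne_zero)), one_mul] at hD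
      have h4 : ‖(D.den : ℚ_[p])‖ < 1 := Padic.norm_natCast_lt_one_iff.mpr h1
      exact h4.ne hD.symm
    have hnum : ‖(D.num : ℚ_[p])‖ = 1 := by
      rw [Rat.cast_def, norm_div, hden, div_one] at hD
      exact hD
    have hn : ¬ (p : ℤ) ∣ D.num * D.den := by
      rw [← Padic.norm_intCast_lt_one_iff]
      push_cast
      rw [norm_mul, hnum, hden]
      norm_num
    have had : ‖a * D.den‖ ≤ 1 := by rw [norm_mul, hden, mul_one]; exact ha
    obtain ⟨b, hb⟩ : ∃ b : ℤ, ‖a * D.den - b‖ < 1 := by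
      obtain ⟨b, -, hb⟩ := PadicInt.exists_mem_range (⟨a * D.den, had⟩ : ℤ_[p])
      refine ⟨b, ?_⟩
      rw [IsLocalRing.mem_maximalIdeal, PadicInt.mem_nonunits] at hb
      rw [PadicInt.norm_def] at hb
      exact_mod_cast hb
    refine not_dvd_sq_sub_of_isInertIn hp h hn b ?_
    rw [← Padic.norm_intCast_lt_one_iff]
    have e : ((b ^ 2 - D.num * D.den : ℤ) : ℚ_[p]) =
        -((a * D.den - b) * (a * D.den + b)) + D.den ^ 2 * (a ^ 2 - D) := by
      have hD' : (D : ℚ_[p]) * D.den = D.num := by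
        exact_mod_cast congrArg (Rat.cast : ℚ → ℚ_[p]) (Rat.mul_den_eq_num D)
      push_cast
      linear_combination (-(D.den : ℚ_[p])) * (-hD')
    rw [e]
    refine (IsUltrametricDist.norm_add_le_max _ _).trans_lt (max_lt ?_ ?_)
    · rw [norm_neg]
      exact norm_mul_lt_one_left p hb ((IsUltrametricDist.norm_add_le_max _ _).trans
        (max_le had (Padic.norm_int_le_one _)))
    · exact norm_mul_lt_one_right p (by rw [norm_pow, hden, one_pow]) hlt

end Inert

/-! ### Haar measure on ℚ_p and volumes of balls. -/

section PadicVolume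

variable (p : ℕ) [Fact p.Prime]

noncomputable instance : MeasurableSpace ℚ_[p] := borel _

instance : BorelSpace ℚ_[p] := ⟨rfl⟩

/-- The Haar measure on `ℚ_p` that gives `ℤ_p` volume `1`. -/
noncomputable def padicVol : Measure ℚ_[p] :=
  Measure.addHaarMeasure ⟨⟨Metric.closedBall 0 1, isCompact_closedBall _ _⟩,
    ⟨0, mem_interior_iff_mem_nhds.mpr (Metric.closedBall_mem_nhds _ one_pos)⟩⟩

instance : (padicVol p).IsAddHaarMeasure := by unfold padicVol; infer_instance

theorem padicVol_closedBall_zero_one : padicVol p (Metric.closedBall 0 1) = 1 :=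
  Measure.addHaarMeasure_self

theorem padicVol_closedBall_eq (c : ℚ_[p]) (r : ℝ) :
    padicVol p (Metric.closedBall c r) = padicVol p (Metric.closedBall 0 r) := by
  have : Metric.closedBall c r = (fun x => -c + x) ⁻¹' Metric.closedBall 0 r := by
    ext x
    simp [dist_eq_norm, neg_add_eq_sub]
  rw [this, measure_preimage_add]

theorem cast_prime_ne_zero : (p : ℚ_[p]) ≠ 0 := Nat.cast_ne_zero.mpr (Fact.out : p.Prime).ne_zero

theorem cast_prime_pos : (0 : ℝ) < p := Nat.cast_pos.mpr (Fact.out : p.Prime).pos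

theorem one_lt_cast_prime : (1 : ℝ) < p := Nat.one_lt_cast.mpr (Fact.out : p.Prime).one_lt

/-- The ball of radius p^(-k) is the disjoint union of p balls of radius p^(-(k+1)), centred at jp^k
for 0 ≤ j < p. -/
theorem padicVol_closedBall_zpow_succ (k : ℤ) :
    padicVol p (Metric.closedBall 0 ((p : ℝ) ^ (-k))) =
      p * padicVol p (Metric.closedBall 0 ((p : ℝ) ^ (-(k + 1)))) := by
  have hp0 := cast_prime_ne_zero p
  have hpR := cast_prime_pos p
  have hU : Metric.closedBall (0 : ℚ_[p]) ((p : ℝ) ^ (-k)) =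
      ⋃ j ∈ Finset.range p, Metric.closedBall ((j : ℚ_[p]) * (p : ℚ_[p]) ^ k)
        ((p : ℝ) ^ (-(k + 1))) := by
    ext x
    simp only [Set.mem_iUnion, Metric.mem_closedBall, dist_eq_norm, sub_zero, exists_prop,
      Finset.mem_range]
    constructor
    · intro hx
      have hx' : ‖x * (p : ℚ_[p]) ^ (-k)‖ ≤ 1 := by
        rw [norm_mul, Padic.norm_p_zpow, neg_neg]
        calc ‖x‖ * (p : ℝ) ^ k ≤ (p : ℝ) ^ (-k) * (p : ℝ) ^ k := by gcongr
          _ = 1 := by rw [← zpow_add₀ hpR.ne', neg_add_cancel, zpow_zero]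
      obtain ⟨j, hj, hmem⟩ := PadicInt.exists_mem_range (⟨_, hx'⟩ : ℤ_[p])
      refine ⟨j, hj, ?_⟩
      rw [IsLocalRing.mem_maximalIdeal, PadicInt.mem_nonunits,
        PadicInt.norm_lt_one_iff_dvd] at hmem
      obtain ⟨u, hu⟩ := hmem
      have hu' : x * (p : ℚ_[p]) ^ (-k) - j = p * u := by
        have := congrArg (Subtype.val : ℤ_[p] → ℚ_[p]) hu
        exact_mod_cast this
      have e : x - j * (p : ℚ_[p]) ^ k = (p : ℚ_[p]) ^ (k + 1) * u := by
        rw [zpow_add_one₀ hp0, mul_assoc, ← hu', mul_sub, zpow_neg]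
        field_simp
      rw [e, norm_mul, Padic.norm_p_zpow]
      exact mul_le_of_le_one_right (by positivity) (PadicInt.norm_le_one u)
    · rintro ⟨j, hj, hx⟩
      have e : x = (x - j * (p : ℚ_[p]) ^ k) + j * (p : ℚ_[p]) ^ k := by ring
      rw [e]
      refine (IsUltrametricDist.norm_add_le_max _ _).trans (max_le (hx.trans ?_) ?_)
      · exact zpow_le_zpow_right₀ (one_lt_cast_prime p).le (by linarith)
      · rw [norm_mul, Padic.norm_p_zpow]
        exact mul_le_of_le_one_left (by positivity) (by exact_mod_cast Padic.norm_int_le_one j)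
  rw [hU, measure_biUnion_finset]
  · simp only [padicVol_closedBall_eq]
    simp
  · intro i hi j hj hij
    refine Set.disjoint_left.mpr fun x hx hx' => hij ?_
    rw [Metric.mem_closedBall, dist_eq_norm] at hx hx'
    have e : ((i : ℤ) - (j : ℤ) : ℤ) * (p : ℚ_[p]) ^ k =
        (x - j * (p : ℚ_[p]) ^ k) + -(x - i * (p : ℚ_[p]) ^ k) := by push_cast; ring
    have h1 : ‖(((i : ℤ) - (j : ℤ) : ℤ) : ℚ_[p]) * (p : ℚ_[p]) ^ k‖ ≤ (p : ℝ) ^ (-(k + 1)) := by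
      rw [e]
      exact (IsUltrametricDist.norm_add_le_max _ _).trans (max_le hx' (by rwa [norm_neg]))
    rw [norm_mul, Padic.norm_p_zpow, neg_add, zpow_add₀ hpR.ne', mul_comm,
      mul_le_mul_iff_right₀ (by positivity)] at h1
    have h2 : ‖(((i : ℤ) - (j : ℤ) : ℤ) : ℚ_[p])‖ < 1 :=
      h1.trans_lt (zpow_lt_one_of_neg₀ (one_lt_cast_prime p) (by norm_num))
    rw [Padic.norm_intCast_lt_one_iff] at h2
    have hi' := Finset.mem_range.mp hi
    have hj' := Finset.mem_range.mp hj
    have h3 := Int.eq_zero_of_abs_lt_dvd h2 (by rw [abs_lt]; constructor <;> linarith)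
    omega
  · exact fun _ _ => measurableSet_closedBall

theorem padicVol_closedBall (c : ℚ_[p]) (k : ℤ) :
    padicVol p (Metric.closedBall c ((p : ℝ) ^ (-k))) = ENNReal.ofReal ((p : ℝ) ^ (-k)) := by
  have hpR := cast_prime_pos p
  rw [padicVol_closedBall_eq]
  have hpE : (p : ℝ≥0∞) = ENNReal.ofReal p := (ENNReal.ofReal_natCast p).symm
  have hp0 : ENNReal.ofReal (p : ℝ) ≠ 0 := (ENNReal.ofReal_pos.mpr hpR).ne'
  induction k using Int.induction_on with
  | zero => simpa using padicVol_closedBall_zero_one p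
  | succ k ih =>
    have h := padicVol_closedBall_zpow_succ p k
    rw [ih, hpE] at h
    have h2 : ENNReal.ofReal ((p : ℝ) ^ (-(k : ℤ))) =
        ENNReal.ofReal p * ENNReal.ofReal ((p : ℝ) ^ (-((k : ℤ) + 1))) := by
      rw [← ENNReal.ofReal_mul hpR.le, neg_add, zpow_add₀ hpR.ne', zpow_neg_one]
      congr 1
      field_simp
    rw [h2] at h
    exact ((ENNReal.mul_right_inj hp0 ENNReal.ofReal_ne_top).mp h).symm
  | pred k ih =>
    have h := padicVol_closedBall_zpow_succ p (-(k : ℤ) - 1)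
    rw [sub_add_cancel, ih, hpE, ← ENNReal.ofReal_mul hpR.le] at h
    rw [h]
    congr 1
    rw [← zpow_one_add₀ hpR.ne']
    congr 1
    ring

/-- An additive automorphism preserving a set of finite positive volume preserves the volume. -/
theorem measurePreserving_of_preimage_eq {E : Type*} [AddCommGroup E] [TopologicalSpace E]
    [IsTopologicalAddGroup E] [MeasurableSpace E] [BorelSpace E] [LocallyCompactSpace E]
    [SecondCountableTopology E] (μ : Measure E) [μ.IsAddHaarMeasure] (e : E ≃ₜ+ E) {B : Set E}
    (hB : MeasurableSet B) (h0 : μ B ≠ 0) (h1 : μ B ≠ ∞) (he : e ⁻¹' B = B) :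
    MeasurePreserving e μ μ := by
  have hm : Measurable e := e.continuous.measurable
  refine ⟨hm, ?_⟩
  have : (μ.map e).IsAddHaarMeasure := e.isAddHaarMeasure_map μ
  have h := Measure.isAddLeftInvariant_eq_smul (μ.map e) μ
  have h2 := congrArg (fun m : Measure E => m B) h
  simp only [Measure.map_apply hm hB, he, Measure.smul_apply] at h2
  have h3 : ((μ.map e).addHaarScalarFactor μ : ℝ≥0∞) = 1 := by
    rw [ENNReal.smul_def, smul_eq_mul] at h2
    refine ((ENNReal.mul_left_inj h0 h1).mp ?_)
    rw [one_mul]; exact h2.symm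
  rw [h]
  have h4 : (μ.map e).addHaarScalarFactor μ = 1 := by exact_mod_cast h3
  rw [h4, one_smul]

end PadicVolume

/-! ### Coordinates on the torus and the group law of R. -/

section TorusParam

variable {F : Type*} [Field F]

/-- The element `x + y ω` of the torus of the form `[[α, β], [β, γ]]`, where `w = (x, y)` and
`ω = [[β, γ], [-α, -β]]`. -/
def torMat (α β γ : F) (w : F × F) : Matrix (Fin 2) (Fin 2) F :=
  !![w.1 + w.2 * β, w.2 * γ; -(w.2 * α), w.1 - w.2 * β]

/-- The determinant of `x + y ω`. -/
def torNorm (α β γ : F) (w : F × F) : F := w.1 ^ 2 + w.2 ^ 2 * (α * γ - β ^ 2)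

/-- The multiplication of the algebra `F[ω]` in coordinates. -/
def torMul (α β γ : F) (s w : F × F) : F × F :=
  (s.1 * w.1 - (α * γ - β ^ 2) * (s.2 * w.2), s.1 * w.2 + s.2 * w.1)

/-- The conjugation `x + y ω ↦ x - y ω` in coordinates. -/
def torConj (w : F × F) : F × F := (w.1, -w.2)

/-- The action `X ↦ det(A)⁻¹ A X Aᵀ` of the torus element `A` on symmetric matrices
`X = [[n, q], [q, r]]`. -/
def symAct (α β γ : F) (w : F × F) (X : F × F × F) : F × F × F :=
  let a := w.1 + w.2 * β
  let b := w.2 * γ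
  let c := -(w.2 * α)
  let d := w.1 - w.2 * β
  ((torNorm α β γ w)⁻¹ * (a ^ 2 * X.1 + 2 * a * b * X.2.1 + b ^ 2 * X.2.2),
    (torNorm α β γ w)⁻¹ * (a * c * X.1 + (a * d + b * c) * X.2.1 + b * d * X.2.2),
    (torNorm α β γ w)⁻¹ * (c ^ 2 * X.1 + 2 * c * d * X.2.1 + d ^ 2 * X.2.2))

variable {α β γ : F}

theorem det_torMat (w : F × F) : (torMat α β γ w).det = torNorm α β γ w := by
  rw [Matrix.det_fin_two]
  simp [torMat, torNorm]
  ring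

theorem torMat_torMul (s w : F × F) :
    torMat α β γ (torMul α β γ s w) = torMat α β γ s * torMat α β γ w := by
  ext i j
  fin_cases i <;> fin_cases j <;> simp [torMat, torMul, Matrix.mul_apply] <;> ring

theorem torNorm_torMul (s w : F × F) :
    torNorm α β γ (torMul α β γ s w) = torNorm α β γ s * torNorm α β γ w := by
  rw [← det_torMat, torMat_torMul, Matrix.det_mul, det_torMat, det_torMat]

theorem torNorm_torConj (w : F × F) : torNorm α β γ (torConj w) = torNorm α β γ w := by
  simp [torNorm, torConj]

theorem torMul_comm (s w : F × F) : torMul α β γ s w = torMul α β γ w s := by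
  ext <;> simp [torMul] <;> ring

theorem torMul_torConj_torMul (s w : F × F) :
    torMul α β γ (torConj s) (torMul α β γ s w) = torNorm α β γ s • w := by
  ext <;> simp [torMul, torConj, torNorm] <;> ring

theorem torConj_torConj (w : F × F) : torConj (torConj w) = w := by simp [torConj]

theorem symAct_add (w : F × F) (X Y : F × F × F) :
    symAct α β γ w (X + Y) = symAct α β γ w X + symAct α β γ w Y := by
  ext <;> simp [symAct] <;> ring

theorem symAct_torConj_symAct {w : F × F} (hw : torNorm α β γ w ≠ 0) (X : F × F × F) :
    symAct α β γ (torConj w) (symAct α β γ w X) = X := by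
  have h : torNorm α β γ w * (torNorm α β γ w)⁻¹ = 1 := mul_inv_cancel₀ hw
  simp only [symAct, torNorm_torConj]
  generalize hN : (torNorm α β γ w)⁻¹ = e at h
  rw [torNorm] at h
  obtain ⟨n, q, r⟩ := X
  obtain ⟨x, y⟩ := w
  simp only [torConj] at h ⊢
  have h2 : (x ^ 2 + y ^ 2 * (α * γ - β ^ 2)) ^ 2 * e ^ 2 = 1 := by
    rw [← mul_pow, h, one_pow]
  ext <;> dsimp only
  · linear_combination n * h2
  · linear_combination q * h2
  · linear_combination r * h2

open Classical in
/-- The image in `GSp(4)` of the torus element `x + y ω` (and `1` if that is not invertible). -/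
noncomputable def torElt (α β γ : F) (w : F × F) : GSp4 F :=
  if h : torNorm α β γ w ≠ 0 then
    leviEmb (Matrix.GeneralLinearGroup.mkOfDetNeZero (torMat α β γ w) (by rwa [det_torMat]))
  else 1

theorem mat4_torElt {w : F × F} (hw : torNorm α β γ w ≠ 0) :
    mat4 (torElt α β γ w) = leviMat (torMat α β γ w) := by
  rw [torElt, dif_pos hw]
  rfl

theorem mat4_elU (n q r : F) :
    mat4 (elU n q r) = !![1, 0, n, q; 0, 1, q, r; 0, 0, 1, 0; 0, 0, 0, 1] := rfl

theorem simil_torElt {w : F × F} (hw : torNorm α β γ w ≠ 0) :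
    simil (torElt α β γ w) = torNorm α β γ w := by
  refine simil_of ?_
  rw [mat4_torElt hw, leviMat_similitude, det_torMat]

theorem simil_elU (n q r : F) : simil (elU n q r) = 1 := simil_ofMatrix _ _ _ _

theorem torElt_mul_torElt {s w : F × F} (hs : torNorm α β γ s ≠ 0) (hw : torNorm α β γ w ≠ 0) :
    torElt α β γ s * torElt α β γ w = torElt α β γ (torMul α β γ s w) := by
  refine GSp4.ext_matrix ?_
  change mat4 (torElt α β γ s) * mat4 (torElt α β γ w) = mat4 _
  rw [mat4_torElt hs, mat4_torElt hw, mat4_torElt (by rw [torNorm_torMul]; exact mul_ne_zero hs hw),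
    torMat_torMul, leviMat_mul]

/-- The torus acts on U by X ↦ det(A)⁻¹AXAᵀ; moving A to the left past U_X applies the inverse
action, which is that of the conjugate. -/
theorem elU_mul_torElt {w : F × F} (hw : torNorm α β γ w ≠ 0) (X : F × F × F) :
    elU X.1 X.2.1 X.2.2 * torElt α β γ w = torElt α β γ w *
      elU (symAct α β γ (torConj w) X).1 (symAct α β γ (torConj w) X).2.1
        (symAct α β γ (torConj w) X).2.2 := by
  refine GSp4.ext_matrix ?_
  change mat4 (elU _ _ _) * mat4 (torElt α β γ w) = mat4 (torElt α β γ w) * mat4 (elU _ _ _)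
  rw [mat4_torElt hw, mat4_elU, mat4_elU]
  have h : torNorm α β γ w * (torNorm α β γ w)⁻¹ = 1 := mul_inv_cancel₀ hw
  simp only [symAct, torNorm_torConj]
  generalize hN : (torNorm α β γ w)⁻¹ = e at h
  rw [torNorm] at h
  obtain ⟨n, q, r⟩ := X
  obtain ⟨x, y⟩ := w
  simp only [torConj, torMat, leviMat] at h ⊢
  ext i j
  fin_cases i <;> fin_cases j <;> simp [Matrix.mul_apply, Fin.sum_univ_four]
  · linear_combination (-(n * (x - y * β) - q * (y * γ))) * h
  · linear_combination (-(n * (y * α) + q * (x + y * β))) * h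
  · linear_combination (-(q * (x - y * β) - r * (y * γ))) * h
  · linear_combination (-(q * (y * α) + r * (x + y * β))) * h

/-- The element `(x + y ω) U_{(n,q,r)}` of the Bessel subgroup. -/
noncomputable def besselElt (α β γ : F) (v : (F × F) × (F × F × F)) : GSp4 F :=
  torElt α β γ v.1 * elU v.2.1 v.2.2.1 v.2.2.2

theorem besselElt_mul_besselElt {v v' : (F × F) × (F × F × F)} (hv : torNorm α β γ v.1 ≠ 0)
    (hv' : torNorm α β γ v'.1 ≠ 0) :
    besselElt α β γ v * besselElt α β γ v' = besselElt α β γ (torMul α β γ v.1 v'.1,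
      symAct α β γ (torConj v'.1) v.2 + v'.2) := by
  unfold besselElt
  rw [mul_assoc, ← mul_assoc (elU _ _ _), elU_mul_torElt hv' v.2, mul_assoc, ← mul_assoc,
    torElt_mul_torElt hv hv', elU_mul_elU]
  rfl

theorem torMat_mem_torus {w : F × F} (h : (torMat α β γ w).det ≠ 0) :
    Matrix.GeneralLinearGroup.mkOfDetNeZero (torMat α β γ w) h ∈ torus !![α, β; β, γ] := by
  change (torMat α β γ w)ᵀ * !![α, β; β, γ] * torMat α β γ w = (torMat α β γ w).det • _
  rw [det_torMat]
  ext i j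
  fin_cases i <;> fin_cases j <;>
    simp [torMat, torNorm, Matrix.mul_apply] <;> ring

theorem besselElt_mem (v : (F × F) × (F × F × F)) :
    besselElt α β γ v ∈ besselR !![α, β; β, γ] := by
  by_cases h : torNorm α β γ v.1 ≠ 0
  · refine ⟨_, torMat_mem_torus (by rwa [det_torMat]), v.2.1, v.2.2.1, v.2.2.2, ?_⟩
    rw [besselElt, torElt, dif_pos h]
  · refine ⟨1, one_mem _, v.2.1, v.2.2.1, v.2.2.2, ?_⟩
    rw [besselElt, torElt, dif_neg h, map_one]

/-- Multiplying by the transposed adjugate linearizes the quadratic condition to Sg = adj(g)ᵀS.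
Since γ and 2 are invertible, this system can be solved with x half the trace of g and y = g₀₁/γ. -/
theorem exists_torMat_eq_of_mem_torus [NeZero (2 : F)] (hγ : γ ≠ 0) {g : GL (Fin 2) F}
    (hg : g ∈ torus !![α, β; β, γ]) : ∃ w : F × F, g.1 = torMat α β γ w := by
  have h2 : (2 : F) ≠ 0 := two_ne_zero
  have hg' : g.1ᵀ * !![α, β; β, γ] * g.1 = g.1.det • !![α, β; β, γ] := hg
  have hd := Matrix.GeneralLinearGroup.det_ne_zero g
  have hadj : !![α, β; β, γ] * g.1 = g.1.adjugateᵀ * !![α, β; β, γ] := by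
    have e : g.1.adjugateᵀ * (g.1ᵀ * !![α, β; β, γ] * g.1) =
        g.1.det • (!![α, β; β, γ] * g.1) := by
      rw [← Matrix.mul_assoc, ← Matrix.mul_assoc, ← Matrix.transpose_mul, Matrix.mul_adjugate,
        Matrix.transpose_smul, Matrix.transpose_one, Matrix.smul_mul, Matrix.smul_mul,
        Matrix.one_mul]
    rw [hg', Matrix.mul_smul] at e
    exact (smul_right_injective _ hd e).symm
  rw [Matrix.adjugate_fin_two] at hadj
  have e01 := congrFun (congrFun hadj 0) 1
  have e11 := congrFun (congrFun hadj 1) 1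
  simp [Matrix.mul_apply] at e01 e11
  refine ⟨((g.1 0 0 + g.1 1 1) / 2, g.1 0 1 / γ), ?_⟩
  ext i j
  fin_cases i <;> fin_cases j <;> simp [torMat] <;> field_simp
  · linear_combination (-1 : F) * e11
  · linear_combination e01
  · linear_combination e11

end TorusParam

/-! ### Haar measure on T(ℤ_p)U(ℚ_p). -/

section BesselMeasure

variable {p : ℕ} [Fact p.Prime]

/-- The binary quadratic form `[[α, β], [β, γ]]` over `ℤ_p` is anisotropic modulo `p`. -/
structure IsInertForm (α β γ : ℚ_[p]) : Prop where
  norm_left : ‖α‖ = 1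
  norm_mid : ‖β‖ ≤ 1
  norm_right : ‖γ‖ = 1
  norm_torNorm : ∀ w : ℚ_[p] × ℚ_[p], ‖torNorm α β γ w‖ = ‖w‖ ^ 2

/-- The coordinates of the integral elements of the torus. -/
def unitTorus (p : ℕ) [Fact p.Prime] : Set (ℚ_[p] × ℚ_[p]) := {w | ‖w‖ = 1}

theorem measurableSet_unitTorus : MeasurableSet (unitTorus p) :=
  measurableSet_eq_fun measurable_norm measurable_const

/-- The product Haar measure on the coordinates of symmetric matrices. -/
noncomputable def symVol (p : ℕ) [Fact p.Prime] : Measure (ℚ_[p] × ℚ_[p] × ℚ_[p]) :=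
  (padicVol p).prod ((padicVol p).prod (padicVol p))

/-- The measure on the coordinates of the integral elements of the torus. -/
noncomputable def unitTorusVol (p : ℕ) [Fact p.Prime] : Measure (ℚ_[p] × ℚ_[p]) :=
  ((padicVol p).prod (padicVol p)).restrict (unitTorus p)

instance : (symVol p).IsAddHaarMeasure := by
  unfold symVol
  have : ((padicVol p).prod (padicVol p)).IsAddHaarMeasure :=
    Measure.prod.instIsAddHaarMeasure _ _
  exact Measure.prod.instIsAddHaarMeasure _ _

instance : SFinite (unitTorusVol p) := by unfold unitTorusVol; infer_instance

/-- The Haar measure on `T(ℤ_p) U(ℚ_p)`, as a measure on `GSp(4)`. -/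
noncomputable def besselVol₀ (α β γ : ℚ_[p]) : Measure (GSp4 ℚ_[p]) :=
  ((unitTorusVol p).prod (symVol p)).map (besselElt α β γ)

/-- The scalar element `p^k` of the torus. -/
noncomputable def scalarElt (α β γ : ℚ_[p]) (k : ℤ) : GSp4 ℚ_[p] :=
  torElt α β γ ((p : ℚ_[p]) ^ k, 0)

/-- The Haar measure on the Bessel subgroup, as a measure on `GSp(4)`. -/
noncomputable def besselVol (α β γ : ℚ_[p]) : Measure (GSp4 ℚ_[p]) :=
  Measure.sum fun k : ℤ => (besselVol₀ α β γ).map (scalarElt α β γ k * ·)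

/-- The topology on units also asks for continuity of the inverse, which is automatic from the
formula for g⁻¹. -/
theorem continuous_of_mat4 {Y : Type*} [TopologicalSpace Y] {f : Y → GSp4 ℚ_[p]}
    (h : Continuous fun y => mat4 (f y)) : Continuous f := by
  refine Topology.IsInducing.subtypeVal.continuous_iff.mpr (Units.continuous_iff.mpr ⟨h, ?_⟩)
  have he : ∀ i j, Continuous fun y => mat4 (f y) i j := fun i j => h.matrix_elem i j
  have hs : Continuous fun y => (simil (f y))⁻¹ := by
    have h1 : Continuous fun y => simil (f y) :=
      ((h.matrix_transpose.matrix_mul continuous_const).matrix_mul h).matrix_elem 0 2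
    exact h1.inv₀ fun y => simil_ne_zero _
  change Continuous fun y => mat4 (f y)⁻¹
  simp only [mat4_inv]
  refine hs.smul (continuous_matrix fun i j => ?_)
  fin_cases i <;> fin_cases j <;> first | exact he _ _ | exact (he _ _).neg

theorem measurable_torElt (α β γ : ℚ_[p]) : Measurable (torElt α β γ) := by
  have hc : Continuous (torNorm α β γ) := by unfold torNorm; fun_prop
  have ho : MeasurableSet {w | torNorm α β γ w ≠ 0} :=
    (isOpen_ne_fun hc continuous_const).measurableSet
  refine measurable_of_restrict_of_restrict_compl ho ?_ ?_
  · refine Continuous.measurable (continuous_of_mat4 ?_)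
    have : (fun y : {w | torNorm α β γ w ≠ 0} => mat4 (torElt α β γ y.1)) =
        fun y => leviMat (torMat α β γ y.1) := by
      funext y
      exact mat4_torElt y.2
    change Continuous fun y : {w | torNorm α β γ w ≠ 0} => mat4 (torElt α β γ y.1)
    rw [this]
    refine continuous_matrix fun i j => ?_
    fin_cases i <;> fin_cases j <;> simp [leviMat, torMat] <;> fun_prop
  · have : Set.domRestrict {w | torNorm α β γ w ≠ 0}ᶜ (torElt α β γ) = fun _ => 1 := by
      funext y
      rw [Set.domRestrict_apply, torElt]
      exact dif_neg y.2
    rw [this]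
    exact measurable_const

theorem continuous_elU :
    Continuous (fun X : ℚ_[p] × ℚ_[p] × ℚ_[p] => elU X.1 X.2.1 X.2.2) := by
  refine continuous_of_mat4 (continuous_matrix fun i j => ?_)
  simp only [mat4_elU]
  fin_cases i <;> fin_cases j <;> simp <;> fun_prop

theorem measurable_besselElt (α β γ : ℚ_[p]) : Measurable (besselElt α β γ) :=
  ((measurable_torElt α β γ).comp measurable_fst).mul
    (continuous_elU.measurable.comp measurable_snd)

variable {α β γ : ℚ_[p]}

theorem measurable_symAct_torConj (X : ℚ_[p] × ℚ_[p] × ℚ_[p]) :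
    Measurable fun w => symAct α β γ (torConj w) X := by
  unfold symAct torConj torNorm
  fun_prop

theorem IsInertForm.torNorm_ne_zero (h : IsInertForm α β γ) {w : ℚ_[p] × ℚ_[p]} (hw : w ≠ 0) :
    torNorm α β γ w ≠ 0 := by
  rw [← norm_ne_zero_iff, h.norm_torNorm]
  exact pow_ne_zero _ (norm_ne_zero_iff.mpr hw)

theorem ne_zero_of_mem_unitTorus {w : ℚ_[p] × ℚ_[p]} (hw : w ∈ unitTorus p) : w ≠ 0 := by
  rintro rfl
  have : ‖(0 : ℚ_[p] × ℚ_[p])‖ = 1 := hw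
  simp at this

/-- The square of the sup norm is the absolute value of the multiplicative norm form. -/
theorem IsInertForm.norm_torMul (h : IsInertForm α β γ) (s w : ℚ_[p] × ℚ_[p]) :
    ‖torMul α β γ s w‖ = ‖s‖ * ‖w‖ := by
  have h1 := h.norm_torNorm (torMul α β γ s w)
  rw [torNorm_torMul, norm_mul, h.norm_torNorm, h.norm_torNorm, ← mul_pow] at h1
  exact ((sq_eq_sq₀ (by positivity) (by positivity)).mp h1).symm

theorem norm_torConj (w : ℚ_[p] × ℚ_[p]) : ‖torConj w‖ = ‖w‖ := by
  simp [torConj, Prod.norm_def]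

theorem IsInertForm.norm_symAct_le (h : IsInertForm α β γ) {w : ℚ_[p] × ℚ_[p]}
    (hw : w ∈ unitTorus p) {X : ℚ_[p] × ℚ_[p] × ℚ_[p]} {r : ℝ} (hX : ‖X‖ ≤ r) :
    ‖symAct α β γ w X‖ ≤ r := by
  have hw' : ‖w‖ ≤ 1 := le_of_eq hw
  rw [Prod.norm_def, max_le_iff] at hw'
  obtain ⟨h1, h2⟩ := hw'
  have hN : ‖torNorm α β γ w‖ = 1 := by
    rw [h.norm_torNorm, show ‖w‖ = 1 from hw, one_pow]
  have ha : ‖w.1 + w.2 * β‖ ≤ 1 := (IsUltrametricDist.norm_add_le_max _ _).trans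
    (max_le h1 (norm_mul_le_one' p h2 h.norm_mid))
  have hb : ‖w.2 * γ‖ ≤ 1 := norm_mul_le_one' p h2 h.norm_right.le
  have hc : ‖-(w.2 * α)‖ ≤ 1 := by
    rw [norm_neg]; exact norm_mul_le_one' p h2 h.norm_left.le
  have hd : ‖w.1 - w.2 * β‖ ≤ 1 := by
    rw [sub_eq_add_neg]
    exact (IsUltrametricDist.norm_add_le_max _ _).trans
      (max_le h1 (by rw [norm_neg]; exact norm_mul_le_one' p h2 h.norm_mid))
  have h2' : ‖(2 : ℚ_[p])‖ ≤ 1 := by exact_mod_cast Padic.norm_int_le_one 2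
  obtain ⟨n, q, t⟩ := X
  simp only [Prod.norm_def, max_le_iff] at hX
  obtain ⟨hn, hq, ht⟩ := hX
  have key : ∀ {a b c x y z : ℚ_[p]}, ‖a‖ ≤ 1 → ‖b‖ ≤ 1 → ‖c‖ ≤ 1 → ‖x‖ ≤ r → ‖y‖ ≤ r → ‖z‖ ≤ r →
      ‖(torNorm α β γ w)⁻¹ * (a * x + b * y + c * z)‖ ≤ r := by
    intro a b c x y z ha hb hc hx hy hz
    rw [norm_mul, norm_inv, hN, inv_one, one_mul]
    have m : ∀ {a x : ℚ_[p]}, ‖a‖ ≤ 1 → ‖x‖ ≤ r → ‖a * x‖ ≤ r := by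
      intro a x ha hx
      rw [norm_mul]
      exact (mul_le_of_le_one_left (norm_nonneg _) ha).trans hx
    exact (IsUltrametricDist.norm_add_le_max _ _).trans (max_le
      ((IsUltrametricDist.norm_add_le_max _ _).trans (max_le (m ha hx) (m hb hy))) (m hc hz))
  simp only [symAct, Prod.norm_def, max_le_iff]
  have sq : ∀ {a : ℚ_[p]}, ‖a‖ ≤ 1 → ‖a ^ 2‖ ≤ 1 := fun ha => by
    rw [norm_pow]; exact pow_le_one₀ (norm_nonneg _) ha
  refine ⟨key (sq ha) (norm_mul_le_one' p (norm_mul_le_one' p h2' ha) hb) (sq hb) hn hq ht,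
    key (norm_mul_le_one' p ha hc) ((IsUltrametricDist.norm_add_le_max _ _).trans (max_le
      (norm_mul_le_one' p ha hd) (norm_mul_le_one' p hb hc))) (norm_mul_le_one' p hb hd) hn hq ht,
    key (sq hc) (norm_mul_le_one' p (norm_mul_le_one' p h2' hc) hd) (sq hd) hn hq ht⟩

theorem torConj_mem_unitTorus {w : ℚ_[p] × ℚ_[p]} (hw : w ∈ unitTorus p) :
    torConj w ∈ unitTorus p := (norm_torConj w).trans hw

/-- The action of an integral torus element on symmetric matrices. -/
noncomputable def symActEquiv (h : IsInertForm α β γ) {w : ℚ_[p] × ℚ_[p]} (hw : w ∈ unitTorus p) :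
    (ℚ_[p] × ℚ_[p] × ℚ_[p]) ≃ₜ+ (ℚ_[p] × ℚ_[p] × ℚ_[p]) where
  toFun := symAct α β γ w
  invFun := symAct α β γ (torConj w)
  left_inv X := symAct_torConj_symAct (h.torNorm_ne_zero (ne_zero_of_mem_unitTorus hw)) X
  right_inv X := by
    have := symAct_torConj_symAct (h.torNorm_ne_zero (ne_zero_of_mem_unitTorus
      (torConj_mem_unitTorus hw))) X
    rwa [torConj_torConj] at this
  map_add' := symAct_add w
  continuous_toFun := by unfold symAct; fun_prop
  continuous_invFun := by unfold symAct; fun_prop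

theorem measurePreserving_symAct (h : IsInertForm α β γ) {w : ℚ_[p] × ℚ_[p]}
    (hw : w ∈ unitTorus p) : MeasurePreserving (symAct α β γ w) (symVol p) (symVol p) := by
  refine measurePreserving_of_preimage_eq (symVol p) (symActEquiv h hw)
    (B := Metric.closedBall 0 1) measurableSet_closedBall
    (Metric.measure_closedBall_pos _ _ one_pos).ne' (isCompact_closedBall _ _).measure_lt_top.ne ?_
  ext X
  simp only [Set.mem_preimage, mem_closedBall_zero_iff]
  refine ⟨fun hX => ?_, fun hX => h.norm_symAct_le hw hX⟩
  have := h.norm_symAct_le (torConj_mem_unitTorus hw) hX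
  rwa [show symAct α β γ (torConj w) (symActEquiv h hw X) = X from
    (symActEquiv h hw).symm_apply_apply X] at this

/-- The multiplication by an integral torus element. -/
noncomputable def torMulEquiv (h : IsInertForm α β γ) {s : ℚ_[p] × ℚ_[p]} (hs : s ∈ unitTorus p) :
    (ℚ_[p] × ℚ_[p]) ≃ₜ+ (ℚ_[p] × ℚ_[p]) where
  toFun := torMul α β γ s
  invFun w := (torNorm α β γ s)⁻¹ • torMul α β γ (torConj s) w
  left_inv w := by
    have h0 := h.torNorm_ne_zero (ne_zero_of_mem_unitTorus hs)
    dsimp only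
    rw [torMul_torConj_torMul, smul_smul, inv_mul_cancel₀ h0, one_smul]
  right_inv w := by
    have h0 := h.torNorm_ne_zero (ne_zero_of_mem_unitTorus hs)
    have e := torMul_torConj_torMul (α := α) (β := β) (γ := γ) (torConj s) w
    rw [torConj_torConj, torNorm_torConj] at e
    have e2 : ∀ (c : ℚ_[p]) (v : ℚ_[p] × ℚ_[p]),
        torMul α β γ s (c • v) = c • torMul α β γ s v := by
      intro c v
      ext <;> simp [torMul] <;> ring
    dsimp only
    rw [e2, e, smul_smul, inv_mul_cancel₀ h0, one_smul]
  map_add' v w := by ext <;> simp [torMul] <;> ring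
  continuous_toFun := by unfold torMul; fun_prop
  continuous_invFun := by unfold torMul; fun_prop

/-- Multiplication by a unit-norm element is an additive automorphism that preserves the sup norm,
hence the unit ball and the unit sphere. So additive Haar measure on the sphere is also
multiplicatively invariant. -/
theorem measurePreserving_torMul (h : IsInertForm α β γ) {s : ℚ_[p] × ℚ_[p]}
    (hs : s ∈ unitTorus p) :
    MeasurePreserving (torMul α β γ s) (unitTorusVol p) (unitTorusVol p) := by
  have hn : ∀ w, ‖torMul α β γ s w‖ = ‖w‖ := fun w => by
    rw [h.norm_torMul, show ‖s‖ = 1 from hs, one_mul]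
  have h1 := measurePreserving_of_preimage_eq ((padicVol p).prod (padicVol p)) (torMulEquiv h hs)
    (B := Metric.closedBall 0 1) measurableSet_closedBall
    (Metric.measure_closedBall_pos _ _ one_pos).ne' (isCompact_closedBall _ _).measure_lt_top.ne
    (by
      ext w
      simp only [Set.mem_preimage, mem_closedBall_zero_iff]
      rw [show ‖torMulEquiv h hs w‖ = ‖w‖ from hn w])
  have h2 := h1.restrict_preimage measurableSet_unitTorus
  have h3 : torMulEquiv h hs ⁻¹' unitTorus p = unitTorus p := by
    ext w
    change ‖torMul α β γ s w‖ = 1 ↔ ‖w‖ = 1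
    rw [hn]
  rw [h3] at h2
  exact h2

theorem ae_unitTorus : ∀ᵐ v ∂(unitTorusVol p).prod (symVol p), v.1 ∈ unitTorus p := by
  have h : ∀ᵐ w ∂unitTorusVol p, w ∈ unitTorus p := ae_restrict_mem measurableSet_unitTorus
  exact Measure.quasiMeasurePreserving_fst.ae h

/-- In coordinates, left multiplication is a skew product: multiplication on the sphere and, over
each w, a translation of the symmetric matrices. -/
theorem map_mul_left_besselVol₀ (h : IsInertForm α β γ)
    {v : (ℚ_[p] × ℚ_[p]) × (ℚ_[p] × ℚ_[p] × ℚ_[p])}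
    (hv : v.1 ∈ unitTorus p) :
    (besselVol₀ α β γ).map (besselElt α β γ v * ·) = besselVol₀ α β γ := by
  have hsk := (measurePreserving_torMul h hv).skew_product (μc := symVol p) (μd := symVol p)
    (g := fun w X => symAct α β γ (torConj w) v.2 + X)
    (by
      have := measurable_symAct_torConj (α := α) (β := β) (γ := γ) v.2
      exact (this.comp measurable_fst).add measurable_snd)
    (Filter.Eventually.of_forall fun w => map_add_left_eq_self _ _)
  have hm := measurable_besselElt α β γ
  unfold besselVol₀
  rw [Measure.map_map (measurable_const_mul _) hm]
  conv_rhs => rw [← hsk.map_eq]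
  rw [Measure.map_map hm hsk.measurable]
  refine Measure.map_congr ?_
  filter_upwards [ae_unitTorus] with v' hv'
  exact besselElt_mul_besselElt (h.torNorm_ne_zero (ne_zero_of_mem_unitTorus hv))
    (h.torNorm_ne_zero (ne_zero_of_mem_unitTorus hv'))

/-- Right multiplication is the product of a multiplication on the sphere and an affine map of the
symmetric matrices whose linear part preserves the integral ones. -/
theorem map_mul_right_besselVol₀ (h : IsInertForm α β γ)
    {v : (ℚ_[p] × ℚ_[p]) × (ℚ_[p] × ℚ_[p] × ℚ_[p])}
    (hv : v.1 ∈ unitTorus p) :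
    (besselVol₀ α β γ).map (· * besselElt α β γ v) = besselVol₀ α β γ := by
  have hsa := measurePreserving_symAct h (torConj_mem_unitTorus hv)
  have hsk := (measurePreserving_torMul h hv).skew_product (μc := symVol p) (μd := symVol p)
    (g := fun _ X => symAct α β γ (torConj v.1) X + v.2)
    ((hsa.measurable.comp measurable_snd).add_const _)
    (Filter.Eventually.of_forall fun w =>
      ((measurePreserving_add_right (symVol p) v.2).comp hsa).map_eq)
  have hm := measurable_besselElt α β γ
  unfold besselVol₀
  rw [Measure.map_map (measurable_mul_const _) hm]
  conv_rhs => rw [← hsk.map_eq]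
  rw [Measure.map_map hm hsk.measurable]
  refine Measure.map_congr ?_
  filter_upwards [ae_unitTorus] with v' hv'
  refine (besselElt_mul_besselElt (h.torNorm_ne_zero (ne_zero_of_mem_unitTorus hv'))
    (h.torNorm_ne_zero (ne_zero_of_mem_unitTorus hv))).trans ?_
  rw [torMul_comm]
  rfl

end BesselMeasure

/-! ### Haar measure on R: invariance, support, finiteness and positivity. -/

section BesselInvariance

variable {p : ℕ} [Fact p.Prime]

variable {α β γ : ℚ_[p]}

theorem torNorm_scalar (k : ℤ) : torNorm α β γ ((p : ℚ_[p]) ^ k, 0) = (p : ℚ_[p]) ^ (2 * k) := by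
  simp [torNorm, mul_comm 2 k, zpow_mul]

theorem torNorm_scalar_ne_zero (k : ℤ) : torNorm α β γ ((p : ℚ_[p]) ^ k, 0) ≠ 0 := by
  rw [torNorm_scalar]
  exact zpow_ne_zero _ (cast_prime_ne_zero p)

theorem mat4_scalarElt (k : ℤ) : mat4 (scalarElt α β γ k) = (p : ℚ_[p]) ^ k • 1 := by
  rw [scalarElt, mat4_torElt (torNorm_scalar_ne_zero k)]
  ext i j
  fin_cases i <;> fin_cases j <;> simp [leviMat, torMat]

theorem scalarElt_mul_comm (k : ℤ) (g : GSp4 ℚ_[p]) :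
    scalarElt α β γ k * g = g * scalarElt α β γ k := by
  refine GSp4.ext_matrix ?_
  change mat4 (scalarElt α β γ k) * mat4 g = mat4 g * mat4 (scalarElt α β γ k)
  rw [mat4_scalarElt, Matrix.smul_mul, Matrix.mul_smul, Matrix.one_mul, Matrix.mul_one]

theorem scalarElt_mul_scalarElt (k j : ℤ) :
    scalarElt α β γ k * scalarElt α β γ j = scalarElt α β γ (j + k) := by
  refine GSp4.ext_matrix ?_
  change mat4 (scalarElt α β γ k) * mat4 (scalarElt α β γ j) = mat4 (scalarElt α β γ (j + k))
  rw [mat4_scalarElt, mat4_scalarElt, mat4_scalarElt, Matrix.smul_mul, Matrix.one_mul, smul_smul,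
    ← zpow_add₀ (cast_prime_ne_zero p), add_comm]

theorem scalarElt_zero : scalarElt α β γ 0 = 1 := by
  refine GSp4.ext_matrix ?_
  change mat4 (scalarElt α β γ 0) = 1
  rw [mat4_scalarElt, zpow_zero, one_smul]

theorem simil_scalarElt (k : ℤ) : simil (scalarElt α β γ k) = (p : ℚ_[p]) ^ (2 * k) := by
  rw [scalarElt, simil_torElt (torNorm_scalar_ne_zero k), torNorm_scalar]

theorem scalarElt_mem (k : ℤ) : scalarElt α β γ k ∈ besselR !![α, β; β, γ] := by
  have := besselElt_mem (α := α) (β := β) (γ := γ) (((p : ℚ_[p]) ^ k, 0), (0, 0, 0))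
  rwa [besselElt, elU_zero, mul_one] at this

theorem exists_besselElt_eq (h : IsInertForm α β γ) {r : GSp4 ℚ_[p]}
    (hr : r ∈ besselR !![α, β; β, γ]) : ∃ v, torNorm α β γ v.1 ≠ 0 ∧ r = besselElt α β γ v := by
  obtain ⟨t, ht, n, q, s, rfl⟩ := hr
  have hγ : γ ≠ 0 := norm_ne_zero_iff.mp (by rw [h.norm_right]; exact one_ne_zero)
  obtain ⟨w, hw⟩ := exists_torMat_eq_of_mem_torus hγ ht
  have hN : torNorm α β γ w ≠ 0 := by
    rw [← det_torMat, ← hw]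
    exact Matrix.GeneralLinearGroup.det_ne_zero t
  refine ⟨(w, (n, q, s)), hN, ?_⟩
  rw [besselElt]
  congr 1
  refine GSp4.ext_matrix ?_
  refine Eq.trans ?_ (mat4_torElt hN).symm
  exact congrArg leviMat hw

/-- The sup norm of a nonzero vector of ℚ_p² is a power of p, so a scalar p^k brings it onto the
unit sphere. This is where T(ℚ_p) splits as the powers of p times T(ℤ_p). -/
theorem exists_scalarElt_mul_besselElt_eq (h : IsInertForm α β γ) {r : GSp4 ℚ_[p]}
    (hr : r ∈ besselR !![α, β; β, γ]) :
    ∃ (k : ℤ) (v : (ℚ_[p] × ℚ_[p]) × (ℚ_[p] × ℚ_[p] × ℚ_[p])), v.1 ∈ unitTorus p ∧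
      r = scalarElt α β γ k * besselElt α β γ v := by
  obtain ⟨⟨⟨x, y⟩, X⟩, hv, rfl⟩ := exists_besselElt_eq h hr
  have hp0 := cast_prime_ne_zero p
  have hw : ((x, y) : ℚ_[p] × ℚ_[p]) ≠ 0 := by
    rintro e
    apply hv
    simp only [e]
    simp [torNorm]
  obtain ⟨k, hk⟩ : ∃ k : ℤ, ‖((x, y) : ℚ_[p] × ℚ_[p])‖ = (p : ℝ) ^ (-k) := by
    rw [Prod.norm_def]
    rcases max_choice ‖((x, y) : ℚ_[p] × ℚ_[p]).1‖ ‖((x, y) : ℚ_[p] × ℚ_[p]).2‖ with e | e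
    · rw [e]
      refine ⟨_, Padic.norm_eq_zpow_neg_valuation (x := x) ?_⟩
      rintro rfl
      apply hw
      refine Prod.ext rfl ?_
      have : ‖y‖ ≤ 0 := (le_max_right _ _).trans_eq (e.trans norm_zero)
      exact norm_le_zero_iff.mp this
    · rw [e]
      refine ⟨_, Padic.norm_eq_zpow_neg_valuation (x := y) ?_⟩
      rintro rfl
      apply hw
      refine Prod.ext ?_ rfl
      have : ‖x‖ ≤ 0 := (le_max_left _ _).trans_eq (e.trans norm_zero)
      exact norm_le_zero_iff.mp this
  have hm : (p : ℚ_[p]) ^ (-k) • ((x, y) : ℚ_[p] × ℚ_[p]) ∈ unitTorus p := by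
    change ‖(p : ℚ_[p]) ^ (-k) • ((x, y) : ℚ_[p] × ℚ_[p])‖ = 1
    rw [norm_smul, hk, Padic.norm_p_zpow, neg_neg, ← zpow_add₀ (cast_prime_pos p).ne',
      add_neg_cancel, zpow_zero]
  refine ⟨k, ((p : ℚ_[p]) ^ (-k) • (x, y), X), hm, ?_⟩
  rw [besselElt, besselElt, scalarElt, ← mul_assoc,
    torElt_mul_torElt (torNorm_scalar_ne_zero k) (h.torNorm_ne_zero (ne_zero_of_mem_unitTorus hm))]
  congr 2
  have e : ∀ z : ℚ_[p], z = (p : ℚ_[p]) ^ k * (((p : ℚ_[p]) ^ k)⁻¹ * z) := fun z => by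
    rw [mul_inv_cancel_left₀ (zpow_ne_zero _ hp0)]
  ext <;> simp [torMul, ← e]

theorem mat4_besselElt {w : ℚ_[p] × ℚ_[p]} (hw : torNorm α β γ w ≠ 0)
    (X : ℚ_[p] × ℚ_[p] × ℚ_[p]) : mat4 (besselElt α β γ (w, X)) =
      leviMat (torMat α β γ w) *
        !![1, 0, X.1, X.2.1; 0, 1, X.2.1, X.2.2; 0, 0, 1, 0; 0, 0, 0, 1] := by
  rw [← mat4_torElt hw]
  rfl

theorem measurable_mat4_apply (i j : Fin 4) : Measurable fun g : GSp4 ℚ_[p] => mat4 g i j :=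
  (continuous_mat_apply i j).measurable

/-- The coordinates of an element of R are measurable functions of its matrix. Rebuilding an element
from these coordinates gives a measurable map Z on G with values in R, and R is the set of its fixed
points. -/
theorem measurableSet_besselR (h : IsInertForm α β γ) :
    MeasurableSet (besselR !![α, β; β, γ] : Set (GSp4 ℚ_[p])) := by
  have hγ : γ ≠ 0 := norm_ne_zero_iff.mp (by rw [h.norm_right]; exact one_ne_zero)
  let W : GSp4 ℚ_[p] → ℚ_[p] × ℚ_[p] := fun g =>
    (2⁻¹ * (mat4 g 0 0 + mat4 g 1 1), γ⁻¹ * mat4 g 0 1)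
  have hW : Measurable W :=
    ((((measurable_mat4_apply 0 0).add (measurable_mat4_apply 1 1)).const_mul _)).prodMk
      ((measurable_mat4_apply 0 1).const_mul _)
  let Y : GSp4 ℚ_[p] → GSp4 ℚ_[p] := fun g => (torElt α β γ (W g))⁻¹ * g
  have hY : Measurable Y := (((measurable_torElt α β γ).comp hW).inv).mul measurable_id
  let Z : GSp4 ℚ_[p] → GSp4 ℚ_[p] := fun g =>
    besselElt α β γ (W g, (mat4 (Y g) 0 2, mat4 (Y g) 0 3, mat4 (Y g) 1 3))
  have hZ : Measurable Z := (measurable_besselElt α β γ).comp (hW.prodMk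
    (((measurable_mat4_apply 0 2).comp hY).prodMk (((measurable_mat4_apply 0 3).comp hY).prodMk
      ((measurable_mat4_apply 1 3).comp hY))))
  have e : (besselR !![α, β; β, γ] : Set (GSp4 ℚ_[p])) = (fun g => g⁻¹ * Z g) ⁻¹' {1} := by
    ext g
    rw [Set.mem_preimage, Set.mem_singleton_iff, inv_mul_eq_one]
    refine ⟨fun hg => ?_, fun hg => hg ▸ besselElt_mem _⟩
    obtain ⟨⟨w, X⟩, hw, rfl⟩ := exists_besselElt_eq h hg
    have h1 : W (besselElt α β γ (w, X)) = w := by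
      simp only [W]
      rw [mat4_besselElt hw]
      ext
      · simp [leviMat, torMat, Matrix.mul_apply, Fin.sum_univ_four]
        ring
      · simp [leviMat, torMat, Matrix.mul_apply, Fin.sum_univ_four, mul_comm w.2, hγ]
    have h2 : Y (besselElt α β γ (w, X)) = elU X.1 X.2.1 X.2.2 := by
      simp only [Y, h1]
      rw [besselElt, inv_mul_cancel_left]
    simp only [Z, h1, h2]
    rfl
  rw [e]
  exact (measurable_inv.mul hZ) (measurableSet_singleton 1)

instance : SFinite (besselVol₀ α β γ) := by unfold besselVol₀; infer_instance

instance : SFinite (besselVol α β γ) := by unfold besselVol; infer_instance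

theorem ae_mem_besselR (h : IsInertForm α β γ) :
    ∀ᵐ r ∂besselVol α β γ, r ∈ besselR !![α, β; β, γ] := by
  have hm := measurableSet_besselR h
  unfold besselVol besselVol₀
  rw [Measure.ae_sum_iff]
  intro k
  rw [Measure.map_map (measurable_const_mul _) (measurable_besselElt α β γ), ae_map_iff
    ((measurable_const_mul _).comp (measurable_besselElt α β γ)).aemeasurable
    (p := fun x => x ∈ besselR !![α, β; β, γ]) hm]
  exact Filter.Eventually.of_forall fun v => mul_mem (scalarElt_mem k) (besselElt_mem v)

/-- The T(ℤ_p)U part preserves each summand, as the scalars are central, and the scalar p^k shifts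
the summation index by k. -/
theorem map_mul_left_besselVol (h : IsInertForm α β γ) {r : GSp4 ℚ_[p]}
    (hr : r ∈ besselR !![α, β; β, γ]) :
    (besselVol α β γ).map (r * ·) = besselVol α β γ := by
  obtain ⟨k, v, hv, rfl⟩ := exists_scalarElt_mul_besselElt_eq h hr
  unfold besselVol
  rw [Measure.map_sum (measurable_const_mul _).aemeasurable]
  have e : ∀ j : ℤ, ((besselVol₀ α β γ).map (scalarElt α β γ j * ·)).map
      (scalarElt α β γ k * besselElt α β γ v * ·) =
      (besselVol₀ α β γ).map (scalarElt α β γ (Equiv.addRight k j) * ·) := by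
    intro j
    rw [Measure.map_map (measurable_const_mul _) (measurable_const_mul _)]
    conv_rhs => rw [← map_mul_left_besselVol₀ h hv]
    rw [Measure.map_map (measurable_const_mul _) (measurable_const_mul _)]
    congr 1
    funext x
    change scalarElt α β γ k * besselElt α β γ v * (scalarElt α β γ j * x) =
      scalarElt α β γ (j + k) * (besselElt α β γ v * x)
    rw [← scalarElt_mul_scalarElt, mul_assoc, ← mul_assoc (besselElt α β γ v),
      ← scalarElt_mul_comm, mul_assoc, mul_assoc]
  simp only [e]
  ext A hA
  rw [Measure.sum_apply _ hA, Measure.sum_apply _ hA]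
  exact (Equiv.addRight k).tsum_eq fun j => ((besselVol₀ α β γ).map
    (scalarElt α β γ j * ·)) A

theorem map_mul_right_besselVol (h : IsInertForm α β γ) {r : GSp4 ℚ_[p]}
    (hr : r ∈ besselR !![α, β; β, γ]) :
    (besselVol α β γ).map (· * r) = besselVol α β γ := by
  obtain ⟨k, v, hv, rfl⟩ := exists_scalarElt_mul_besselElt_eq h hr
  unfold besselVol
  rw [Measure.map_sum (measurable_mul_const _).aemeasurable]
  have e : ∀ j : ℤ, ((besselVol₀ α β γ).map (scalarElt α β γ j * ·)).map
      (· * (scalarElt α β γ k * besselElt α β γ v)) =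
      (besselVol₀ α β γ).map (scalarElt α β γ (Equiv.addRight k j) * ·) := by
    intro j
    rw [Measure.map_map (measurable_mul_const _) (measurable_const_mul _)]
    conv_rhs => rw [← map_mul_right_besselVol₀ h hv]
    rw [Measure.map_map (measurable_const_mul _) (measurable_mul_const _)]
    congr 1
    funext x
    change scalarElt α β γ j * x * (scalarElt α β γ k * besselElt α β γ v) =
      scalarElt α β γ (j + k) * (x * besselElt α β γ v)
    rw [← scalarElt_mul_scalarElt, ← mul_assoc, ← scalarElt_mul_comm, mul_assoc, mul_assoc,
      mul_assoc]
  simp only [e]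
  ext A hA
  rw [Measure.sum_apply _ hA, Measure.sum_apply _ hA]
  exact (Equiv.addRight k).tsum_eq fun j => ((besselVol₀ α β γ).map
    (scalarElt α β γ j * ·)) A

theorem simil_besselElt {v : (ℚ_[p] × ℚ_[p]) × (ℚ_[p] × ℚ_[p] × ℚ_[p])}
    (hv : torNorm α β γ v.1 ≠ 0) : simil (besselElt α β γ v) = torNorm α β γ v.1 := by
  rw [besselElt, simil_mul, simil_torElt hv, simil_elU, mul_one]

theorem norm_simil_besselElt (h : IsInertForm α β γ)
    {v : (ℚ_[p] × ℚ_[p]) × (ℚ_[p] × ℚ_[p] × ℚ_[p])} (hv : v.1 ∈ unitTorus p) :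
    ‖simil (besselElt α β γ v)‖ = 1 := by
  rw [simil_besselElt (h.torNorm_ne_zero (ne_zero_of_mem_unitTorus hv)), h.norm_torNorm,
    show ‖v.1‖ = 1 from hv, one_pow]

/-- Almost everywhere on the k-th summand the similitude factor has absolute value p^(-2k), so only
k = 0 contributes. -/
theorem besselVol_eq_of_norm_simil (h : IsInertForm α β γ) {A : Set (GSp4 ℚ_[p])}
    (hA : MeasurableSet A) (hs : ∀ g ∈ A, ‖simil g‖ = 1) :
    besselVol α β γ A = besselVol₀ α β γ A := by
  unfold besselVol
  rw [Measure.sum_apply _ hA, tsum_eq_single 0]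
  · congr 1
    conv_rhs => rw [← Measure.map_id (μ := besselVol₀ α β γ)]
    congr 1
    funext x
    change scalarElt α β γ 0 * x = x
    rw [scalarElt_zero, one_mul]
  · intro k hk
    unfold besselVol₀
    have hm := (measurable_const_mul (scalarElt α β γ k)).comp (measurable_besselElt α β γ)
    rw [Measure.map_map (measurable_const_mul _) (measurable_besselElt α β γ),
      Measure.map_apply hm hA, ← nonpos_iff_eq_zero]
    refine le_of_le_of_eq (measure_mono ?_) (ae_iff.mp ae_unitTorus)
    intro v hv hv'
    have h1 := hs _ hv
    rw [Function.comp_apply] at h1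
    change ‖simil (scalarElt α β γ k * besselElt α β γ v)‖ = 1 at h1
    rw [simil_mul, norm_mul, norm_simil_besselElt h hv', mul_one, simil_scalarElt,
      Padic.norm_p_zpow] at h1
    have h2 := (zpow_eq_one_iff_right₀ (cast_prime_pos p).le (one_lt_cast_prime p).ne').mp h1
    omega

theorem torElt_mem_maxCompact (h : IsInertForm α β γ) {w : ℚ_[p] × ℚ_[p]}
    (hw : w ∈ unitTorus p) : torElt α β γ w ∈ maxCompact p := by
  have h0 := h.torNorm_ne_zero (ne_zero_of_mem_unitTorus hw)
  have hw' : ‖w‖ ≤ 1 := le_of_eq hw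
  rw [Prod.norm_def, max_le_iff] at hw'
  obtain ⟨h1, h2⟩ := hw'
  have ha : ‖w.1 + w.2 * β‖ ≤ 1 := (IsUltrametricDist.norm_add_le_max _ _).trans
    (max_le h1 (norm_mul_le_one' p h2 h.norm_mid))
  have hb : ‖w.2 * γ‖ ≤ 1 := norm_mul_le_one' p h2 h.norm_right.le
  have hc : ‖w.2 * α‖ ≤ 1 := norm_mul_le_one' p h2 h.norm_left.le
  have hd : ‖w.1 - w.2 * β‖ ≤ 1 := by
    rw [sub_eq_add_neg]
    exact (IsUltrametricDist.norm_add_le_max _ _).trans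
      (max_le h1 (by rw [norm_neg]; exact norm_mul_le_one' p h2 h.norm_mid))
  rw [mem_maxCompact_iff]
  refine ⟨?_, by rw [simil_torElt h0, h.norm_torNorm, show ‖w‖ = 1 from hw, one_pow]⟩
  rw [mat4_torElt h0]
  intro i j
  fin_cases i <;> fin_cases j <;> simp only [leviMat, torMat] <;>
    first
    | exact ha | exact hb | exact hd | exact hc
    | exact (norm_neg _).trans_le hc | exact (norm_neg _).trans_le hb
    | exact (norm_neg _).trans_le ((norm_neg _).trans_le hc)
    | simp

open scoped Pointwise in
-- The torus factor lies in K, so the unipotent factors of elements of E lie in the compact set KE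
-- and have bounded coordinates.
theorem besselVol₀_ne_top_of_isCompact (h : IsInertForm α β γ) {E : Set (GSp4 ℚ_[p])}
    (hE : IsCompact E)
    (hEm : MeasurableSet E) : besselVol₀ α β γ E ≠ ∞ := by
  have hc : IsCompact ((maxCompact p : Set (GSp4 ℚ_[p])) * E) := isCompact_maxCompact.mul hE
  have hb : ∀ i j : Fin 4, ∃ C : ℝ, ∀ g ∈ (maxCompact p : Set (GSp4 ℚ_[p])) * E,
      ‖mat4 g i j‖ ≤ C := fun i j =>
    hc.exists_bound_of_continuousOn (continuous_mat_apply i j).continuousOn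
  obtain ⟨a, ha⟩ := hb 0 2
  obtain ⟨b, hb'⟩ := hb 0 3
  obtain ⟨c, hc'⟩ := hb 1 3
  unfold besselVol₀
  rw [Measure.map_apply (measurable_besselElt α β γ) hEm]
  have hsub : besselElt α β γ ⁻¹' E ⊆ {v | v.1 ∉ unitTorus p} ∪
      Set.univ ×ˢ Metric.closedBall 0 (max a (max b c)) := by
    intro v hv
    by_cases hw : v.1 ∈ unitTorus p
    · right
      refine ⟨Set.mem_univ _, ?_⟩
      have hm : elU v.2.1 v.2.2.1 v.2.2.2 ∈ (maxCompact p : Set (GSp4 ℚ_[p])) * E :=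
        ⟨(torElt α β γ v.1)⁻¹, inv_mem (torElt_mem_maxCompact h hw), _, hv, by
          simp only [besselElt]
          rw [inv_mul_cancel_left]⟩
      rw [mem_closedBall_zero_iff, Prod.norm_def, Prod.norm_def]
      exact max_le_max (ha _ hm) (max_le_max (hb' _ hm) (hc' _ hm))
    · exact Or.inl hw
  refine (lt_of_le_of_lt (measure_mono hsub) (lt_of_le_of_lt (measure_union_le _ _) ?_)).ne
  rw [show ((unitTorusVol p).prod (symVol p)) {v | v.1 ∉ unitTorus p} = 0 from
    ae_iff.mp ae_unitTorus, zero_add, Measure.prod_prod]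
  refine ENNReal.mul_lt_top ?_ (isCompact_closedBall _ _).measure_lt_top
  unfold unitTorusVol
  rw [Measure.restrict_apply_univ]
  refine lt_of_le_of_lt (measure_mono (t := Metric.closedBall 0 1) ?_)
    (isCompact_closedBall _ _).measure_lt_top
  intro w hw
  rw [mem_closedBall_zero_iff]
  exact le_of_eq hw

theorem isOpen_unitTorus : IsOpen (unitTorus p) := by
  have : unitTorus p = (Metric.closedBall 0 1 ×ˢ Metric.closedBall 0 1) \
      (Metric.ball 0 1 ×ˢ Metric.ball 0 1) := by
    rw [closedBall_prod_same, ball_prod_same, Metric.closedBall_sdiff_ball]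
    ext w
    exact mem_sphere_zero_iff_norm.symm
  rw [this]
  exact ((IsUltrametricDist.isOpen_closedBall _ one_ne_zero).prod
    (IsUltrametricDist.isOpen_closedBall _ one_ne_zero)).sdiff
    ((IsUltrametricDist.isClosed_ball _ _).prod (IsUltrametricDist.isClosed_ball _ _))

theorem continuousOn_besselElt (h : IsInertForm α β γ) :
    ContinuousOn (besselElt α β γ) (unitTorus p ×ˢ Set.univ) := by
  rw [continuousOn_iff_continuous_domRestrict]
  refine continuous_of_mat4 ?_
  have : (fun v : (unitTorus p ×ˢ Set.univ : Set ((ℚ_[p] × ℚ_[p]) × (ℚ_[p] × ℚ_[p] × ℚ_[p]))) =>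
      mat4 (besselElt α β γ v.1)) = fun v => leviMat (torMat α β γ v.1.1) *
        !![1, 0, v.1.2.1, v.1.2.2.1; 0, 1, v.1.2.2.1, v.1.2.2.2; 0, 0, 1, 0; 0, 0, 0, 1] := by
    funext v
    exact mat4_besselElt (h.torNorm_ne_zero (ne_zero_of_mem_unitTorus v.2.1)) v.1.2
  change Continuous fun v : (unitTorus p ×ˢ Set.univ :
    Set ((ℚ_[p] × ℚ_[p]) × (ℚ_[p] × ℚ_[p] × ℚ_[p]))) => mat4 (besselElt α β γ v.1)
  rw [this]
  refine Continuous.matrix_mul (continuous_matrix fun i j => ?_) (continuous_matrix fun i j => ?_)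
  · fin_cases i <;> fin_cases j <;> simp [leviMat, torMat] <;> fun_prop
  · fin_cases i <;> fin_cases j <;> simp <;> fun_prop

theorem besselVol₀_ne_zero (h : IsInertForm α β γ) {E : Set (GSp4 ℚ_[p])} (hE : IsOpen E)
    (h1 : 1 ∈ E) : besselVol₀ α β γ E ≠ 0 := by
  have ho : IsOpen (unitTorus p ×ˢ (Set.univ : Set (ℚ_[p] × ℚ_[p] × ℚ_[p]))) :=
    isOpen_unitTorus.prod isOpen_univ
  have hO := (continuousOn_besselElt h).isOpen_inter_preimage ho hE
  unfold besselVol₀ unitTorusVol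
  rw [Measure.map_apply (measurable_besselElt α β γ) hE.measurableSet,
    Measure.restrict_prod_eq_prod_univ, Measure.restrict_apply
      (measurable_besselElt α β γ hE.measurableSet), Set.inter_comm]
  refine (hO.measure_pos _ ⟨((1, 0), 0), ⟨?_, Set.mem_univ _⟩, ?_⟩).ne'
  · simp [unitTorus, Prod.norm_def]
  · have : besselElt α β γ ((1, 0), 0) = 1 := by
      have := scalarElt_zero (α := α) (β := β) (γ := γ)
      rw [scalarElt, zpow_zero] at this
      rw [besselElt, this, one_mul]
      exact elU_zero
    rw [Set.mem_preimage, this]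
    exact h1

/-- The set sKs⁻¹ is an open compact neighbourhood of 1 on which the similitude factor is a unit.
These are the normalizing constants of the weight function. -/
theorem besselVol_conj (h : IsInertForm α β γ) (s : GSp4 ℚ_[p]) :
    besselVol α β γ {x | s⁻¹ * x * s ∈ maxCompact p} ≠ 0 ∧
      besselVol α β γ {x | s⁻¹ * x * s ∈ maxCompact p} ≠ ∞ := by
  have hc : Continuous fun x => s⁻¹ * x * s := by fun_prop
  have ho : IsOpen {x | s⁻¹ * x * s ∈ maxCompact p} := isOpen_maxCompact.preimage hc
  have hcpt : IsCompact {x | s⁻¹ * x * s ∈ maxCompact p} := by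
    convert isCompact_maxCompact.image (f := fun x => s * x * s⁻¹) (by fun_prop) using 1
    ext x
    constructor
    · intro hx
      exact ⟨_, hx, by group⟩
    · rintro ⟨y, hy, rfl⟩
      change s⁻¹ * (s * y * s⁻¹) * s ∈ maxCompact p
      have e : s⁻¹ * (s * y * s⁻¹) * s = y := by group
      rw [e]
      exact hy
  rw [besselVol_eq_of_norm_simil h ho.measurableSet]
  · refine ⟨besselVol₀_ne_zero h ho ?_, besselVol₀_ne_top_of_isCompact h hcpt ho.measurableSet⟩
    change s⁻¹ * 1 * s ∈ maxCompact p
    rw [mul_one, inv_mul_cancel]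
    exact one_mem _
  · intro x hx
    have := norm_simil_of_mem_maxCompact hx
    rw [simil_mul, simil_mul, simil_inv, mul_comm, mul_inv_cancel_left₀ (simil_ne_zero s)] at this
    exact this

end BesselInvariance

/-! ### Explicit volumes in the coordinates of R. -/

section BesselVolume

variable {p : ℕ} [Fact p.Prime]

theorem norm_lt_one_iff_le_inv {x : ℚ_[p]} : ‖x‖ < 1 ↔ ‖x‖ ≤ (p : ℝ) ^ (-(1 : ℤ)) := by
  have := Padic.norm_le_pow_iff_norm_lt_pow_add_one x (-1)
  rw [this]
  simp

theorem measurableSet_norm_snd_le (r : ℝ) :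
    MeasurableSet {w : ℚ_[p] × ℚ_[p] | ‖w.2‖ ≤ r} :=
  measurableSet_le measurable_snd.norm measurable_const

/-- For j > 0 the second coordinate is not a unit, so the first must be: the set is the units of ℤ_p
times a ball. For j = 0 this fails. -/
theorem unitTorusVol_setOf_norm_snd_le {j : ℕ} (hj : 0 < j) :
    unitTorusVol p {w | ‖w.2‖ ≤ (p : ℝ) ^ (-(j : ℤ))} =
      ENNReal.ofReal ((1 - (p : ℝ) ^ (-(1 : ℤ))) * (p : ℝ) ^ (-(j : ℤ))) := by
  have hp1 := one_lt_cast_prime p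
  have hlt : (p : ℝ) ^ (-(j : ℤ)) < 1 := zpow_lt_one_of_neg₀ hp1 (by omega)
  have hle : (p : ℝ) ^ (-(1 : ℤ)) ≤ 1 := (zpow_lt_one_of_neg₀ hp1 (by omega)).le
  have e : {w : ℚ_[p] × ℚ_[p] | ‖w.2‖ ≤ (p : ℝ) ^ (-(j : ℤ))} ∩ unitTorus p =
      (Metric.closedBall 0 1 \ Metric.closedBall 0 ((p : ℝ) ^ (-(1 : ℤ)))) ×ˢ
        Metric.closedBall 0 ((p : ℝ) ^ (-(j : ℤ))) := by
    ext ⟨x, y⟩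
    simp only [unitTorus, Set.mem_inter_iff, Set.mem_ofPred_eq, Set.mem_prod, Set.mem_sdiff,
      mem_closedBall_zero_iff, Prod.norm_mk, ← norm_lt_one_iff_le_inv, not_lt]
    constructor
    · rintro ⟨h1, h2⟩
      have h3 : ‖x‖ ≤ 1 := (le_max_left _ _).trans_eq h2
      refine ⟨⟨h3, ?_⟩, h1⟩
      by_contra hx
      exact (max_lt (not_le.mp hx) (h1.trans_lt hlt)).ne h2
    · rintro ⟨⟨h1, h2⟩, h3⟩
      exact ⟨h3, by rw [le_antisymm h1 h2]; exact max_eq_left (h3.trans hlt.le)⟩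
  unfold unitTorusVol
  rw [Measure.restrict_apply (measurableSet_norm_snd_le _), e, Measure.prod_prod,
    measure_sdiff (Metric.closedBall_subset_closedBall hle)
      measurableSet_closedBall.nullMeasurableSet (isCompact_closedBall _ _).measure_lt_top.ne,
    padicVol_closedBall_zero_one, padicVol_closedBall, padicVol_closedBall,
    ENNReal.ofReal_mul (sub_nonneg.mpr hle), ENNReal.ofReal_sub _ (by positivity),
    ENNReal.ofReal_one]

theorem unitTorusVol_univ :
    unitTorusVol p Set.univ = ENNReal.ofReal (1 - (p : ℝ) ^ (-(2 : ℤ))) := by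
  have hp1 := one_lt_cast_prime p
  have hle : (p : ℝ) ^ (-(1 : ℤ)) ≤ 1 := (zpow_lt_one_of_neg₀ hp1 (by omega)).le
  have e : unitTorus p = Metric.closedBall 0 1 ×ˢ Metric.closedBall 0 1 \
      Metric.closedBall 0 ((p : ℝ) ^ (-(1 : ℤ))) ×ˢ
        Metric.closedBall 0 ((p : ℝ) ^ (-(1 : ℤ))) := by
    ext ⟨x, y⟩
    simp only [unitTorus, Set.mem_ofPred_eq, Set.mem_prod, Set.mem_sdiff,
      mem_closedBall_zero_iff, Prod.norm_mk, ← norm_lt_one_iff_le_inv, ← max_lt_iff,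
      ← max_le_iff, not_lt]
    exact ⟨fun h => ⟨h.le, h.ge⟩, fun h => le_antisymm h.1 h.2⟩
  unfold unitTorusVol
  rw [Measure.restrict_apply_univ, e, measure_sdiff
    (Set.prod_mono (Metric.closedBall_subset_closedBall hle)
      (Metric.closedBall_subset_closedBall hle))
      (measurableSet_closedBall.prod measurableSet_closedBall).nullMeasurableSet
      ((isCompact_closedBall _ _).prod (isCompact_closedBall _ _)).measure_lt_top.ne,
    Measure.prod_prod, Measure.prod_prod, padicVol_closedBall_zero_one, padicVol_closedBall,
    ENNReal.ofReal_sub _ (by positivity), ← ENNReal.ofReal_mul (by positivity),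
    ← zpow_add₀ (cast_prime_pos p).ne', ENNReal.ofReal_one, one_mul]
  norm_num

variable {α β γ : ℚ_[p]}

/-- Fubini over the torus coordinate. The centre `f w` of the ball for q may depend on w, as
translating a ball keeps its volume; t₃ needs this. -/
theorem besselVol₀_apply {A : Set (GSp4 ℚ_[p])} (hA : MeasurableSet A)
    {C : Set (ℚ_[p] × ℚ_[p])} (hC : MeasurableSet C) (f : ℚ_[p] × ℚ_[p] → ℚ_[p]) (a b c : ℤ)
    (hAC : ∀ w ∈ unitTorus p, ∀ n q r, besselElt α β γ (w, (n, q, r)) ∈ A ↔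
      w ∈ C ∧ ‖n‖ ≤ (p : ℝ) ^ (-a) ∧ ‖q - f w‖ ≤ (p : ℝ) ^ (-b) ∧ ‖r‖ ≤ (p : ℝ) ^ (-c)) :
    besselVol₀ α β γ A = unitTorusVol p C * ENNReal.ofReal ((p : ℝ) ^ (-(a + b + c))) := by
  have hpR := cast_prime_pos p
  have hm := measurable_besselElt α β γ
  unfold besselVol₀
  rw [Measure.map_apply hm hA, Measure.prod_apply (hm hA)]
  have hae : ∀ᵐ w ∂unitTorusVol p, w ∈ unitTorus p := ae_restrict_mem measurableSet_unitTorus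
  have hcongr : ∀ᵐ w ∂unitTorusVol p, symVol p (Prod.mk w ⁻¹' (besselElt α β γ ⁻¹' A)) =
      C.indicator (fun _ => ENNReal.ofReal ((p : ℝ) ^ (-(a + b + c)))) w := by
    filter_upwards [hae] with w hw
    by_cases hwC : w ∈ C
    · have e : Prod.mk w ⁻¹' (besselElt α β γ ⁻¹' A) = Metric.closedBall 0 ((p : ℝ) ^ (-a)) ×ˢ
          (Metric.closedBall (f w) ((p : ℝ) ^ (-b)) ×ˢ Metric.closedBall 0 ((p : ℝ) ^ (-c))) := by
        ext ⟨n, q, r⟩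
        rw [Set.mem_preimage, Set.mem_preimage, hAC w hw]
        simp only [hwC, true_and, Set.mem_prod, sub_zero, Metric.mem_closedBall,
          dist_eq_norm]
      rw [Set.indicator_of_mem hwC, e]
      unfold symVol
      rw [Measure.prod_prod, Measure.prod_prod, padicVol_closedBall, padicVol_closedBall,
        padicVol_closedBall, ← ENNReal.ofReal_mul (by positivity),
        ← ENNReal.ofReal_mul (by positivity), ← zpow_add₀ hpR.ne', ← zpow_add₀ hpR.ne']
      congr 2
      ring
    · have e : Prod.mk w ⁻¹' (besselElt α β γ ⁻¹' A) = ∅ := by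
        ext ⟨n, q, r⟩
        rw [Set.mem_preimage, Set.mem_preimage, hAC w hw]
        simp [hwC]
      rw [Set.indicator_of_notMem hwC, e, measure_empty]
  rw [lintegral_congr_ae hcongr, lintegral_indicator_const hC, mul_comm]

theorem elU_mem_maxCompact_iff {n q r : ℚ_[p]} :
    elU n q r ∈ maxCompact p ↔ ‖n‖ ≤ 1 ∧ ‖q‖ ≤ 1 ∧ ‖r‖ ≤ 1 := by
  rw [mem_maxCompact_iff, simil_elU, mat4_elU]
  constructor
  · rintro ⟨h, -⟩
    exact ⟨h 0 2, h 0 3, h 1 3⟩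
  · rintro ⟨hn, hq, hr⟩
    refine ⟨fun i j => ?_, norm_one⟩
    fin_cases i <;> fin_cases j <;> simp [hn, hq, hr]

theorem besselElt_mem_maxCompact_iff (h : IsInertForm α β γ) {w : ℚ_[p] × ℚ_[p]}
    (hw : w ∈ unitTorus p) {n q r : ℚ_[p]} : besselElt α β γ (w, (n, q, r)) ∈ maxCompact p ↔
      ‖n‖ ≤ 1 ∧ ‖q‖ ≤ 1 ∧ ‖r‖ ≤ 1 := by
  rw [besselElt, Subgroup.mul_mem_cancel_left _ (torElt_mem_maxCompact h hw),
    elU_mem_maxCompact_iff]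

theorem besselVol_maxCompact (h : IsInertForm α β γ) :
    besselVol α β γ (maxCompact p) = ENNReal.ofReal (1 - (p : ℝ) ^ (-(2 : ℤ))) := by
  have hm : MeasurableSet (maxCompact p : Set (GSp4 ℚ_[p])) := isOpen_maxCompact.measurableSet
  rw [besselVol_eq_of_norm_simil h hm fun g hg => norm_simil_of_mem_maxCompact hg,
    besselVol₀_apply hm MeasurableSet.univ (fun _ => 0) 0 0 0, unitTorusVol_univ]
  · simp
  · intro w hw n q r
    simp [besselElt_mem_maxCompact_iff h hw]

end BesselVolume

/-! ### The modular character of G on the elements that occur. -/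

section Unimodular

variable {p : ℕ} [Fact p.Prime]

theorem modularCharacter_eq_one_of_measure_eq {g : GSp4 ℚ_[p]} {E : Set (GSp4 ℚ_[p])}
    (hE : IsOpen E) (hne : E.Nonempty) (hc : IsCompact E)
    (h : (Measure.haar : Measure (GSp4 ℚ_[p])).map (· * g) E = Measure.haar E) :
    Measure.modularCharacter g = 1 := by
  have h1 := Measure.map_right_mul_eq_modularCharacterFun_smul
    (Measure.haar : Measure (GSp4 ℚ_[p])) g
  rw [h1, Measure.smul_apply, ENNReal.smul_def, smul_eq_mul] at h
  have h2 := (ENNReal.mul_left_inj (hE.measure_pos _ hne).ne' hc.measure_lt_top.ne).mp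
    (h.trans (one_mul _).symm)
  exact_mod_cast h2

theorem modularCharacter_eq_one_of_mem_maxCompact {g : GSp4 ℚ_[p]} (hg : g ∈ maxCompact p) :
    Measure.modularCharacter g = 1 := by
  refine modularCharacter_eq_one_of_measure_eq isOpen_maxCompact ⟨1, one_mem _⟩
    isCompact_maxCompact ?_
  rw [Measure.map_apply (measurable_mul_const g) isOpen_maxCompact.measurableSet]
  congr 1
  ext x
  exact Subgroup.mul_mem_cancel_right _ hg

theorem modularCharacter_eq_one_of_central {g : GSp4 ℚ_[p]} (hg : ∀ x, g * x = x * g) :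
    Measure.modularCharacter g = 1 := by
  refine modularCharacter_eq_one_of_measure_eq isOpen_maxCompact ⟨1, one_mem _⟩
    isCompact_maxCompact ?_
  simp only [← hg]
  rw [map_mul_left_eq_self]

theorem mat4_elH (l : ℤ) (m : ℕ) : mat4 (elH p l m) =
    !![(p : ℚ_[p]) ^ (2 * (m : ℤ) + l), 0, 0, 0;
       0, (p : ℚ_[p]) ^ ((m : ℤ) + l), 0, 0;
       0, 0, 1, 0;
       0, 0, 0, (p : ℚ_[p]) ^ (m : ℤ)] := rfl

theorem elH_mul_elJ_mul_elH (α β γ : ℚ_[p]) (l : ℤ) (m : ℕ) :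
    elH p l m * elJ * elH p l m = scalarElt α β γ (2 * (m : ℤ) + l) * elJ := by
  refine GSp4.ext_matrix ?_
  change mat4 (elH p l m) * J4 _ * mat4 (elH p l m) =
    mat4 (scalarElt α β γ (2 * (m : ℤ) + l)) * J4 _
  have e : (p : ℚ_[p]) ^ (2 * (m : ℤ) + l) =
      (p : ℚ_[p]) ^ ((m : ℤ) + l) * (p : ℚ_[p]) ^ (m : ℤ) := by
    rw [← zpow_add₀ (cast_prime_ne_zero p)]
    congr 1
    ring
  rw [mat4_scalarElt, mat4_elH, e]
  generalize (p : ℚ_[p]) ^ ((m : ℤ) + l) = a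
  generalize (p : ℚ_[p]) ^ (m : ℤ) = b
  ext i j
  fin_cases i <;> fin_cases j <;> simp [J4, Matrix.mul_apply, Fin.sum_univ_four, mul_comm]

/-- As hJh is a central scalar times J, the modular character of h has square 1. Its values are
nonnegative, so it equals 1. -/
theorem modularCharacter_elH (l : ℤ) (m : ℕ) : Measure.modularCharacter (elH p l m) = 1 := by
  have h1 := congrArg (Measure.modularCharacter (G := GSp4 ℚ_[p]))
    (elH_mul_elJ_mul_elH (1 : ℚ_[p]) 0 0 l m)
  rw [map_mul, map_mul, map_mul, modularCharacter_eq_one_of_mem_maxCompact elJ_mem_maxCompact,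
    modularCharacter_eq_one_of_central (scalarElt_mul_comm _), mul_one, mul_one, ← sq] at h1
  exact (pow_eq_one_iff_of_nonneg zero_le two_ne_zero).mp h1

theorem elH_zero_mul_elU (l : ℤ) (n q r : ℚ_[p]) : elH p l 0 * elU n q r =
    elU ((p : ℚ_[p]) ^ l * n) ((p : ℚ_[p]) ^ l * q) ((p : ℚ_[p]) ^ l * r) * elH p l 0 := by
  refine GSp4.ext_matrix ?_
  change mat4 (elH p l 0) * mat4 (elU _ _ _) = mat4 (elU _ _ _) * mat4 (elH p l 0)
  rw [mat4_elH, mat4_elU, mat4_elU]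
  ext i j
  fin_cases i <;> fin_cases j <;> simp [Matrix.mul_apply, Fin.sum_univ_four]

theorem exists_zpow_mul_norm_le_one (n q r : ℚ_[p]) : ∃ l : ℤ, ‖(p : ℚ_[p]) ^ l * n‖ ≤ 1 ∧
    ‖(p : ℚ_[p]) ^ l * q‖ ≤ 1 ∧ ‖(p : ℚ_[p]) ^ l * r‖ ≤ 1 := by
  obtain ⟨k, hk⟩ := pow_unbounded_of_one_lt (max ‖n‖ (max ‖q‖ ‖r‖)) (one_lt_cast_prime p)
  have hpR := cast_prime_pos p
  have key : ∀ x : ℚ_[p], ‖x‖ ≤ (p : ℝ) ^ k → ‖(p : ℚ_[p]) ^ (k : ℤ) * x‖ ≤ 1 := by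
    intro x hx
    rw [norm_mul, Padic.norm_p_zpow, zpow_neg, zpow_natCast]
    exact inv_mul_le_one_of_le₀ hx (by positivity)
  simp only [max_lt_iff] at hk
  exact ⟨k, key n hk.1.le, key q hk.2.1.le, key r hk.2.2.le⟩

/-- Conjugation by a suitable h(l,0) brings the element into K. -/
theorem modularCharacter_elU (n q r : ℚ_[p]) : Measure.modularCharacter (elU n q r) = 1 := by
  obtain ⟨l, hl⟩ := exists_zpow_mul_norm_le_one n q r
  have h1 := congrArg (Measure.modularCharacter (G := GSp4 ℚ_[p])) (elH_zero_mul_elU l n q r)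
  rwa [map_mul, map_mul, modularCharacter_elH, one_mul, mul_one,
    modularCharacter_eq_one_of_mem_maxCompact (elU_mem_maxCompact_iff.mpr hl)] at h1

theorem modularCharacter_eq_one_of_mem_besselR {α β γ : ℚ_[p]} (h : IsInertForm α β γ)
    {r : GSp4 ℚ_[p]} (hr : r ∈ besselR !![α, β; β, γ]) : Measure.modularCharacter r = 1 := by
  obtain ⟨k, v, hv, rfl⟩ := exists_scalarElt_mul_besselElt_eq h hr
  rw [besselElt, map_mul, map_mul, modularCharacter_elU,
    modularCharacter_eq_one_of_mem_maxCompact (torElt_mem_maxCompact h hv),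
    modularCharacter_eq_one_of_central (scalarElt_mul_comm _), mul_one, mul_one]

/-- The right Haar measure on `GSp(4, ℚ_p)`. -/
noncomputable def rightHaar (p : ℕ) [Fact p.Prime] : Measure (GSp4 ℚ_[p]) :=
  (Measure.haar : Measure (GSp4 ℚ_[p])).map fun g => g⁻¹

instance : SFinite (rightHaar p) := by unfold rightHaar; infer_instance

theorem map_mul_right_rightHaar (g : GSp4 ℚ_[p]) : (rightHaar p).map (· * g) = rightHaar p := by
  unfold rightHaar
  rw [Measure.map_map (measurable_mul_const g) measurable_inv]
  conv_rhs => rw [← map_mul_left_eq_self Measure.haar g⁻¹, Measure.map_map measurable_inv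
    (measurable_const_mul _)]
  congr 1

theorem map_mul_left_rightHaar {g : GSp4 ℚ_[p]} (hg : Measure.modularCharacter g = 1) :
    (rightHaar p).map (g * ·) = rightHaar p := by
  have h1 : (Measure.haar : Measure (GSp4 ℚ_[p])).map (· * g⁻¹) = Measure.haar := by
    have h2 := Measure.map_right_mul_eq_modularCharacterFun_smul
      (Measure.haar : Measure (GSp4 ℚ_[p])) g⁻¹
    have h3 : Measure.modularCharacterFun g⁻¹ = 1 := by
      have h4 : Measure.modularCharacter g⁻¹ * Measure.modularCharacter g = 1 := by
        rw [← map_mul, inv_mul_cancel, map_one]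
      rwa [hg, mul_one] at h4
    rw [h2, h3, one_smul]
  unfold rightHaar
  rw [Measure.map_map (measurable_const_mul g) measurable_inv]
  conv_rhs => rw [← h1, Measure.map_map measurable_inv (measurable_mul_const _)]
  congr 1

theorem rightHaar_ne_zero {E : Set (GSp4 ℚ_[p])} (hE : IsOpen E) (hne : E.Nonempty) :
    rightHaar p E ≠ 0 := by
  unfold rightHaar
  rw [Measure.map_apply measurable_inv hE.measurableSet]
  exact ((hE.preimage continuous_inv).measure_pos _ (by simpa using hne)).ne'

theorem rightHaar_ne_top {E : Set (GSp4 ℚ_[p])} (hE : IsOpen E) (hc : IsCompact E) :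
    rightHaar p E ≠ ∞ := by
  unfold rightHaar
  rw [Measure.map_apply measurable_inv hE.measurableSet]
  exact hc.inv.measure_lt_top.ne

end Unimodular

/-- Makes any two compact open subgroups commensurable. -/
theorem Subgroup.relIndex_ne_zero_of_isOpen_of_isCompact {G : Type*} [Group G] [TopologicalSpace G]
    [IsTopologicalGroup G] {H' H : Subgroup G} (h' : IsOpen (H' : Set G))
    (h : IsCompact (H : Set G)) : H'.relIndex H ≠ 0 := by
  have : CompactSpace H := isCompact_iff_compactSpace.mp h
  have := Subgroup.quotient_finite_of_isOpen (H'.subgroupOf H)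
    (h'.preimage continuous_subtype_val)
  have : (H'.subgroupOf H).FiniteIndex := Subgroup.finiteIndex_of_finite_quotient
  exact Subgroup.FiniteIndex.index_ne_zero

/-! ### Coset volumes as ratios of volumes in R. -/

section BesselQuotient

variable {p : ℕ} [Fact p.Prime] {S : Matrix (Fin 2) (Fin 2) ℚ}

theorem BesselQuot.mk_surjective : Function.Surjective (BesselQuot.mk (p := p) S) :=
  Quotient.mk_surjective

theorem BesselQuot.mk_eq_iff (a b : GSp4 ℚ_[p]) :
    BesselQuot.mk S a = BesselQuot.mk S b ↔ ∃ r ∈ besselR (matPadic p S), a = r * b := by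
  refine Quotient.eq.trans (QuotientGroup.rightRel_apply.trans ⟨fun h => ?_, ?_⟩)
  · refine ⟨a * b⁻¹, ?_, by group⟩
    have := inv_mem h
    rwa [mul_inv_rev, inv_inv] at this
  · rintro ⟨r, hr, rfl⟩
    rw [mul_inv_rev, mul_inv_cancel_left]
    exact inv_mem hr

theorem BesselQuot.continuous_mk : Continuous (BesselQuot.mk (p := p) S) := continuous_quot_mk

theorem BesselQuot.translate_mk (g x : GSp4 ℚ_[p]) :
    BesselQuot.translate g (BesselQuot.mk S x) = BesselQuot.mk S (x * g) := rfl

theorem BesselQuot.continuous_translate (g : GSp4 ℚ_[p]) :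
    Continuous (BesselQuot.translate (S := S) g) :=
  continuous_quot_lift _ (BesselQuot.continuous_mk.comp (continuous_mul_const g))

theorem BesselQuot.isOpen_image_mk {U : Set (GSp4 ℚ_[p])} (hU : IsOpen U) :
    IsOpen (BesselQuot.mk S '' U) := by
  have e : BesselQuot.mk S ⁻¹' (BesselQuot.mk S '' U) =
      ⋃ r ∈ besselR (matPadic p S), (r * ·) ⁻¹' U := by
    ext x
    simp only [Set.mem_preimage, Set.mem_image, Set.mem_iUnion, exists_prop]
    constructor
    · rintro ⟨u, hu, h⟩
      obtain ⟨r, hr, rfl⟩ := (BesselQuot.mk_eq_iff u x).mp h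
      exact ⟨r, hr, hu⟩
    · rintro ⟨r, hr, hu⟩
      exact ⟨_, hu, (BesselQuot.mk_eq_iff _ x).mpr ⟨r, hr, rfl⟩⟩
  refine isOpen_coinduced.mpr ?_
  change IsOpen (BesselQuot.mk S ⁻¹' (BesselQuot.mk S '' U))
  rw [e]
  exact isOpen_biUnion fun r _ => hU.preimage (continuous_const_mul r)

variable {α β γ : ℚ_[p]}

theorem exists_isNormalizedInvariant (h : IsInertForm α β γ)
    (hS : matPadic p S = !![α, β; β, γ]) :
    ∃ μ : Measure (BesselQuot p S), IsNormalizedInvariant μ := by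
  obtain ⟨μ, h1, h2⟩ := exists_invariant_measure_quotient (R := besselR !![α, β; β, γ])
    isOpen_maxCompact (ae_mem_besselR h) (fun r hr => map_mul_left_besselVol h hr)
    (fun r hr => map_mul_right_besselVol h hr) (fun s => (besselVol_conj h s).1)
    (fun s => (besselVol_conj h s).2) (ν := rightHaar p) map_mul_right_rightHaar
    (fun r hr => map_mul_left_rightHaar (modularCharacter_eq_one_of_mem_besselR h hr))
    (rightHaar_ne_zero isOpen_maxCompact ⟨1, one_mem _⟩)
    (rightHaar_ne_top isOpen_maxCompact isCompact_maxCompact)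
    (π := BesselQuot.mk S) BesselQuot.continuous_mk.measurable
    (hS ▸ BesselQuot.mk_eq_iff) (τ := BesselQuot.translate) BesselQuot.translate_mk
    (fun g => (BesselQuot.continuous_translate g).measurable)
    (BesselQuot.isOpen_image_mk isOpen_maxCompact).measurableSet
  exact ⟨μ, h1, h2⟩

/-- The conjugate `g I_p g⁻¹` of the Iwahori subgroup. -/
noncomputable def conjIwahori (g : GSp4 ℚ_[p]) : Subgroup (GSp4 ℚ_[p]) :=
  (iwahoriSubgroup p).comap (MulAut.conj g⁻¹).toMonoidHom

theorem mem_conjIwahori {g x : GSp4 ℚ_[p]} : x ∈ conjIwahori g ↔ g⁻¹ * x * g ∈ iwahori p := by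
  change g⁻¹ * x * g⁻¹⁻¹ ∈ iwahori p ↔ _
  rw [inv_inv]

theorem isOpen_conjIwahori (g : GSp4 ℚ_[p]) : IsOpen (conjIwahori g : Set (GSp4 ℚ_[p])) := by
  have : (conjIwahori g : Set (GSp4 ℚ_[p])) = (fun x => g⁻¹ * x * g) ⁻¹' iwahori p :=
    Set.ext fun x => mem_conjIwahori
  rw [this]
  exact isOpen_iwahori.preimage (by fun_prop)

theorem isCompact_iwahori : IsCompact (iwahori p) :=
  isCompact_maxCompact.of_isClosed_subset
    (Subgroup.isClosed_of_isOpen (iwahoriSubgroup p) isOpen_iwahori) iwahoriSubgroup_le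

theorem isCompact_conjIwahori (g : GSp4 ℚ_[p]) :
    IsCompact (conjIwahori g : Set (GSp4 ℚ_[p])) := by
  convert isCompact_iwahori.image (f := fun x => g * x * g⁻¹) (by fun_prop) using 1
  ext x
  constructor
  · intro hx
    exact ⟨_, mem_conjIwahori.mp hx, by group⟩
  · rintro ⟨y, hy, rfl⟩
    have e : g⁻¹ * (g * y * g⁻¹) * g = y := by group
    refine mem_conjIwahori.mpr ?_
    rwa [e]

theorem norm_simil_of_mem_conjIwahori {g x : GSp4 ℚ_[p]} (hx : x ∈ conjIwahori g) :
    ‖simil x‖ = 1 := by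
  have := norm_simil_of_mem_maxCompact (mem_conjIwahori.mp hx).1
  rwa [simil_mul, simil_mul, simil_inv, mul_comm, mul_inv_cancel_left₀ (simil_ne_zero g)] at this

theorem rightHaar_conjIwahori {g : GSp4 ℚ_[p]} (hg : Measure.modularCharacter g = 1) :
    rightHaar p (conjIwahori g) = rightHaar p (iwahori p) := by
  have hm : MeasurableSet (iwahori p) := isOpen_iwahori.measurableSet
  have hg' : Measure.modularCharacter g⁻¹ = 1 := by
    have h4 : Measure.modularCharacter g⁻¹ * Measure.modularCharacter g = 1 := by
      rw [← map_mul, inv_mul_cancel, map_one]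
    rwa [hg, mul_one] at h4
  have e : (conjIwahori g : Set (GSp4 ℚ_[p])) = (g⁻¹ * ·) ⁻¹' ((· * g) ⁻¹' iwahori p) :=
    Set.ext fun x => mem_conjIwahori
  rw [e, ← Measure.map_apply (measurable_const_mul _) (measurable_mul_const _ hm),
    map_mul_left_rightHaar hg', ← Measure.map_apply (measurable_mul_const _) hm,
    map_mul_right_rightHaar]

/-- Since gI = (gIg⁻¹)g, the double coset is a right translate of the image of a subgroup, and
invariance of the measure removes the translation. -/
theorem image_mk_mul_iwahori (g : GSp4 ℚ_[p]) :
    (fun k => BesselQuot.mk S (g * k)) '' iwahori p =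
      BesselQuot.translate g⁻¹ ⁻¹' (BesselQuot.mk S '' conjIwahori g) := by
  ext x
  obtain ⟨y, rfl⟩ := BesselQuot.mk_surjective x
  rw [Set.mem_preimage, BesselQuot.translate_mk]
  constructor
  · rintro ⟨k, hk, hky⟩
    refine ⟨g * k * g⁻¹, mem_conjIwahori.mpr ?_, ?_⟩
    · have e : g⁻¹ * (g * k * g⁻¹) * g = k := by group
      rwa [e]
    · rw [← BesselQuot.translate_mk, ← BesselQuot.translate_mk]
      exact congrArg _ hky
  · rintro ⟨k, hk, hky⟩
    refine ⟨_, mem_conjIwahori.mp hk, ?_⟩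
    have := congrArg (BesselQuot.translate g) hky
    rw [BesselQuot.translate_mk, BesselQuot.translate_mk, inv_mul_cancel_right] at this
    dsimp only
    rw [← this]
    congr 1
    group

/-- The comparison of gIg⁻¹ with K, where g = h(l,m)t: the image of K has measure 1, ν(gIg⁻¹) =
ν(I), and ν(K) = [K:I]ν(I); then ν(I) cancels. -/
theorem cosetVolume_mul (h : IsInertForm α β γ) (hS : matPadic p S = !![α, β; β, γ])
    {μ : Measure (BesselQuot p S)} (hμ : IsNormalizedInvariant μ) (l : ℤ) (m : ℕ)
    {t : GSp4 ℚ_[p]} (ht : t ∈ maxCompact p) :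
    cosetVolume μ l m t * besselVol α β γ (conjIwahori (elH p l m * t)) *
      ((p + 1) ^ 2 * (p ^ 2 + 1) : ℕ) = besselVol α β γ (maxCompact p) := by
  set g := elH p l m * t with hg
  have hΔ : Measure.modularCharacter g = 1 := by
    rw [hg, map_mul, modularCharacter_elH, modularCharacter_eq_one_of_mem_maxCompact ht, one_mul]
  have ho : IsOpen ((conjIwahori g ⊓ maxCompact p : Subgroup _) : Set (GSp4 ℚ_[p])) :=
    (isOpen_conjIwahori g).inter isOpen_maxCompact
  have hc : IsCompact ((conjIwahori g ⊓ maxCompact p : Subgroup _) : Set (GSp4 ℚ_[p])) :=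
    (isCompact_conjIwahori g).inter isCompact_maxCompact
  have key := measure_image_mul_measure_mul_measure (R := besselR !![α, β; β, γ])
    (isOpen_conjIwahori g) isOpen_maxCompact
    (Subgroup.relIndex_ne_zero_of_isOpen_of_isCompact ho (isCompact_conjIwahori g))
    (Subgroup.relIndex_ne_zero_of_isOpen_of_isCompact ho isCompact_maxCompact)
    (ae_mem_besselR h) (fun r hr => map_mul_right_besselVol h hr) map_mul_right_rightHaar
    (rightHaar_ne_zero ho ⟨1, one_mem _⟩) (rightHaar_ne_top ho hc)
    (π := BesselQuot.mk S) BesselQuot.mk_surjective (hS ▸ BesselQuot.mk_eq_iff)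
    (τ := BesselQuot.translate) BesselQuot.translate_mk
    (fun U hU => (BesselQuot.isOpen_image_mk hU).measurableSet) hμ.invariant
  have hK := measure_eq_relIndex_mul (R := ⊤) (η := rightHaar p) (iwahoriSubgroup_le (p := p))
    isOpen_iwahori.measurableSet
    (by rw [top_inf_eq, top_inf_eq, relIndex_iwahoriSubgroup]; positivity) (by simp)
    (fun g _ => map_mul_right_rightHaar g)
  rw [top_inf_eq, top_inf_eq, relIndex_iwahoriSubgroup] at hK
  have hcv : cosetVolume μ l m t = μ (BesselQuot.mk S '' conjIwahori g) := by
    unfold cosetVolume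
    rw [← hg, image_mk_mul_iwahori, hμ.invariant _ _
      (BesselQuot.isOpen_image_mk (isOpen_conjIwahori g)).measurableSet]
  rw [hμ.normalized, one_mul, rightHaar_conjIwahori hΔ, hK, ← hcv, ← mul_assoc] at key
  exact (ENNReal.mul_left_inj (rightHaar_ne_zero isOpen_iwahori ⟨1, one_mem (iwahoriSubgroup p)⟩)
    (rightHaar_ne_top isOpen_iwahori isCompact_iwahori)).mp key

theorem cosetVolume_eq_of_mem_iff (h : IsInertForm α β γ) (hS : matPadic p S = !![α, β; β, γ])
    {μ : Measure (BesselQuot p S)} (hμ : IsNormalizedInvariant μ) (l : ℤ) (m : ℕ)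
    {t : GSp4 ℚ_[p]} (ht : t ∈ maxCompact p) (f : ℚ_[p] × ℚ_[p] → ℚ_[p]) {j : ℕ} (hj : 0 < j)
    (a b c : ℤ)
    (hiff : ∀ w ∈ unitTorus p, ∀ n q r, besselElt α β γ (w, (n, q, r)) ∈
      conjIwahori (elH p l m * t) ↔ ‖w.2‖ ≤ (p : ℝ) ^ (-(j : ℤ)) ∧ ‖n‖ ≤ (p : ℝ) ^ (-a) ∧
        ‖q - f w‖ ≤ (p : ℝ) ^ (-b) ∧ ‖r‖ ≤ (p : ℝ) ^ (-c)) :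
    cosetVolume μ l m t =
      ENNReal.ofReal ((p : ℝ) ^ (j + a + b + c - 1) / (((p : ℝ) + 1) * ((p : ℝ) ^ 2 + 1))) := by
  have hpR := cast_prime_pos p
  have hp1 := one_lt_cast_prime p
  have hlt : (p : ℝ) ^ (-(1 : ℤ)) < 1 := zpow_lt_one_of_neg₀ hp1 (by omega)
  have hm : MeasurableSet (conjIwahori (elH p l m * t) : Set (GSp4 ℚ_[p])) :=
    (isOpen_conjIwahori _).measurableSet
  have key := cosetVolume_mul h hS hμ l m ht
  rw [besselVol_maxCompact h, besselVol_eq_of_norm_simil h hm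
    (fun g hg => norm_simil_of_mem_conjIwahori hg),
    besselVol₀_apply hm (measurableSet_norm_snd_le _) f a b c hiff,
    unitTorusVol_setOf_norm_snd_le hj, ← ENNReal.ofReal_mul
      (mul_nonneg (sub_nonneg.mpr hlt.le) (by positivity)), ← ENNReal.ofReal_natCast, mul_assoc,
    ← ENNReal.ofReal_mul (mul_nonneg (mul_nonneg (sub_nonneg.mpr hlt.le) (by positivity))
      (by positivity))] at key
  set D := (1 - (p : ℝ) ^ (-(1 : ℤ))) * (p : ℝ) ^ (-(j : ℤ)) * (p : ℝ) ^ (-(a + b + c)) *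
    (((p + 1) ^ 2 * (p ^ 2 + 1) : ℕ) : ℝ) with hD
  have hD0 : 0 < D := by
    have := sub_pos.mpr hlt
    positivity
  refine (ENNReal.mul_left_inj (ENNReal.ofReal_pos.mpr hD0).ne' ENNReal.ofReal_ne_top).mp ?_
  rw [key, ← ENNReal.ofReal_mul (by positivity)]
  congr 1
  have e : (p : ℝ) ^ (j + a + b + c - 1) * ((p : ℝ) ^ (-(j : ℤ)) * (p : ℝ) ^ (-(a + b + c))) =
      (p : ℝ) ^ (-(1 : ℤ)) := by
    rw [← zpow_add₀ hpR.ne', ← zpow_add₀ hpR.ne']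
    congr 1
    ring
  rw [hD]
  push_cast
  -- This factorization of the volume of K∩R is the source of the -1 in the exponent, and it cancels
  -- one of the two factors p + 1 of the index.
  calc 1 - (p : ℝ) ^ (-(2 : ℤ)) = (p : ℝ) ^ (-(1 : ℤ)) * (1 - (p : ℝ) ^ (-(1 : ℤ))) * (p + 1) := by
        rw [show -(2 : ℤ) = -1 + -1 by norm_num, zpow_add₀ hpR.ne', zpow_neg_one]
        field_simp
        ring
    _ = ((p : ℝ) ^ (j + a + b + c - 1) * ((p : ℝ) ^ (-(j : ℤ)) * (p : ℝ) ^ (-(a + b + c)))) *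
          (1 - (p : ℝ) ^ (-(1 : ℤ))) * (p + 1) := by rw [e]
    _ = _ := by
        field_simp

end BesselQuotient

/-! ### The groups tIt⁻¹ on block upper triangular matrices. -/

section IwahoriConj

/-- Allows a conjugate to be guessed and then verified without computing an inverse. -/
theorem mat4_inv_mul_mul {F : Type*} [Field F] {g x : GSp4 F} {M : Matrix (Fin 4) (Fin 4) F}
    (e : mat4 g * M = mat4 x * mat4 g) : mat4 (g⁻¹ * x * g) = M := by
  have h2 : mat4 g⁻¹ * mat4 g = 1 := by rw [← mat4_mul, inv_mul_cancel, mat4_one]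
  rw [mat4_mul, mat4_mul, Matrix.mul_assoc, ← e, ← Matrix.mul_assoc, h2, Matrix.one_mul]

variable {p : ℕ} [Fact p.Prime]

/-- Conjugation by t ∈ K preserves K, so beyond L ∈ K only the six congruences on M = t⁻¹Lt remain.
-/
theorem mem_conjIwahori_iff {t L : GSp4 ℚ_[p]} (ht : t ∈ maxCompact p)
    {M : Matrix (Fin 4) (Fin 4) ℚ_[p]} (e : mat4 t * M = mat4 L * mat4 t) :
    L ∈ conjIwahori t ↔ L ∈ maxCompact p ∧ ‖M 0 1‖ < 1 ∧ ‖M 2 0‖ < 1 ∧ ‖M 2 1‖ < 1 ∧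
      ‖M 3 0‖ < 1 ∧ ‖M 3 1‖ < 1 ∧ ‖M 3 2‖ < 1 := by
  have hM := mat4_inv_mul_mul e
  have hK : t⁻¹ * L * t ∈ maxCompact p ↔ L ∈ maxCompact p := by
    rw [Subgroup.mul_mem_cancel_right _ ht, Subgroup.mul_mem_cancel_left _ (inv_mem ht)]
  rw [mem_conjIwahori, ← hK, ← hM]
  rfl

theorem elZ_zero : elZ (some (0 : ℚ_[p])) = 1 := by
  refine GSp4.ext_matrix ?_
  change !![1, 0, 0, 0; 0, 1, 0, 0; 0, 0, 1, 0; 0, 0, -0, 1] = (1 : Matrix (Fin 4) (Fin 4) ℚ_[p])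
  ext i j
  fin_cases i <;> fin_cases j <;> simp

theorem elZ_mem_maxCompact_of_eq {y : Option ℚ_[p]} (hy : y = some 0 ∨ y = none) :
    elZ y ∈ maxCompact p := by
  rcases hy with rfl | rfl
  · rw [elZ_zero]
    exact one_mem _
  · exact elZ_none_mem_maxCompact

theorem elB_mem_maxCompact {n q r : ℚ_[p]} (hn : ‖n‖ ≤ 1) (hq : ‖q‖ ≤ 1) (hr : ‖r‖ ≤ 1)
    {y : Option ℚ_[p]} (hy : y = some 0 ∨ y = none) : elB n q r y ∈ maxCompact p :=
  mul_mem (mul_mem (mul_mem elJ_mem_maxCompact (elU_mem_maxCompact_iff.mpr ⟨hn, hq, hr⟩))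
    elJ_mem_maxCompact) (elZ_mem_maxCompact_of_eq hy)

theorem elA_mem_maxCompact {n q r : ℚ_[p]} (hn : ‖n‖ ≤ 1) (hq : ‖q‖ ≤ 1) (hr : ‖r‖ ≤ 1)
    {y : Option ℚ_[p]} (hy : y = some 0 ∨ y = none) : elA n q r y ∈ maxCompact p :=
  mul_mem (mul_mem (elU_mem_maxCompact_iff.mpr ⟨hn, hq, hr⟩) elJ_mem_maxCompact)
    (elZ_mem_maxCompact_of_eq hy)

theorem t₁_mem : (t₁ : GSp4 ℚ_[p]) ∈ maxCompact p :=
  elB_mem_maxCompact norm_one.le (by simp) (by simp) (.inl rfl)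
theorem t₂_mem : (t₂ : GSp4 ℚ_[p]) ∈ maxCompact p :=
  elB_mem_maxCompact norm_one.le (by simp) (by simp) (.inr rfl)
theorem t₃_mem : (t₃ : GSp4 ℚ_[p]) ∈ maxCompact p :=
  elB_mem_maxCompact (by simp) (by simp) norm_one.le (.inl rfl)
theorem t₄_mem : (t₄ : GSp4 ℚ_[p]) ∈ maxCompact p :=
  elB_mem_maxCompact (by simp) (by simp) norm_one.le (.inr rfl)
theorem t₅_mem : (t₅ : GSp4 ℚ_[p]) ∈ maxCompact p :=
  elB_mem_maxCompact (by simp) (by simp) (by simp) (.inl rfl)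
theorem t₆_mem : (t₆ : GSp4 ℚ_[p]) ∈ maxCompact p :=
  elB_mem_maxCompact (by simp) (by simp) (by simp) (.inr rfl)
theorem t₇_mem : (t₇ : GSp4 ℚ_[p]) ∈ maxCompact p :=
  elA_mem_maxCompact (by simp) (by simp) (by simp) (.inl rfl)
theorem t₈_mem : (t₈ : GSp4 ℚ_[p]) ∈ maxCompact p :=
  elA_mem_maxCompact (by simp) (by simp) (by simp) (.inr rfl)

theorem mat4_elB (n r : ℚ_[p]) : mat4 (elB n 0 r (some 0)) =
    !![-1, 0, 0, 0; 0, -1, 0, 0; n, 0, -1, 0; 0, r, 0, -1] := by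
  rw [elB, elZ_zero, mul_one]
  change J4 ℚ_[p] * !![1, 0, n, 0; 0, 1, 0, r; 0, 0, 1, 0; 0, 0, 0, 1] * J4 ℚ_[p] = _
  ext i j
  fin_cases i <;> fin_cases j <;> simp [J4, Matrix.mul_apply, Fin.sum_univ_four]

theorem mat4_elB_none (n r : ℚ_[p]) : mat4 (elB n 0 r none) =
    !![0, -1, 0, 0; -1, 0, 0, 0; 0, n, 0, -1; r, 0, -1, 0] := by
  change J4 ℚ_[p] * !![1, 0, n, 0; 0, 1, 0, r; 0, 0, 1, 0; 0, 0, 0, 1] * J4 ℚ_[p] *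
    !![0, 1, 0, 0; 1, 0, 0, 0; 0, 0, 0, 1; 0, 0, 1, 0] = _
  ext i j
  fin_cases i <;> fin_cases j <;> simp [J4, Matrix.mul_apply, Fin.sum_univ_four]

theorem mat4_t₇ : mat4 (t₇ : GSp4 ℚ_[p]) =
    !![0, 0, 1, 0; 0, 0, 0, 1; -1, 0, 0, 0; 0, -1, 0, 0] := by
  rw [t₇, elA, elZ_zero, mul_one, elU_zero, one_mul]
  change J4 ℚ_[p] = _
  ext i j
  fin_cases i <;> fin_cases j <;> simp [J4]

theorem mat4_t₈ : mat4 (t₈ : GSp4 ℚ_[p]) =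
    !![0, 0, 0, 1; 0, 0, 1, 0; 0, -1, 0, 0; -1, 0, 0, 0] := by
  rw [t₈, elA, elU_zero, one_mul]
  change J4 ℚ_[p] * !![0, 1, 0, 0; 1, 0, 0, 0; 0, 0, 0, 1; 0, 0, 1, 0] = _
  ext i j
  fin_cases i <;> fin_cases j <;> simp [J4, Matrix.mul_apply, Fin.sum_univ_four]

variable {L : GSp4 ℚ_[p]} {a b c d e f g h : ℚ_[p]}

/-- Here and for the other tᵢ, M is t⁻¹Lt written out; the conditions kept are its six Iwahori
entries, without zeros and repetitions. -/
theorem mem_conjIwahori_t₁ (hL : mat4 L = !![a, b, e, f; c, d, g, h; 0, 0, d, -c; 0, 0, -b, a]) :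
    L ∈ conjIwahori t₁ ↔ L ∈ maxCompact p ∧ ‖b‖ < 1 ∧ ‖a - e - d‖ < 1 := by
  rw [mem_conjIwahori_iff (M := !![a - e, b, e, f; c - g, d, g, h; a - e - d, b, d + e, f - c;
    b, 0, -b, a]) t₁_mem]
  · refine and_congr_right fun _ => ?_
    simp
    tauto
  · rw [hL, t₁, mat4_elB]
    ext i j
    fin_cases i <;> fin_cases j <;> simp [Matrix.mul_apply, Fin.sum_univ_four] <;> ring

theorem mem_conjIwahori_t₂ (hL : mat4 L = !![a, b, e, f; c, d, g, h; 0, 0, d, -c; 0, 0, -b, a]) :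
    L ∈ conjIwahori t₂ ↔ L ∈ maxCompact p ∧ ‖b‖ < 1 ∧ ‖a - e - d‖ < 1 ∧ ‖c - g‖ < 1 ∧
      ‖f - c‖ < 1 := by
  rw [mem_conjIwahori_iff (M := !![d, c - g, h, g; b, a - e, f, e; 0, b, a, -b;
    b, a - e - d, f - c, d + e]) t₂_mem]
  · refine and_congr_right fun _ => ?_
    simp
    tauto
  · rw [hL, t₂, mat4_elB_none]
    ext i j
    fin_cases i <;> fin_cases j <;> simp [Matrix.mul_apply, Fin.sum_univ_four] <;> ring

theorem mem_conjIwahori_t₃ (hL : mat4 L = !![a, b, e, f; c, d, g, h; 0, 0, d, -c; 0, 0, -b, a]) :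
    L ∈ conjIwahori t₃ ↔ L ∈ maxCompact p ∧ ‖c‖ < 1 ∧ ‖d - h - a‖ < 1 ∧ ‖b - f‖ < 1 ∧
      ‖g - b‖ < 1 := by
  rw [mem_conjIwahori_iff (M := !![a, b - f, e, f; c, d - h, g, h; 0, c, d, -c;
    c, d - h - a, g - b, h + a]) t₃_mem]
  · refine and_congr_right fun _ => ?_
    simp
    tauto
  · rw [hL, t₃, mat4_elB]
    ext i j
    fin_cases i <;> fin_cases j <;> simp [Matrix.mul_apply, Fin.sum_univ_four] <;> ring

theorem mem_conjIwahori_t₄ (hL : mat4 L = !![a, b, e, f; c, d, g, h; 0, 0, d, -c; 0, 0, -b, a]) :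
    L ∈ conjIwahori t₄ ↔ L ∈ maxCompact p ∧ ‖c‖ < 1 ∧ ‖d - h - a‖ < 1 := by
  rw [mem_conjIwahori_iff (M := !![d - h, c, h, g; b - f, a, f, e; d - h - a, c, h + a, g - b;
    c, 0, -c, d]) t₄_mem]
  · refine and_congr_right fun _ => ?_
    simp
    tauto
  · rw [hL, t₄, mat4_elB_none]
    ext i j
    fin_cases i <;> fin_cases j <;> simp [Matrix.mul_apply, Fin.sum_univ_four] <;> ring

theorem mem_conjIwahori_t₅ (hL : mat4 L = !![a, b, e, f; c, d, g, h; 0, 0, d, -c; 0, 0, -b, a]) :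
    L ∈ conjIwahori t₅ ↔ L ∈ maxCompact p ∧ ‖b‖ < 1 := by
  rw [mem_conjIwahori_iff (M := !![a, b, e, f; c, d, g, h; 0, 0, d, -c; 0, 0, -b, a]) t₅_mem]
  · refine and_congr_right fun _ => ?_
    simp
  · rw [hL, t₅, mat4_elB]
    ext i j
    fin_cases i <;> fin_cases j <;> simp [Matrix.mul_apply, Fin.sum_univ_four]

theorem mem_conjIwahori_t₆ (hL : mat4 L = !![a, b, e, f; c, d, g, h; 0, 0, d, -c; 0, 0, -b, a]) :
    L ∈ conjIwahori t₆ ↔ L ∈ maxCompact p ∧ ‖c‖ < 1 := by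
  rw [mem_conjIwahori_iff (M := !![d, c, h, g; b, a, f, e; 0, 0, a, -b; 0, 0, -c, d]) t₆_mem]
  · refine and_congr_right fun _ => ?_
    simp
  · rw [hL, t₆, mat4_elB_none]
    ext i j
    fin_cases i <;> fin_cases j <;> simp [Matrix.mul_apply, Fin.sum_univ_four]

theorem mem_conjIwahori_t₇ (hL : mat4 L = !![a, b, e, f; c, d, g, h; 0, 0, d, -c; 0, 0, -b, a]) :
    L ∈ conjIwahori t₇ ↔ L ∈ maxCompact p ∧ ‖c‖ < 1 ∧ ‖e‖ < 1 ∧ ‖f‖ < 1 ∧ ‖g‖ < 1 ∧ ‖h‖ < 1 := by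
  rw [mem_conjIwahori_iff (M := !![d, -c, 0, 0; -b, a, 0, 0; -e, -f, a, b; -g, -h, c, d]) t₇_mem]
  · refine and_congr_right fun _ => ?_
    simp
    tauto
  · rw [hL, mat4_t₇]
    ext i j
    fin_cases i <;> fin_cases j <;> simp [Matrix.mul_apply, Fin.sum_univ_four]

theorem mem_conjIwahori_t₈ (hL : mat4 L = !![a, b, e, f; c, d, g, h; 0, 0, d, -c; 0, 0, -b, a]) :
    L ∈ conjIwahori t₈ ↔ L ∈ maxCompact p ∧ ‖b‖ < 1 ∧ ‖e‖ < 1 ∧ ‖f‖ < 1 ∧ ‖g‖ < 1 ∧ ‖h‖ < 1 := by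
  rw [mem_conjIwahori_iff (M := !![a, -b, 0, 0; -c, d, 0, 0; -h, -g, d, c; -f, -e, b, a]) t₈_mem]
  · refine and_congr_right fun _ => ?_
    simp
    tauto
  · rw [hL, mat4_t₈]
    ext i j
    fin_cases i <;> fin_cases j <;> simp [Matrix.mul_apply, Fin.sum_univ_four]

end IwahoriConj

/-! ### Conjugation by h(l,m) as a rescaling of coordinates. -/

section ScaledCoordinates

variable {p : ℕ} [Fact p.Prime]

theorem elU_mul_elH (l : ℤ) (m : ℕ) (n q r : ℚ_[p]) :
    elU ((p : ℚ_[p]) ^ (2 * (m : ℤ) + l) * n) ((p : ℚ_[p]) ^ ((m : ℤ) + l) * q)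
      ((p : ℚ_[p]) ^ l * r) * elH p l m = elH p l m * elU n q r := by
  refine GSp4.ext_matrix ?_
  change mat4 (elU _ _ _) * mat4 (elH p l m) = mat4 (elH p l m) * mat4 (elU _ _ _)
  rw [mat4_elH, mat4_elU, mat4_elU]
  have e1 : (p : ℚ_[p]) ^ (2 * (m : ℤ) + l) =
      (p : ℚ_[p]) ^ l * (p : ℚ_[p]) ^ (m : ℤ) * (p : ℚ_[p]) ^ (m : ℤ) := by
    rw [← zpow_add₀ (cast_prime_ne_zero p), ← zpow_add₀ (cast_prime_ne_zero p)]
    congr 1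
    ring
  have e2 : (p : ℚ_[p]) ^ ((m : ℤ) + l) = (p : ℚ_[p]) ^ l * (p : ℚ_[p]) ^ (m : ℤ) := by
    rw [← zpow_add₀ (cast_prime_ne_zero p), add_comm]
  rw [e1, e2]
  generalize (p : ℚ_[p]) ^ l = s
  generalize (p : ℚ_[p]) ^ (m : ℤ) = u
  ext i j
  fin_cases i <;> fin_cases j <;> simp [Matrix.mul_apply, Fin.sum_univ_four] <;> ring

theorem mat4_elH_inv_mul_torElt_mul_elH {α β γ : ℚ_[p]} {w : ℚ_[p] × ℚ_[p]}
    (hw : torNorm α β γ w ≠ 0) (l : ℤ) (m : ℕ) :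
    mat4 ((elH p l m)⁻¹ * torElt α β γ w * elH p l m) =
      leviMat !![w.1 + w.2 * β, (p : ℚ_[p]) ^ (-(m : ℤ)) * (w.2 * γ);
        -((p : ℚ_[p]) ^ (m : ℤ) * (w.2 * α)), w.1 - w.2 * β] := by
  refine mat4_inv_mul_mul ?_
  rw [mat4_torElt hw, mat4_elH]
  have e1 : (p : ℚ_[p]) ^ (2 * (m : ℤ) + l) =
      (p : ℚ_[p]) ^ l * (p : ℚ_[p]) ^ (m : ℤ) * (p : ℚ_[p]) ^ (m : ℤ) := by
    rw [← zpow_add₀ (cast_prime_ne_zero p), ← zpow_add₀ (cast_prime_ne_zero p)]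
    congr 1
    ring
  have e2 : (p : ℚ_[p]) ^ ((m : ℤ) + l) = (p : ℚ_[p]) ^ l * (p : ℚ_[p]) ^ (m : ℤ) := by
    rw [← zpow_add₀ (cast_prime_ne_zero p), add_comm]
  have hu : (p : ℚ_[p]) ^ (m : ℤ) ≠ 0 := zpow_ne_zero _ (cast_prime_ne_zero p)
  rw [e1, e2, zpow_neg]
  generalize (p : ℚ_[p]) ^ l = s
  generalize (p : ℚ_[p]) ^ (m : ℤ) = u at *
  ext i j
  fin_cases i <;> fin_cases j <;>
    simp [leviMat, torMat, Matrix.mul_apply, Fin.sum_univ_four] <;> field_simp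

theorem norm_zpow_neg_mul_le_iff (k i : ℤ) (x : ℚ_[p]) :
    ‖(p : ℚ_[p]) ^ (-k) * x‖ ≤ (p : ℝ) ^ (-i) ↔ ‖x‖ ≤ (p : ℝ) ^ (-(k + i)) := by
  have hpR := cast_prime_pos p
  rw [norm_mul, Padic.norm_p_zpow, neg_neg, neg_add, zpow_add₀ hpR.ne', zpow_neg (p : ℝ) k,
    ← div_eq_inv_mul, le_div_iff₀' (by positivity)]

variable {α β γ : ℚ_[p]}

/-- If y is divisible by p, then x is a unit and both diagonal entries x ± yβ are congruent to it
modulo p. -/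
theorem IsInertForm.norm_add_of_norm_snd_lt (h : IsInertForm α β γ) {w : ℚ_[p] × ℚ_[p]}
    (hw : w ∈ unitTorus p) (hy : ‖w.2‖ < 1) : ‖w.1 + w.2 * β‖ = 1 ∧ ‖w.1 - w.2 * β‖ = 1 ∧
      ‖(w.1 + w.2 * β) - (w.1 - w.2 * β)‖ < 1 := by
  have hx : ‖w.1‖ = 1 := by
    have h1 : max ‖w.1‖ ‖w.2‖ = 1 := hw
    rcases max_choice ‖w.1‖ ‖w.2‖ with e | e
    · rw [← e, h1]
    · exact absurd (e.symm.trans h1) hy.ne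
  have hyb : ‖w.2 * β‖ < 1 := norm_mul_lt_one_left p hy h.norm_mid
  have h2 : ‖(w.1 + w.2 * β) - (w.1 - w.2 * β)‖ < 1 := by
    rw [show (w.1 + w.2 * β) - (w.1 - w.2 * β) = w.2 * β + w.2 * β by ring]
    exact (IsUltrametricDist.norm_add_le_max _ _).trans_lt (max_lt hyb hyb)
  refine ⟨?_, ?_, h2⟩
  · rw [IsUltrametricDist.norm_add_eq_max_of_norm_ne_norm (by rw [hx]; exact hyb.ne'), hx]
    exact max_eq_left hyb.le
  · rw [sub_eq_add_neg, IsUltrametricDist.norm_add_eq_max_of_norm_ne_norm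
      (by rw [hx, norm_neg]; exact hyb.ne'), hx, norm_neg]
    exact max_eq_left hyb.le

variable {S : Matrix (Fin 2) (Fin 2) ℚ}

/-- The matrix L is the conjugate by h(l,m)⁻¹ of an element of R, and a, b, c, d, n, q, r are its
rescaled coordinates. Undoing the rescaling adds m, 2m+l, m+l and l to the exponents for b, n, q, r,
in total 3l+4m. The assumption `hj` excludes the case where y may be a unit. -/
theorem cosetVolume_eq_of_scaled_iff (h : IsInertForm α β γ) (hS : matPadic p S = !![α, β; β, γ])
    {μ : Measure (BesselQuot p S)} (hμ : IsNormalizedInvariant μ) (l : ℤ) (m : ℕ)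
    {t : GSp4 ℚ_[p]} (ht : t ∈ maxCompact p) (f : ℚ_[p] × ℚ_[p] → ℚ_[p]) (j : ℕ)
    (i₁ i₂ i₃ : ℤ) (hj : 0 < m + j)
    (hiff : ∀ w ∈ unitTorus p, ∀ a b c d n q r : ℚ_[p], ∀ L : GSp4 ℚ_[p],
      a = w.1 + w.2 * β → b = (p : ℚ_[p]) ^ (-(m : ℤ)) * (w.2 * γ) →
      c = -((p : ℚ_[p]) ^ (m : ℤ) * (w.2 * α)) → d = w.1 - w.2 * β →
      ‖a‖ ≤ 1 → ‖d‖ ≤ 1 → ‖c‖ = (p : ℝ) ^ (-(m : ℤ)) * ‖w.2‖ →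
      ‖w.2‖ = (p : ℝ) ^ (-(m : ℤ)) * ‖b‖ →
      mat4 L = !![a, b, a * n + b * q, a * q + b * r; c, d, c * n + d * q, c * q + d * r;
        0, 0, d, -c; 0, 0, -b, a] →
      (L ∈ maxCompact p ↔ ‖b‖ ≤ 1 ∧ ‖n‖ ≤ 1 ∧ ‖q‖ ≤ 1 ∧ ‖r‖ ≤ 1) →
      (L ∈ conjIwahori t ↔ ‖b‖ ≤ (p : ℝ) ^ (-(j : ℤ)) ∧ ‖n‖ ≤ (p : ℝ) ^ (-i₁) ∧
        ‖q - f w‖ ≤ (p : ℝ) ^ (-i₂) ∧ ‖r‖ ≤ (p : ℝ) ^ (-i₃))) :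
    cosetVolume μ l m t = ENNReal.ofReal ((p : ℝ) ^ (3 * l + 4 * m + (j + i₁ + i₂ + i₃ - 1)) /
      (((p : ℝ) + 1) * ((p : ℝ) ^ 2 + 1))) := by
  have hp0 := cast_prime_ne_zero p
  have hpR := cast_prime_pos p
  rw [cosetVolume_eq_of_mem_iff h hS hμ l m ht (fun w => (p : ℚ_[p]) ^ ((m : ℤ) + l) * f w) hj
    (2 * m + l + i₁) (m + l + i₂) (l + i₃)]
  · congr 3
    push_cast
    ring
  intro w hw n q r
  have h0 := h.torNorm_ne_zero (ne_zero_of_mem_unitTorus hw)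
  have hT := torElt_mem_maxCompact h hw
  have hTe := fun i j => (mem_maxCompact_iff.mp hT).1 i j
  rw [mat4_torElt h0] at hTe
  have ha : ‖w.1 + w.2 * β‖ ≤ 1 := hTe 0 0
  have hd : ‖w.1 - w.2 * β‖ ≤ 1 := hTe 1 1
  have hcan : ∀ (k : ℤ) (z : ℚ_[p]), (p : ℚ_[p]) ^ k * ((p : ℚ_[p]) ^ (-k) * z) = z := by
    intro k z
    rw [← mul_assoc, ← zpow_add₀ hp0, add_neg_cancel, zpow_zero, one_mul]
  set n' := (p : ℚ_[p]) ^ (-(2 * (m : ℤ) + l)) * n with hn'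
  set q' := (p : ℚ_[p]) ^ (-((m : ℤ) + l)) * q with hq'
  set r' := (p : ℚ_[p]) ^ (-l) * r with hr'
  set b := (p : ℚ_[p]) ^ (-(m : ℤ)) * (w.2 * γ) with hb
  set c := -((p : ℚ_[p]) ^ (m : ℤ) * (w.2 * α)) with hc
  have hcn : ‖c‖ = (p : ℝ) ^ (-(m : ℤ)) * ‖w.2‖ := by
    rw [hc, norm_neg, norm_mul, Padic.norm_p_zpow, norm_mul, h.norm_left, mul_one]
  have hbn : ‖b‖ = (p : ℝ) ^ (m : ℤ) * ‖w.2‖ := by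
    rw [hb, norm_mul, Padic.norm_p_zpow, norm_mul, h.norm_right, mul_one, neg_neg]
  have hyn : ‖w.2‖ = (p : ℝ) ^ (-(m : ℤ)) * ‖b‖ := by
    rw [hbn, ← mul_assoc, ← zpow_add₀ hpR.ne', neg_add_cancel, zpow_zero, one_mul]
  have hy1 : ‖w.2‖ ≤ 1 := (le_max_right _ _).trans_eq hw
  have hc1 : ‖c‖ ≤ 1 := by
    rw [hcn]
    exact mul_le_one₀ (zpow_le_one_of_nonpos₀ (one_lt_cast_prime p).le (by omega))
      (norm_nonneg _) hy1
  set P := (elH p l m)⁻¹ * torElt α β γ w * elH p l m with hP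
  have hPm : mat4 P = leviMat !![w.1 + w.2 * β, b; c, w.1 - w.2 * β] :=
    mat4_elH_inv_mul_torElt_mul_elH h0 l m
  have hx : besselElt α β γ (w, (n, q, r)) ∈ conjIwahori (elH p l m * t) ↔
      P * elU n' q' r' ∈ conjIwahori t := by
    have hU := elU_mul_elH l m n' q' r'
    rw [hn', hq', hr', hcan, hcan, hcan, ← hn', ← hq', ← hr'] at hU
    have e : P * elU n' q' r' = (elH p l m)⁻¹ * besselElt α β γ (w, (n, q, r)) * elH p l m := by
      rw [hP, besselElt, mul_assoc _ (elH p l m), ← hU]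
      simp only [mul_assoc]
    rw [mem_conjIwahori, mem_conjIwahori, e, mul_inv_rev]
    simp only [mul_assoc]
  have hLm : mat4 (P * elU n' q' r') = !![w.1 + w.2 * β, b, (w.1 + w.2 * β) * n' + b * q',
      (w.1 + w.2 * β) * q' + b * r'; c, w.1 - w.2 * β, c * n' + (w.1 - w.2 * β) * q',
      c * q' + (w.1 - w.2 * β) * r'; 0, 0, w.1 - w.2 * β, -c; 0, 0, -b, w.1 + w.2 * β] := by
    rw [mat4_mul, hPm, mat4_elU]
    ext i j
    fin_cases i <;> fin_cases j <;> simp [leviMat, Matrix.mul_apply, Fin.sum_univ_four]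
  have hPs : ‖simil P‖ = 1 := by
    rw [hP, simil_mul, simil_mul, simil_inv, mul_comm, mul_inv_cancel_left₀ (simil_ne_zero _)]
    exact norm_simil_of_mem_maxCompact hT
  -- The only entry of the conjugated torus element that can fail to be integral is b, since c is
  -- made smaller by the factor p^m.
  have hPK : ‖b‖ ≤ 1 → P ∈ maxCompact p := by
    intro hb1
    rw [mem_maxCompact_iff]
    refine ⟨?_, hPs⟩
    rw [hPm]
    intro i j
    fin_cases i <;> fin_cases j <;>
      first
      | exact ha | exact hb1 | exact hc1 | exact hd
      | exact (norm_neg _).trans_le hb1 | exact (norm_neg _).trans_le hc1 | simp [leviMat]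
  have hLK : P * elU n' q' r' ∈ maxCompact p ↔ ‖b‖ ≤ 1 ∧ ‖n'‖ ≤ 1 ∧ ‖q'‖ ≤ 1 ∧ ‖r'‖ ≤ 1 := by
    constructor
    · intro hL
      have hb1 : ‖b‖ ≤ 1 := by
        have h1 := (mem_maxCompact_iff.mp hL).1 0 1
        rw [hLm] at h1
        exact h1
      exact ⟨hb1, elU_mem_maxCompact_iff.mp
        ((Subgroup.mul_mem_cancel_left _ (hPK hb1)).mp hL)⟩
    · rintro ⟨hb1, hU⟩
      exact mul_mem (hPK hb1) (elU_mem_maxCompact_iff.mpr hU)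
  have key := hiff w hw (w.1 + w.2 * β) b c (w.1 - w.2 * β) n' q' r' (P * elU n' q' r')
    rfl hb hc rfl ha hd hcn hyn hLm hLK
  have hbj : ‖b‖ ≤ (p : ℝ) ^ (-(j : ℤ)) ↔ ‖w.2‖ ≤ (p : ℝ) ^ (-((m + j : ℕ) : ℤ)) := by
    have h1 := norm_zpow_neg_mul_le_iff (m : ℤ) (j : ℤ) (w.2 * γ)
    rw [norm_mul w.2, h.norm_right, mul_one] at h1
    rw [hb, h1]
    push_cast
    rfl
  have hqf : q' - f w = (p : ℚ_[p]) ^ (-((m : ℤ) + l)) *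
      (q - (p : ℚ_[p]) ^ ((m : ℤ) + l) * f w) := by
    have := hcan (-((m : ℤ) + l)) (f w)
    rw [neg_neg] at this
    rw [mul_sub, this]
  rw [hx, key, hbj, hn', hr', hqf, norm_zpow_neg_mul_le_iff, norm_zpow_neg_mul_le_iff,
    norm_zpow_neg_mul_le_iff]

end ScaledCoordinates

/-! ### The eight coset volumes, by counting congruences. -/

section CosetVolumes

variable {p : ℕ} [Fact p.Prime]

theorem norm_add_lt_one {x y : ℚ_[p]} (hx : ‖x‖ < 1) (hy : ‖y‖ < 1) : ‖x + y‖ < 1 :=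
  (IsUltrametricDist.norm_add_le_max _ _).trans_lt (max_lt hx hy)

theorem norm_sub_lt_one {x y : ℚ_[p]} (hx : ‖x‖ < 1) (hy : ‖y‖ < 1) : ‖x - y‖ < 1 := by
  rw [sub_eq_add_neg]
  exact norm_add_lt_one hx (by rwa [norm_neg])

theorem norm_lt_one_iff_of_norm_sub_lt {u v : ℚ_[p]} (h : ‖u - v‖ < 1) :
    ‖u‖ < 1 ↔ ‖v‖ < 1 := by
  refine ⟨fun hu => ?_, fun hv => ?_⟩
  · rw [show v = u - (u - v) by ring]
    exact norm_sub_lt_one hu h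
  · rw [show u = (u - v) + v by ring]
    exact norm_add_lt_one h hv

theorem norm_unit_mul_lt_one_iff {u v : ℚ_[p]} (h : ‖u‖ = 1) : ‖u * v‖ < 1 ↔ ‖v‖ < 1 := by
  rw [norm_mul, h, one_mul]

theorem zpow_neg_mul_lt_one {m : ℕ} {x : ℝ} (hx : 0 ≤ x) (h : x < 1 ∨ 0 < m ∧ x ≤ 1) :
    (p : ℝ) ^ (-(m : ℤ)) * x < 1 := by
  have hp1 := one_lt_cast_prime p
  have hle : (p : ℝ) ^ (-(m : ℤ)) ≤ 1 := zpow_le_one_of_nonpos₀ hp1.le (by omega)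
  rcases h with h | ⟨hm, h⟩
  · exact (mul_le_of_le_one_left hx hle).trans_lt h
  · exact (mul_le_of_le_one_right (by positivity) h).trans_lt
      (zpow_lt_one_of_neg₀ hp1 (by omega))

variable {α β γ : ℚ_[p]} {S : Matrix (Fin 2) (Fin 2) ℚ}

/-- Once b ≡ 0 modulo p, the entries a and d are congruent units and the remaining condition becomes
n ≡ 0: two congruences. -/
theorem cosetVolume_t₁ (h : IsInertForm α β γ) (hS : matPadic p S = !![α, β; β, γ])
    {μ : Measure (BesselQuot p S)} (hμ : IsNormalizedInvariant μ) (l : ℤ) (m : ℕ) :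
    cosetVolume μ l m t₁ = ENNReal.ofReal ((p : ℝ) ^ (3 * l + 4 * m + (1 : ℤ)) /
      (((p : ℝ) + 1) * ((p : ℝ) ^ 2 + 1))) := by
  refine (cosetVolume_eq_of_scaled_iff h hS hμ l m t₁_mem (fun _ => 0) 1 1 0 0 (by omega) ?_).trans
    (by norm_num)
  intro w hw a b c d n q r L ha' hb' hc' hd' ha hd hc hy hL hK
  rw [mem_conjIwahori_t₁ hL, hK]
  simp only [Nat.cast_one, ← norm_lt_one_iff_le_inv, neg_zero, zpow_zero, sub_zero]
  have key : ‖b‖ < 1 → ‖q‖ ≤ 1 → (‖a - (a * n + b * q) - d‖ < 1 ↔ ‖n‖ < 1) := by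
    intro hb hq
    have hy1 : ‖w.2‖ < 1 := hy ▸ zpow_neg_mul_lt_one (norm_nonneg _) (.inl hb)
    obtain ⟨ha1, hd1, had⟩ := h.norm_add_of_norm_snd_lt hw hy1
    rw [← ha'] at ha1 had
    rw [← hd'] at had
    rw [norm_lt_one_iff_of_norm_sub_lt (v := -(a * n)), norm_neg, norm_unit_mul_lt_one_iff ha1]
    rw [show a - (a * n + b * q) - d - -(a * n) = (a - d) - b * q by ring]
    exact norm_sub_lt_one had (norm_mul_lt_one_left p hb hq)
  constructor
  · rintro ⟨⟨-, -, hq, hr⟩, hb, h1⟩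
    exact ⟨hb, (key hb hq).mp h1, hq, hr⟩
  · rintro ⟨hb, hn, hq, hr⟩
    exact ⟨⟨hb.le, hn.le, hq, hr⟩, hb, (key hb hq).mpr hn⟩

/-- With b ≡ 0, hence c ≡ 0, the last two conditions both say q ≡ 0. This leaves three congruences,
on b, n and q. -/
theorem cosetVolume_t₂ (h : IsInertForm α β γ) (hS : matPadic p S = !![α, β; β, γ])
    {μ : Measure (BesselQuot p S)} (hμ : IsNormalizedInvariant μ) (l : ℤ) (m : ℕ) :
    cosetVolume μ l m t₂ = ENNReal.ofReal ((p : ℝ) ^ (3 * l + 4 * m + (2 : ℤ)) /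
      (((p : ℝ) + 1) * ((p : ℝ) ^ 2 + 1))) := by
  refine (cosetVolume_eq_of_scaled_iff h hS hμ l m t₂_mem (fun _ => 0) 1 1 1 0 (by omega) ?_).trans
    (by norm_num)
  intro w hw a b c d n q r L ha' hb' hc' hd' ha hd hc hy hL hK
  rw [mem_conjIwahori_t₂ hL, hK]
  simp only [Nat.cast_one, ← norm_lt_one_iff_le_inv, neg_zero, zpow_zero, sub_zero]
  have key : ‖b‖ < 1 → ‖n‖ ≤ 1 → ‖q‖ ≤ 1 → ‖r‖ ≤ 1 →
      (‖a - (a * n + b * q) - d‖ < 1 ↔ ‖n‖ < 1) ∧ (‖c - (c * n + d * q)‖ < 1 ↔ ‖q‖ < 1) ∧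
        (‖a * q + b * r - c‖ < 1 ↔ ‖q‖ < 1) := by
    intro hb hn hq hr
    have hy1 : ‖w.2‖ < 1 := hy ▸ zpow_neg_mul_lt_one (norm_nonneg _) (.inl hb)
    have hc1 : ‖c‖ < 1 := hc ▸ zpow_neg_mul_lt_one (norm_nonneg _) (.inl hy1)
    obtain ⟨ha1, hd1, had⟩ := h.norm_add_of_norm_snd_lt hw hy1
    rw [← ha'] at ha1 had
    rw [← hd'] at hd1 had
    refine ⟨?_, ?_, ?_⟩
    · rw [norm_lt_one_iff_of_norm_sub_lt (v := -(a * n)), norm_neg, norm_unit_mul_lt_one_iff ha1]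
      rw [show a - (a * n + b * q) - d - -(a * n) = (a - d) - b * q by ring]
      exact norm_sub_lt_one had (norm_mul_lt_one_left p hb hq)
    · rw [norm_lt_one_iff_of_norm_sub_lt (v := -(d * q)), norm_neg, norm_unit_mul_lt_one_iff hd1]
      rw [show c - (c * n + d * q) - -(d * q) = c - c * n by ring]
      exact norm_sub_lt_one hc1 (norm_mul_lt_one_left p hc1 hn)
    · rw [norm_lt_one_iff_of_norm_sub_lt (v := a * q), norm_unit_mul_lt_one_iff ha1]
      rw [show a * q + b * r - c - a * q = b * r - c by ring]
      exact norm_sub_lt_one (norm_mul_lt_one_left p hb hr) hc1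
  constructor
  · rintro ⟨⟨-, hn, hq, hr⟩, hb, h1, h2, -⟩
    obtain ⟨k1, k2, -⟩ := key hb hn hq hr
    exact ⟨hb, k1.mp h1, k2.mp h2, hr⟩
  · rintro ⟨hb, hn, hq, hr⟩
    obtain ⟨k1, k2, k3⟩ := key hb hn.le hq.le hr
    exact ⟨⟨hb.le, hn.le, hq.le, hr⟩, hb, k1.mpr hn, k2.mpr hq, k3.mpr hq⟩

theorem cosetVolume_t₃ (h : IsInertForm α β γ) (hS : matPadic p S = !![α, β; β, γ])
    {μ : Measure (BesselQuot p S)} (hμ : IsNormalizedInvariant μ) (l : ℤ) {m : ℕ} (hm : 0 < m) :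
    cosetVolume μ l m t₃ = ENNReal.ofReal ((p : ℝ) ^ (3 * l + 4 * m + (1 : ℤ)) /
      (((p : ℝ) + 1) * ((p : ℝ) ^ 2 + 1))) := by
  refine (cosetVolume_eq_of_scaled_iff h hS hμ l m t₃_mem
    -- The centre is a⁻¹b. For m > 0 the coordinate b is unrestricted in ℤ_p, and modulo p the
    -- conditions become r ≡ 0 and aq ≡ b, so the ball for q moves with w.
    (fun w => (w.1 + w.2 * β)⁻¹ * ((p : ℚ_[p]) ^ (-(m : ℤ)) * (w.2 * γ))) 0 0 1 1
    (by omega) ?_).trans (by norm_num)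
  intro w hw a b c d n q r L ha' hb' hc' hd' ha hd hc hy hL hK
  rw [mem_conjIwahori_t₃ hL, hK]
  simp only [Nat.cast_zero, ← norm_lt_one_iff_le_inv, neg_zero, zpow_zero, ← ha', ← hb']
  have key : ‖b‖ ≤ 1 → ‖n‖ ≤ 1 → ‖q‖ ≤ 1 → ‖r‖ ≤ 1 → ‖c‖ < 1 ∧
      (‖d - (c * q + d * r) - a‖ < 1 ↔ ‖r‖ < 1) ∧
      (‖r‖ < 1 → (‖b - (a * q + b * r)‖ < 1 ↔ ‖q - a⁻¹ * b‖ < 1)) ∧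
      (‖c * n + d * q - b‖ < 1 ↔ ‖q - a⁻¹ * b‖ < 1) := by
    intro hb hn hq hr
    have hy1 : ‖w.2‖ < 1 := hy ▸ zpow_neg_mul_lt_one (norm_nonneg _) (.inr ⟨hm, hb⟩)
    have hc1 : ‖c‖ < 1 := hc ▸ zpow_neg_mul_lt_one (norm_nonneg _) (.inl hy1)
    obtain ⟨ha1, hd1, had⟩ := h.norm_add_of_norm_snd_lt hw hy1
    rw [← ha'] at ha1 had
    rw [← hd'] at hd1 had
    have ha0 : a ≠ 0 := norm_ne_zero_iff.mp (by rw [ha1]; exact one_ne_zero)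
    have hqa : ‖q - a⁻¹ * b‖ < 1 ↔ ‖a * q - b‖ < 1 := by
      rw [← norm_unit_mul_lt_one_iff ha1, mul_sub, mul_inv_cancel_left₀ ha0]
    refine ⟨hc1, ?_, fun hr1 => ?_, ?_⟩
    · rw [norm_lt_one_iff_of_norm_sub_lt (v := -(d * r)), norm_neg, norm_unit_mul_lt_one_iff hd1]
      rw [show d - (c * q + d * r) - a - -(d * r) = -((a - d) + c * q) by ring, norm_neg]
      exact norm_add_lt_one had (norm_mul_lt_one_left p hc1 hq)
    · rw [hqa, norm_lt_one_iff_of_norm_sub_lt (v := -(a * q - b)), norm_neg]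
      rw [show b - (a * q + b * r) - -(a * q - b) = -(b * r) by ring, norm_neg]
      exact norm_mul_lt_one_right p hb hr1
    · rw [hqa, norm_lt_one_iff_of_norm_sub_lt (v := a * q - b)]
      rw [show c * n + d * q - b - (a * q - b) = c * n - (a - d) * q by ring]
      exact norm_sub_lt_one (norm_mul_lt_one_left p hc1 hn) (norm_mul_lt_one_left p had hq)
  constructor
  · rintro ⟨⟨hb, hn, hq, hr⟩, -, h1, -, h3⟩
    obtain ⟨-, k1, -, k3⟩ := key hb hn hq hr
    exact ⟨hb, hn, k3.mp h3, k1.mp h1⟩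
  · rintro ⟨hb, hn, hq, hr⟩
    -- Integrality of q is not one of the target conditions; it follows because the centre a⁻¹b is
    -- integral.
    have hq' : ‖q‖ ≤ 1 := by
      have hy1 : ‖w.2‖ < 1 := hy ▸ zpow_neg_mul_lt_one (norm_nonneg _) (.inr ⟨hm, hb⟩)
      have ha1 := (h.norm_add_of_norm_snd_lt hw hy1).1
      rw [← ha'] at ha1
      rw [show q = (q - a⁻¹ * b) + a⁻¹ * b by ring]
      refine (IsUltrametricDist.norm_add_le_max _ _).trans (max_le hq.le ?_)
      rwa [norm_mul, norm_inv, ha1, inv_one, one_mul]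
    obtain ⟨hc1, k1, k2, k3⟩ := key hb hn hq' hr.le
    exact ⟨⟨hb, hn, hq', hr.le⟩, hc1, k1.mpr hr, (k2 hr).mpr hq, k3.mpr hq⟩

theorem cosetVolume_t₄ (h : IsInertForm α β γ) (hS : matPadic p S = !![α, β; β, γ])
    {μ : Measure (BesselQuot p S)} (hμ : IsNormalizedInvariant μ) (l : ℤ) {m : ℕ} (hm : 0 < m) :
    cosetVolume μ l m t₄ = ENNReal.ofReal ((p : ℝ) ^ (3 * l + 4 * m + (0 : ℤ)) /
      (((p : ℝ) + 1) * ((p : ℝ) ^ 2 + 1))) := by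
  refine (cosetVolume_eq_of_scaled_iff h hS hμ l m t₄_mem (fun _ => 0) 0 0 0 1 (by omega) ?_).trans
    (by norm_num)
  intro w hw a b c d n q r L ha' hb' hc' hd' ha hd hc hy hL hK
  rw [mem_conjIwahori_t₄ hL, hK]
  simp only [Nat.cast_zero, ← norm_lt_one_iff_le_inv, neg_zero, zpow_zero, sub_zero]
  have key : ‖b‖ ≤ 1 → ‖q‖ ≤ 1 → ‖c‖ < 1 ∧ (‖d - (c * q + d * r) - a‖ < 1 ↔ ‖r‖ < 1) := by
    intro hb hq
    have hy1 : ‖w.2‖ < 1 := hy ▸ zpow_neg_mul_lt_one (norm_nonneg _) (.inr ⟨hm, hb⟩)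
    have hc1 : ‖c‖ < 1 := hc ▸ zpow_neg_mul_lt_one (norm_nonneg _) (.inl hy1)
    obtain ⟨ha1, hd1, had⟩ := h.norm_add_of_norm_snd_lt hw hy1
    rw [← ha'] at had
    rw [← hd'] at hd1 had
    refine ⟨hc1, ?_⟩
    rw [norm_lt_one_iff_of_norm_sub_lt (v := -(d * r)), norm_neg, norm_unit_mul_lt_one_iff hd1]
    rw [show d - (c * q + d * r) - a - -(d * r) = -((a - d) + c * q) by ring, norm_neg]
    exact norm_add_lt_one had (norm_mul_lt_one_left p hc1 hq)
  constructor
  · rintro ⟨⟨hb, hn, hq, -⟩, -, h1⟩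
    exact ⟨hb, hn, hq, (key hb hq).2.mp h1⟩
  · rintro ⟨hb, hn, hq, hr⟩
    exact ⟨⟨hb, hn, hq, hr.le⟩, (key hb hq).1, (key hb hq).2.mpr hr⟩

theorem cosetVolume_t₅ (h : IsInertForm α β γ) (hS : matPadic p S = !![α, β; β, γ])
    {μ : Measure (BesselQuot p S)} (hμ : IsNormalizedInvariant μ) (l : ℤ) (m : ℕ) :
    cosetVolume μ l m t₅ = ENNReal.ofReal ((p : ℝ) ^ (3 * l + 4 * m + (0 : ℤ)) /
      (((p : ℝ) + 1) * ((p : ℝ) ^ 2 + 1))) := by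
  refine (cosetVolume_eq_of_scaled_iff h hS hμ l m t₅_mem (fun _ => 0) 1 0 0 0 (by omega) ?_).trans
    (by norm_num)
  intro w hw a b c d n q r L ha' hb' hc' hd' ha hd hc hy hL hK
  rw [mem_conjIwahori_t₅ hL, hK]
  simp only [Nat.cast_one, ← norm_lt_one_iff_le_inv, neg_zero, zpow_zero, sub_zero]
  exact ⟨fun H => ⟨H.2, H.1.2⟩, fun H => ⟨⟨H.1.le, H.2⟩, H.1⟩⟩

/-- For m > 0 an integral b forces y, and so c, to be divisible by p: no congruence is left, hence
the exponent -1. -/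
theorem cosetVolume_t₆ (h : IsInertForm α β γ) (hS : matPadic p S = !![α, β; β, γ])
    {μ : Measure (BesselQuot p S)} (hμ : IsNormalizedInvariant μ) (l : ℤ) {m : ℕ} (hm : 0 < m) :
    cosetVolume μ l m t₆ = ENNReal.ofReal ((p : ℝ) ^ (3 * l + 4 * m + (-1 : ℤ)) /
      (((p : ℝ) + 1) * ((p : ℝ) ^ 2 + 1))) := by
  refine (cosetVolume_eq_of_scaled_iff h hS hμ l m t₆_mem (fun _ => 0) 0 0 0 0 (by omega) ?_).trans
    (by norm_num)
  intro w hw a b c d n q r L ha' hb' hc' hd' ha hd hc hy hL hK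
  rw [mem_conjIwahori_t₆ hL, hK]
  simp only [Nat.cast_zero, neg_zero, zpow_zero, sub_zero]
  refine and_iff_left_of_imp fun H => ?_
  exact hc ▸ zpow_neg_mul_lt_one (norm_nonneg _)
    (.inl (hy ▸ zpow_neg_mul_lt_one (norm_nonneg _) (.inr ⟨hm, H.1⟩)))

/-- The four entries form the product of an integral 2×2 matrix of unit determinant with the
symmetric matrix of n, q, r; Cramer's rule gives the nontrivial direction. -/
theorem forall_norm_lt_one_iff {a b c d n q r : ℚ_[p]} (ha : ‖a‖ ≤ 1) (hb : ‖b‖ ≤ 1)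
    (hc : ‖c‖ ≤ 1) (hd : ‖d‖ ≤ 1) (hdet : ‖a * d - b * c‖ = 1) :
    (‖a * n + b * q‖ < 1 ∧ ‖a * q + b * r‖ < 1 ∧ ‖c * n + d * q‖ < 1 ∧ ‖c * q + d * r‖ < 1) ↔
      ‖n‖ < 1 ∧ ‖q‖ < 1 ∧ ‖r‖ < 1 := by
  constructor
  · rintro ⟨h1, h2, h3, h4⟩
    refine ⟨?_, ?_, ?_⟩
    · rw [← norm_unit_mul_lt_one_iff hdet,
        show (a * d - b * c) * n = d * (a * n + b * q) - b * (c * n + d * q) by ring]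
      exact norm_sub_lt_one (norm_mul_lt_one_right p hd h1) (norm_mul_lt_one_right p hb h3)
    · rw [← norm_unit_mul_lt_one_iff hdet,
        show (a * d - b * c) * q = d * (a * q + b * r) - b * (c * q + d * r) by ring]
      exact norm_sub_lt_one (norm_mul_lt_one_right p hd h2) (norm_mul_lt_one_right p hb h4)
    · rw [← norm_unit_mul_lt_one_iff hdet,
        show (a * d - b * c) * r = a * (c * q + d * r) - c * (a * q + b * r) by ring]
      exact norm_sub_lt_one (norm_mul_lt_one_right p ha h4) (norm_mul_lt_one_right p hc h2)
  · rintro ⟨hn, hq, hr⟩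
    exact ⟨norm_add_lt_one (norm_mul_lt_one_right p ha hn) (norm_mul_lt_one_right p hb hq),
      norm_add_lt_one (norm_mul_lt_one_right p ha hq) (norm_mul_lt_one_right p hb hr),
      norm_add_lt_one (norm_mul_lt_one_right p hc hn) (norm_mul_lt_one_right p hd hq),
      norm_add_lt_one (norm_mul_lt_one_right p hc hq) (norm_mul_lt_one_right p hd hr)⟩

theorem IsInertForm.norm_det_scaled (h : IsInertForm α β γ) {w : ℚ_[p] × ℚ_[p]}
    (hw : w ∈ unitTorus p) {m : ℕ} {a b c d : ℚ_[p]} (ha : a = w.1 + w.2 * β)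
    (hb : b = (p : ℚ_[p]) ^ (-(m : ℤ)) * (w.2 * γ)) (hc : c = -((p : ℚ_[p]) ^ (m : ℤ) * (w.2 * α)))
    (hd : d = w.1 - w.2 * β) : ‖a * d - b * c‖ = 1 := by
  have hu : (p : ℚ_[p]) ^ (-(m : ℤ)) * (p : ℚ_[p]) ^ (m : ℤ) = 1 := by
    rw [← zpow_add₀ (cast_prime_ne_zero p), neg_add_cancel, zpow_zero]
  have e : a * d - b * c = torNorm α β γ w := by
    rw [ha, hb, hc, hd, torNorm]
    linear_combination (w.2 * γ * (w.2 * α)) * hu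
  rw [e, h.norm_torNorm, show ‖w‖ = 1 from hw, one_pow]

theorem norm_le_one_of_eq_zpow_mul {m : ℕ} {c y : ℚ_[p]} (hy : ‖y‖ ≤ 1)
    (hc : ‖c‖ = (p : ℝ) ^ (-(m : ℤ)) * ‖y‖) : ‖c‖ ≤ 1 := by
  rw [hc]
  exact mul_le_one₀ (zpow_le_one_of_nonpos₀ (one_lt_cast_prime p).le (by omega)) (norm_nonneg _) hy

theorem cosetVolume_t₇ (h : IsInertForm α β γ) (hS : matPadic p S = !![α, β; β, γ])
    {μ : Measure (BesselQuot p S)} (hμ : IsNormalizedInvariant μ) (l : ℤ) {m : ℕ} (hm : 0 < m) :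
    cosetVolume μ l m t₇ = ENNReal.ofReal ((p : ℝ) ^ (3 * l + 4 * m + (2 : ℤ)) /
      (((p : ℝ) + 1) * ((p : ℝ) ^ 2 + 1))) := by
  refine (cosetVolume_eq_of_scaled_iff h hS hμ l m t₇_mem (fun _ => 0) 0 1 1 1 (by omega) ?_).trans
    (by norm_num)
  intro w hw a b c d n q r L ha' hb' hc' hd' ha hd hc hy hL hK
  rw [mem_conjIwahori_t₇ hL, hK]
  simp only [Nat.cast_zero, ← norm_lt_one_iff_le_inv, neg_zero, zpow_zero, sub_zero]
  have hdet := h.norm_det_scaled hw ha' hb' hc' hd'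
  have hc1 := norm_le_one_of_eq_zpow_mul ((le_max_right _ _).trans_eq hw) hc
  constructor
  · rintro ⟨⟨hb, -⟩, -, H⟩
    exact ⟨hb, (forall_norm_lt_one_iff ha hb hc1 hd hdet).mp H⟩
  · rintro ⟨hb, hn, hq, hr⟩
    refine ⟨⟨hb, hn.le, hq.le, hr.le⟩, ?_,
      (forall_norm_lt_one_iff ha hb hc1 hd hdet).mpr ⟨hn, hq, hr⟩⟩
    exact hc ▸ zpow_neg_mul_lt_one (norm_nonneg _)
      (.inl (hy ▸ zpow_neg_mul_lt_one (norm_nonneg _) (.inr ⟨hm, hb⟩)))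

/-- For m = 0 the entries b and c have the same absolute value, so c ≡ 0 is no longer automatic and
acts as a fourth congruence b ≡ 0. -/
theorem cosetVolume_t₇_zero (h : IsInertForm α β γ) (hS : matPadic p S = !![α, β; β, γ])
    {μ : Measure (BesselQuot p S)} (hμ : IsNormalizedInvariant μ) (l : ℤ) :
    cosetVolume μ l 0 t₇ = ENNReal.ofReal ((p : ℝ) ^ (3 * l + (3 : ℤ)) /
      (((p : ℝ) + 1) * ((p : ℝ) ^ 2 + 1))) := by
  refine (cosetVolume_eq_of_scaled_iff h hS hμ l 0 t₇_mem (fun _ => 0) 1 1 1 1 (by omega) ?_).trans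
    (by norm_num)
  intro w hw a b c d n q r L ha' hb' hc' hd' ha hd hc hy hL hK
  rw [mem_conjIwahori_t₇ hL, hK]
  simp only [Nat.cast_one, ← norm_lt_one_iff_le_inv, sub_zero]
  have hdet := h.norm_det_scaled hw ha' hb' hc' hd'
  have hc1 := norm_le_one_of_eq_zpow_mul ((le_max_right _ _).trans_eq hw) hc
  have hcb : ‖c‖ = ‖b‖ := by simpa [hy] using hc
  rw [hcb]
  constructor
  · rintro ⟨⟨hb, -⟩, hb', H⟩
    exact ⟨hb', (forall_norm_lt_one_iff ha hb hc1 hd hdet).mp H⟩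
  · rintro ⟨hb, hn, hq, hr⟩
    exact ⟨⟨hb.le, hn.le, hq.le, hr.le⟩, hb,
      (forall_norm_lt_one_iff ha hb.le hc1 hd hdet).mpr ⟨hn, hq, hr⟩⟩

theorem cosetVolume_t₈ (h : IsInertForm α β γ) (hS : matPadic p S = !![α, β; β, γ])
    {μ : Measure (BesselQuot p S)} (hμ : IsNormalizedInvariant μ) (l : ℤ) (m : ℕ) :
    cosetVolume μ l m t₈ = ENNReal.ofReal ((p : ℝ) ^ (3 * l + 4 * m + (3 : ℤ)) /
      (((p : ℝ) + 1) * ((p : ℝ) ^ 2 + 1))) := by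
  refine (cosetVolume_eq_of_scaled_iff h hS hμ l m t₈_mem (fun _ => 0) 1 1 1 1 (by omega) ?_).trans
    (by norm_num)
  intro w hw a b c d n q r L ha' hb' hc' hd' ha hd hc hy hL hK
  rw [mem_conjIwahori_t₈ hL, hK]
  simp only [Nat.cast_one, ← norm_lt_one_iff_le_inv, sub_zero]
  have hdet := h.norm_det_scaled hw ha' hb' hc' hd'
  have hc1 := norm_le_one_of_eq_zpow_mul ((le_max_right _ _).trans_eq hw) hc
  constructor
  · rintro ⟨-, hb, H⟩
    exact ⟨hb, (forall_norm_lt_one_iff ha hb.le hc1 hd hdet).mp H⟩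
  · rintro ⟨hb, hn, hq, hr⟩
    exact ⟨⟨hb.le, hn.le, hq.le, hr.le⟩, hb,
      (forall_norm_lt_one_iff ha hb.le hc1 hd hdet).mpr ⟨hn, hq, hr⟩⟩

end CosetVolumes

/-! ### From inertness to the norm form, and the conclusion. -/

section InertForm

variable {p : ℕ} [Fact p.Prime]

/-- Everything follows from u² + 4 det S being a unit for every integral u. -/
theorem isInertForm_of_isInertIn (hp : p ≠ 2) {S : Matrix (Fin 2) (Fin 2) ℚ} (hS : S.IsSymm)
    (hinert : IsInertIn p (-(4 * S.det))) (hint : ∀ i j, ‖((S i j : ℚ) : ℚ_[p])‖ ≤ 1)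
    (hdisc : ‖((4 * S.det : ℚ) : ℚ_[p])‖ = 1) :
    IsInertForm ((S 0 0 : ℚ) : ℚ_[p]) ((S 0 1 : ℚ) : ℚ_[p]) ((S 1 1 : ℚ) : ℚ_[p]) := by
  have hs : S 1 0 = S 0 1 := hS.apply 0 1
  have hsq : ∀ a : ℚ_[p], ‖a‖ ≤ 1 → ‖a ^ 2 - ((-(4 * S.det) : ℚ) : ℚ_[p])‖ = 1 := fun a ha =>
    norm_sq_sub_eq_one hp hinert (by rw [Rat.cast_neg, norm_neg]; exact hdisc) ha
  have hα := hint 0 0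
  have hβ := hint 0 1
  have hγ := hint 1 1
  have hdet : ((-(4 * S.det) : ℚ) : ℚ_[p]) = -(4 * (((S 0 0 : ℚ) : ℚ_[p]) *
      ((S 1 1 : ℚ) : ℚ_[p]) - ((S 0 1 : ℚ) : ℚ_[p]) ^ 2)) := by
    rw [Matrix.det_fin_two, hs]
    push_cast
    ring
  have hδ : ‖((-(4 * S.det) : ℚ) : ℚ_[p])‖ = 1 := by rw [Rat.cast_neg, norm_neg]; exact hdisc
  rw [hdet] at hsq hδ
  generalize ((S 0 0 : ℚ) : ℚ_[p]) = α at *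
  generalize ((S 0 1 : ℚ) : ℚ_[p]) = β at *
  generalize ((S 1 1 : ℚ) : ℚ_[p]) = γ at *
  have h2 : ‖(2 : ℚ_[p])‖ ≤ 1 := by exact_mod_cast Padic.norm_int_le_one 2
  have h4 : ‖(4 : ℚ_[p])‖ ≤ 1 := by exact_mod_cast Padic.norm_int_le_one 4
  -- With u = 2β the unit u² + 4 det S equals 4αγ, so 4, α and γ, being integral, are all units.
  have hprod : ‖(4 : ℚ_[p])‖ * (‖α‖ * ‖γ‖) = 1 := by
    rw [← norm_mul, ← norm_mul, ← hsq (2 * β) (norm_mul_le_one' p h2 hβ)]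
    congr 1
    ring
  have h4' : ‖(4 : ℚ_[p])‖ = 1 := by
    refine le_antisymm h4 (hprod ▸ mul_le_of_le_one_right (norm_nonneg _) ?_)
    exact mul_le_one₀ hα (norm_nonneg _) hγ
  rw [h4', one_mul] at hprod
  have hα' : ‖α‖ = 1 := le_antisymm hα (hprod ▸ mul_le_of_le_one_right (norm_nonneg _) hγ)
  have hγ' : ‖γ‖ = 1 := by rwa [hα', one_mul] at hprod
  rw [norm_neg, norm_mul, h4', one_mul] at hδ
  refine ⟨hα', hβ, hγ', ?_⟩
  rintro ⟨x, y⟩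
  rw [torNorm, Prod.norm_mk]
  dsimp only
  rcases lt_or_ge ‖y‖ ‖x‖ with h | h
  · have hlt : ‖y ^ 2 * (α * γ - β ^ 2)‖ < ‖x ^ 2‖ := by
      rw [norm_mul, hδ, mul_one, norm_pow, norm_pow]
      gcongr
    rw [IsUltrametricDist.norm_add_eq_max_of_norm_ne_norm hlt.ne', max_eq_left hlt.le,
      max_eq_left h.le, norm_pow]
  · rw [max_eq_right h]
    rcases eq_or_ne y 0 with rfl | hy
    · have hx : x = 0 := norm_le_zero_iff.mp (by simpa using h)
      simp [hx]
    · have hy' : 0 < ‖y‖ := norm_pos_iff.mpr hy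
      have hxy : ‖2 * (x / y)‖ ≤ 1 := by
        refine norm_mul_le_one' p h2 ?_
        rw [norm_div]
        exact div_le_one_of_le₀ h hy'.le
      -- When |x| ≤ |y|, factoring out y² leaves the unit with u = 2x/y; when |x| > |y|, the term x²
      -- dominates.
      have e : 4 * (x ^ 2 + y ^ 2 * (α * γ - β ^ 2)) =
          y ^ 2 * ((2 * (x / y)) ^ 2 - -(4 * (α * γ - β ^ 2))) := by
        field_simp
        ring
      have h5 := congrArg norm e
      rwa [norm_mul, h4', one_mul, norm_mul, hsq _ hxy, mul_one, norm_pow] at h5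

theorem matPadic_eq {S : Matrix (Fin 2) (Fin 2) ℚ} (hS : S.IsSymm) :
    matPadic p S = !![((S 0 0 : ℚ) : ℚ_[p]), ((S 0 1 : ℚ) : ℚ_[p]);
      ((S 0 1 : ℚ) : ℚ_[p]), ((S 1 1 : ℚ) : ℚ_[p])] := by
  have hs : S 1 0 = S 0 1 := hS.apply 0 1
  ext i j
  fin_cases i <;> fin_cases j <;> simp [matPadic, hs]

theorem zpow_mul_volM (l : ℤ) (m : ℕ) (k : ℤ) :
    (p : ℝ) ^ (3 * l + 4 * m + k) / (((p : ℝ) + 1) * ((p : ℝ) ^ 2 + 1)) =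
      (p : ℝ) ^ k * volM p l m := by
  rw [volM, zpow_add₀ (cast_prime_pos p).ne']
  ring

end InertForm

theorem mainTheorem9 (p : ℕ) [Fact p.Prime] (hp : p ≠ 2)
    (S : Matrix (Fin 2) (Fin 2) ℚ) (hS : S.IsSymm)
    (hinert : IsInertIn p (-(4 * S.det)))
    (hint : ∀ i j, ‖((S i j : ℚ) : ℚ_[p])‖ ≤ 1)
    (hdisc : ‖((4 * S.det : ℚ) : ℚ_[p])‖ = 1) :
    (∃ μ : Measure (BesselQuot p S), IsNormalizedInvariant μ) ∧
    ∀ μ : Measure (BesselQuot p S), IsNormalizedInvariant μ →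
      (∀ (l : ℤ) (m : ℕ), 0 < m →
        cosetVolume μ l m t₁ = ENNReal.ofReal ((p : ℝ) * volM p l m) ∧
        cosetVolume μ l m t₂ = ENNReal.ofReal ((p : ℝ) ^ 2 * volM p l m) ∧
        cosetVolume μ l m t₃ = ENNReal.ofReal ((p : ℝ) * volM p l m) ∧
        cosetVolume μ l m t₄ = ENNReal.ofReal (volM p l m) ∧
        cosetVolume μ l m t₅ = ENNReal.ofReal (volM p l m) ∧
        cosetVolume μ l m t₆ = ENNReal.ofReal ((p : ℝ)⁻¹ * volM p l m) ∧
        cosetVolume μ l m t₇ = ENNReal.ofReal ((p : ℝ) ^ 2 * volM p l m) ∧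
        cosetVolume μ l m t₈ = ENNReal.ofReal ((p : ℝ) ^ 3 * volM p l m)) ∧
      (∀ l : ℤ,
        cosetVolume μ l 0 t₁ =
          ENNReal.ofReal ((p : ℝ) ^ (3 * l + 1) / (((p : ℝ) + 1) * ((p : ℝ) ^ 2 + 1))) ∧
        cosetVolume μ l 0 t₂ =
          ENNReal.ofReal ((p : ℝ) ^ (3 * l + 2) / (((p : ℝ) + 1) * ((p : ℝ) ^ 2 + 1))) ∧
        cosetVolume μ l 0 t₅ =
          ENNReal.ofReal ((p : ℝ) ^ (3 * l) / (((p : ℝ) + 1) * ((p : ℝ) ^ 2 + 1))) ∧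
        cosetVolume μ l 0 t₇ =
          ENNReal.ofReal ((p : ℝ) ^ (3 * l + 3) / (((p : ℝ) + 1) * ((p : ℝ) ^ 2 + 1)))) := by
  have h := isInertForm_of_isInertIn hp hS hinert hint hdisc
  have hM := matPadic_eq (p := p) hS
  refine ⟨exists_isNormalizedInvariant h hM, fun μ hμ => ⟨fun l m hm => ?_, fun l => ?_⟩⟩
  · rw [cosetVolume_t₁ h hM hμ, cosetVolume_t₂ h hM hμ, cosetVolume_t₃ h hM hμ l hm,
      cosetVolume_t₄ h hM hμ l hm, cosetVolume_t₅ h hM hμ, cosetVolume_t₆ h hM hμ l hm,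
      cosetVolume_t₇ h hM hμ l hm, cosetVolume_t₈ h hM hμ]
    simp only [zpow_mul_volM, zpow_neg_one, zpow_ofNat, pow_one, pow_zero, one_mul, and_self]
  · rw [cosetVolume_t₁ h hM hμ, cosetVolume_t₂ h hM hμ, cosetVolume_t₅ h hM hμ,
      cosetVolume_t₇_zero h hM hμ]
    simp
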